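/- **Conventions.** $\mathcal A$ is an (ungraded) dg algebra over $\mathbb F_2$ with ring of idempotents $\mathbf k$. A type $D$ structure over $\mathcal A$ is a $\mathbf k$-module $M$ with a map $\delta^1\colon M\to A\otimes_{\mathbf k} M$ such that $(\mu\otimes \mathbb I)(\mathbb I\otimes\delta^1)\delta^1+(\partial\otimes\mathbb I)\delta^1=0$; morphism spaces consist of all $\mathbf k$-linear maps $M\to A\otimes N$ with the usual differential, morphisms are cycles, a homotopy $H$ from $\varphi$ to $\varphi'$ satisfies $\varphi+\varphi'=dH$, and ${}^{\mathcal A}\mathsf{Mod}$ consists of the type $D$ structures homotopy equivalent to a bounded one. $\mathcal T$ is the path algebra over $\mathbb F_2$ of the quiver with vertices $\iota_0,\iota_1$ and arrows $f,h\colon\iota_0\to\iota_1$, $g\colon\iota_1\to\iota_0$, modulo $gf=hg=0$ (a word is read as a path from left to right). A $DD$ bimodule over $(\mathcal A,\mathcal T)$ is a type $D$ structure over $\mathcal A\otimes\mathcal T$, and ${}^{\mathcal A}\mathsf{Mod}^{\mathcal T}$ consists of those homotopy equivalent to a bounded one. **Geometry.** $\mathsf{ContDiffBorSut}$ has bordered-sutured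 three-manifolds as objects, and two types of morphism: diffeomorphisms, and sutured gluing maps $M\to N$, i.e. embeddings of $M$ in $N$, such that the complement $A=N-\mathrm{Int}(M)$ has as boundary the balanced sutured boundary components of $M$ and $N$, together with an isotopy class of contact structures on $A$ with convex boundary and the sutures of $M$ and $N$ as dividing set. An object of $\mathsf{DiffBorSutTor}_2^\perp$ is such a gluing map $f\colon M\to N$ which is a product extension of a basic slice $T^2\times I$ (tight, minimally twisting, with orthogonal sutures on the two ends); $h\colon M\to N$ is the conjugate gluing map, given by the other basic slice. Its morphisms are pairs of diffeomorphisms that commute with the embeddings and respect the contact structures. **Invariants.** A set $\mathcal G$ of auxiliary data for a category assigns to every object $O$ a connected graph $\mathcal G(O)$ and to every morphism $f\colon O\to O'$ a connected nonempty subgraph $\mathcal G(f)\subset\mathcal G(O)\times\mathcal G(O')$. A weak $\mathcal G$ homotopy invariant $F$ assigns to every vertex $\mathcal D$ of $\mathcal G(O)$ an object $F(\mathcal D)$, to every edge $e$ a homotopy equivalence $F(e)$, and to every vertex $(\mathcal D_0,\mathcal D_1)$ of $\mathcal G(f)$ a morphism $F_f(\mathcal D_0,\mathcal D_1)\colon F(\mathcal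 D_0)\to F(\mathcal D_1)$, such that the square of every edge of $\mathcal G(f)$ commutes up to homotopy. It is strong if the homotopy class of the map assigned to a path in $\mathcal G(O)$ (edges may be traversed backwards, by means of homotopy inverses) depends only on the ends of the path. Witnesses are explicit homotopies $F_f(e_0,e_1)$ for these squares such that the induced maps $\mathbf F_f(e_0,e_1)\colon \mathrm{Cone}(F_f(\mathcal D_0,\mathcal D_1))\to \mathrm{Cone}(F_f(\mathcal D_0',\mathcal D_1'))$ are homotopy equivalences; they are strong if the homotopy class of the map of cones assigned to a path in $\mathcal G(f)$ depends only on its ends. Carriage returns for a witnessed weak homotopy invariant $F$ of $\mathsf{ContDiffBorSut}$ are, for every object $f\colon M\to N$ of $\mathsf{DiffBorSutTor}_2^\perp$: a nonempty connected subgraph $\mathcal G(f,h)\subset\mathcal G(f)\times\mathcal G(h)$ all of whose vertices $((\mathcal D_0,\mathcal D_1),(\mathcal D_0',\mathcal D_1'))$ satisfy $F(\mathcal D_i)=F(\mathcal D_i')$ and all of whose edges $((e_0,e_1),(e_0',e_1'))$ satisfy $F(e_i)=F(e_i')$ for $i=0,1$; a morphism $F(\mathcal D_0,\mathcal D_1;\mathcal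 D_0',\mathcal D_1')\colon \mathrm{Cone}(F_f(\mathcal D_0,\mathcal D_1))\to\mathrm{Cone}(F_h(\mathcal D_0',\mathcal D_1'))$ for every vertex; and for every edge a homotopy $F(e_0,e_1;e_0',e_1')$ through which the square formed by these morphisms and $\mathbf F_f(e_0,e_1)$, $\mathbf F_h(e_0',e_1')$ commutes, such that the induced map between the cones of the carriage returns is a homotopy equivalence. A typewriter in ${}^{\mathcal A}\mathsf{Mod}$ is a tuple $\mathbf M=(M_0,M_1;D_f,D_h;D_{CR})$ of objects $M_0,M_1$ and morphisms $D_f,D_h\colon M_0\to M_1$, $D_{CR}\colon\mathrm{Cone}(D_f)\to\mathrm{Cone}(D_h)$. A morphism $(T_0,T_1;T_f,T_h;T_{CR})\colon\mathbf M\to\mathbf M'$ consists of morphisms $T_i\colon M_i\to M_i'$, homotopies $T_*$ from $T_1D_*$ to $D_*'T_0$ for $*=f,h$, inducing $\mathbf T_*\colon\mathrm{Cone}(D_*)\to\mathrm{Cone}(D'_*)$, and a homotopy $T_{CR}$ from $\mathbf T_hD_{CR}$ to $D'_{CR}\mathbf T_f$, inducing $\mathbf T_{CR}\colon \mathrm{Cone}(D_{CR})\to\mathrm{Cone}(D'_{CR})$;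 a homotopy between two morphisms is a tuple $(H_0,H_1;H_f,H_h;H_{CR})$ of maps such that $H_0$, $H_1$ and the induced maps $\mathbf H_f,\mathbf H_h,\mathbf H_{CR}$ are homotopies between the corresponding maps. Each vertex of $\mathcal G(f,h)$ gives the typewriter $(F(\mathcal D_0),F(\mathcal D_1);F_f(\mathcal D_0,\mathcal D_1),F_h(\mathcal D_0',\mathcal D_1');F(\mathcal D_0,\mathcal D_1;\mathcal D'_0,\mathcal D'_1))$ and each edge the morphism $(F(e_0),F(e_1);F_f(e_0,e_1),F_h(e_0',e_1');F(e_0,e_1;e_0',e_1'))$ of typewriters. The carriage returns are strong if the homotopy class of the morphism of typewriters assigned to a path in $\mathcal G(f,h)$ depends only on its ends. The $DD$ bimodule $\Theta(\mathbf M)$ of a typewriter is $M_0\oplus M_1$ with structure map $$\delta^1=(\delta^1_{M_0},\delta^1_{M_1})\otimes \mathbf 1+\sum_{t}D_t\otimes t,\qquad t\in\{f,g,h,fg,gh,fgh\},$$ where $D_{CR}(x,y)=(D_g y+D_{fg}x,\;D_{gh}y+D_{fgh}x)$; on morphisms of typewriters, $\Theta(T_0,T_1;T_f,T_h;T_{CR})=(T_0,T_1)\otimes\mathbf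 1+\sum_t T_t\otimes t$ likewise. **Statement.** Let $F$ be a weak homotopy invariant of $\mathsf{ContDiffBorSut}$ valued in ${}^{\mathcal A}\mathsf{Mod}$, with witnesses and carriage returns. Then there are auxiliary data on the morphisms of $\mathsf{DiffBorSutTor}_2^\perp$ (connected nonempty subgraphs of $\mathcal G(f,h)\times\mathcal G(f',h')$ for every morphism $f\to f'$ of pairs) and morphisms between the above typewriters at the vertices of these subgraphs which commute up to homotopy with the morphisms of typewriters of edges. For every choice of these, the assignment $BFD$ that sends a vertex of $\mathcal G(f,h)$ to $\Theta$ of its typewriter, an edge to $\Theta$ of its morphism of typewriters, and a vertex of the data of a morphism of pairs to $\Theta$ of the chosen morphism of typewriters, is a weak homotopy invariant of $\mathsf{DiffBorSutTor}_2^\perp$ valued in ${}^{\mathcal A}\mathsf{Mod}^{\mathcal T}$. If moreover $F$, its witnesses and its carriage returns are strong, then $BFD$ is a strong homotopy invariant. -/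

import Mathlib

open scoped TensorProduct Manifold ContDiff

universe u v w x y

noncomputable section

/-! ### Differential graded algebras over a ring of idempotents -/

/-- An (ungraded) differential graded algebra over `𝔽₂`, together with its ring of idempotents
`base` (a commutative `𝔽₂`-algebra all of whose elements are idempotent, not necessarily central
in the algebra, on which the differential vanishes). -/
structure DGAlgebra where
  carrier : Type u
  base : Type u
  [ring : Ring carrier]
  [algebra : Algebra (ZMod 2) carrier]
  [baseRing : CommRing base]
  [baseAlgebra : Algebra (ZMod 2) base]
  unit : base →ₐ[ZMod 2] carrier
  base_idem : ∀ c : base, c * c = c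
  d : carrier →ₗ[ZMod 2] carrier
  d_d : ∀ a, d (d a) = 0
  leibniz : ∀ a b, d (a * b) = d a * b + a * d b
  d_unit : ∀ c, d (unit c) = 0

attribute [instance] DGAlgebra.ring DGAlgebra.algebra DGAlgebra.baseRing DGAlgebra.baseAlgebra

namespace DGAlgebra

/-- The algebra as a bimodule: a left module over itself, and a module over the (commutative) ring
of idempotents through right multiplication. -/
def Bimod (A : DGAlgebra.{u}) : Type u := A.carrier

instance (A : DGAlgebra.{u}) : AddCommGroup A.Bimod := inferInstanceAs (AddCommGroup A.carrier)

instance (A : DGAlgebra.{u}) : Module A.carrier A.Bimod :=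
  inferInstanceAs (Module A.carrier A.carrier)

instance (A : DGAlgebra.{u}) : Module A.base A.Bimod where
  smul c a := ((show A.carrier from a) * A.unit c : A.carrier)
  one_smul a := by
    change (show A.carrier from a) * A.unit 1 = a
    rw [map_one, mul_one]
  mul_smul c c' a := by
    change (show A.carrier from a) * A.unit (c * c') =
      ((show A.carrier from a) * A.unit c') * A.unit c
    rw [mul_comm, map_mul, mul_assoc]
  smul_zero c := zero_mul (A.unit c)
  smul_add c a b := add_mul (show A.carrier from a) (show A.carrier from b) (A.unit c)
  add_smul c c' a := by
    change (show A.carrier from a) * A.unit (c + c') =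
      (show A.carrier from a) * A.unit c + (show A.carrier from a) * A.unit c'
    rw [map_add, mul_add]
  zero_smul a := by
    change (show A.carrier from a) * A.unit 0 = 0
    rw [map_zero, mul_zero]

instance (A : DGAlgebra.{u}) : SMulCommClass A.base A.carrier A.Bimod where
  smul_comm c a b := mul_assoc a (show A.carrier from b) (A.unit c)

/-- `A ⊗ X`, the tensor product being taken over the ring of idempotents. -/
def Ten (A : DGAlgebra.{u}) (X : Type u) [AddCommGroup X] [Module A.base X] : Type u :=
  A.Bimod ⊗[A.base] X

section Ten

variable (A : DGAlgebra.{u}) {X Y : Type u} [AddCommGroup X] [Module A.base X]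
  [AddCommGroup Y] [Module A.base Y]

instance : AddCommGroup (A.Ten X) := inferInstanceAs (AddCommGroup (A.Bimod ⊗[A.base] X))

/-- Left multiplication on the first tensor factor. -/
instance : Module A.carrier (A.Ten X) := inferInstanceAs (Module A.carrier (A.Bimod ⊗[A.base] X))

/-- The left action of the ring of idempotents, through left multiplication on `A`. -/
instance : Module A.base (A.Ten X) := Module.compHom _ A.unit.toRingHom

/-- The pure tensor `a ⊗ x`. -/
def tm (a : A.carrier) (x : X) : A.Ten X := TensorProduct.tmul A.base (show A.Bimod from a) x

theorem base_smul_def (c : A.base) (t : A.Ten X) : c • t = A.unit c • t := rfl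

theorem smul_tm (a b : A.carrier) (x : X) : a • A.tm b x = A.tm (a * b) x := rfl

theorem tm_smul (a : A.carrier) (c : A.base) (x : X) : A.tm a (c • x) = A.tm (a * A.unit c) x :=
  (TensorProduct.smul_tmul c (show A.Bimod from a) x).symm

theorem tm_add (a : A.carrier) (x x' : X) : A.tm a (x + x') = A.tm a x + A.tm a x' :=
  TensorProduct.tmul_add _ _ _

theorem add_tm (a b : A.carrier) (x : X) : A.tm (a + b) x = A.tm a x + A.tm b x :=
  TensorProduct.add_tmul _ _ _

theorem ten_induction {P : A.Ten X → Prop} (t : A.Ten X) (zero : P 0)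
    (tm : ∀ a x, P (A.tm a x)) (add : ∀ s t, P s → P t → P (s + t)) : P t :=
  TensorProduct.induction_on (motive := P) t zero tm add

/-- The additive map `A ⊗ X → Z` induced by a balanced biadditive map. -/
def tenLift {Z : Type u} [AddCommGroup Z] (f : A.carrier →+ X →+ Z)
    (hf : ∀ (c : A.base) (a : A.carrier) (x : X), f (a * A.unit c) x = f a (c • x)) :
    A.Ten X →+ Z :=
  TensorProduct.liftAddHom (R := A.base) (M := A.Bimod) (N := X) f hf

theorem tenLift_tm {Z : Type u} [AddCommGroup Z] (f : A.carrier →+ X →+ Z)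
    (hf : ∀ (c : A.base) (a : A.carrier) (x : X), f (a * A.unit c) x = f a (c • x))
    (a : A.carrier) (x : X) : A.tenLift f hf (A.tm a x) = f a x := rfl

/-- `id ⊗ f : A ⊗ X → A ⊗ Y`. -/
def tenMap (f : X →ₗ[A.base] Y) : A.Ten X →ₗ[A.base] A.Ten Y :=
  let L : A.Ten X →+ A.Ten Y := (LinearMap.lTensor A.Bimod f).toAddMonoidHom
  { toFun := L
    map_add' := L.map_add
    map_smul' := fun c t => by
      change L (c • t) = c • L t
      induction t using A.ten_induction with
      | zero => rw [smul_zero, map_zero, smul_zero]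
      | tm a x => rfl
      | add s t hs ht => rw [smul_add, map_add, hs, ht, map_add, smul_add] }

/-- `∂ ⊗ id : A ⊗ X → A ⊗ X`. -/
def tenD : A.Ten X →ₗ[A.base] A.Ten X :=
  let D : A.Ten X →+ A.Ten X := A.tenLift
    { toFun := fun a =>
        { toFun := fun x => A.tm (A.d a) x
          map_zero' := TensorProduct.tmul_zero _ _
          map_add' := fun x x' => A.tm_add _ x x' }
      map_zero' := by
        ext x
        change A.tm (A.d 0) x = 0
        rw [map_zero]
        exact TensorProduct.zero_tmul _ _
      map_add' := fun a b => by
        ext x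
        change A.tm (A.d (a + b)) x = A.tm (A.d a) x + A.tm (A.d b) x
        rw [map_add, A.add_tm] }
    (fun c a x => by
      change A.tm (A.d (a * A.unit c)) x = A.tm (A.d a) (c • x)
      rw [A.leibniz, A.d_unit, mul_zero, add_zero, A.tm_smul])
  { toFun := D
    map_add' := D.map_add
    map_smul' := fun c t => by
      change D (c • t) = c • D t
      induction t using A.ten_induction with
      | zero => rw [smul_zero, map_zero, smul_zero]
      | tm a x =>
        change A.tm (A.d (A.unit c * a)) x = A.tm (A.unit c * A.d a) x
        rw [A.leibniz, A.d_unit, zero_mul, zero_add]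
      | add s t hs ht => rw [smul_add, map_add, hs, ht, map_add, smul_add] }

/-- The extension `A ⊗ X → A ⊗ Y`, `a ⊗ x ↦ a • ψ x`, of a map `ψ : X → A ⊗ Y`; this is
`(μ ⊗ id) ∘ (id ⊗ ψ)` for the multiplication `μ` of `A`. -/
def ext (ψ : X →ₗ[A.base] A.Ten Y) : A.Ten X →ₗ[A.base] A.Ten Y :=
  let E : A.Ten X →+ A.Ten Y := A.tenLift
    { toFun := fun a =>
        { toFun := fun x => a • ψ x
          map_zero' := by rw [map_zero, smul_zero]
          map_add' := fun x x' => by rw [map_add, smul_add] }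
      map_zero' := by ext x; exact zero_smul _ _
      map_add' := fun a b => by ext x; exact add_smul _ _ _ }
    (fun c a x => by
      change (a * A.unit c) • ψ x = a • ψ (c • x)
      rw [map_smul, A.base_smul_def, mul_smul])
  { toFun := E
    map_add' := E.map_add
    map_smul' := fun c t => by
      change E (c • t) = c • E t
      induction t using A.ten_induction with
      | zero => rw [smul_zero, map_zero, smul_zero]
      | tm a x => exact mul_smul (A.unit c) a (ψ x)
      | add s t hs ht => rw [smul_add, map_add, hs, ht, map_add, smul_add] }

end Ten

end DGAlgebra

/-! ### Type `D` structures -/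

/-- A module over the ring of idempotents of `A` with a map `δ¹ : X → A ⊗ X`. -/
structure PreD (A : DGAlgebra.{u}) where
  X : Type u
  [addCommGroup : AddCommGroup X]
  [module : Module A.base X]
  δ : X →ₗ[A.base] A.Ten X

attribute [instance] PreD.addCommGroup PreD.module

namespace PreD

variable {A : DGAlgebra.{u}}

/-- The structure equation of a type `D` structure:
`(μ ⊗ id) ∘ (id ⊗ δ¹) ∘ δ¹ + (∂ ⊗ id) ∘ δ¹ = 0`. -/
def IsTypeD (M : PreD A) : Prop := A.ext M.δ ∘ₗ M.δ + A.tenD ∘ₗ M.δ = 0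

/-- The morphism space from `M` to `N`: all maps `M → A ⊗ N` linear over the idempotents. -/
abbrev Hom (M N : PreD A) : Type u := M.X →ₗ[A.base] A.Ten N.X

/-- Composition `(μ ⊗ id) ∘ (id ⊗ ψ) ∘ φ`. -/
def comp {M N P : PreD A} (ψ : Hom N P) (φ : Hom M N) : Hom M P := A.ext ψ ∘ₗ φ

/-- The identity `x ↦ 1 ⊗ x`. -/
def idHom (M : PreD A) : Hom M M where
  toFun x := A.tm 1 x
  map_add' x x' := A.tm_add 1 x x'
  map_smul' c x := by
    change A.tm 1 (c • x) = A.unit c • A.tm 1 x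
    rw [A.tm_smul, A.smul_tm, one_mul, mul_one]

/-- The differential of the morphism space. -/
def diff {M N : PreD A} (φ : Hom M N) : Hom M N :=
  comp N.δ φ + comp φ M.δ + A.tenD ∘ₗ φ

/-- A morphism of type `D` structures is a cycle of the morphism space. -/
def IsMor {M N : PreD A} (φ : Hom M N) : Prop := diff φ = 0

/-- `H` is a homotopy from `φ` to `φ'`. -/
def IsHomotopy {M N : PreD A} (H φ φ' : Hom M N) : Prop := φ + φ' = diff H

def Homotopic {M N : PreD A} (φ φ' : Hom M N) : Prop := ∃ H, IsHomotopy H φ φ'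

/-- `ψ` is a homotopy inverse morphism of `φ`. -/
def IsHInverse {M N : PreD A} (φ : Hom M N) (ψ : Hom N M) : Prop :=
  IsMor ψ ∧ Homotopic (comp ψ φ) (idHom M) ∧ Homotopic (comp φ ψ) (idHom N)

def IsHEquiv {M N : PreD A} (φ : Hom M N) : Prop := IsMor φ ∧ ∃ ψ : Hom N M, IsHInverse φ ψ

/-- `A ⊗ (A ⊗ (⋯ ⊗ X))` with `n` factors `A`. -/
def tenPow (M : PreD A) : ℕ → ModuleCat.{u} A.base
  | 0 => ModuleCat.of A.base M.X
  | n + 1 => ModuleCat.of A.base (A.Ten (tenPow M n))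

/-- The iterates `δⁿ : X → A^{⊗ n} ⊗ X`, in which nothing is multiplied. -/
def iter (M : PreD A) : ∀ n, M.X →ₗ[A.base] tenPow M n
  | 0 => LinearMap.id
  | n + 1 => A.tenMap (iter M n) ∘ₗ M.δ

def IsBounded (M : PreD A) : Prop := ∀ x : M.X, ∃ n, ∀ i, n < i → iter M i x = 0

/-- `M` is homotopy equivalent to a bounded type `D` structure. -/
def IsHomotopyBounded (M : PreD A) : Prop :=
  ∃ N : PreD A, N.IsTypeD ∧ N.IsBounded ∧ ∃ φ : Hom M N, IsHEquiv φ

/-- The objects of `ᴬMod`. -/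
def IsObj (M : PreD A) : Prop := M.IsTypeD ∧ M.IsHomotopyBounded

/-- The mapping cone `M ⊕ N`, with `δ (x, y) = (δ x, δ y + φ x)`. -/
def cone {M N : PreD A} (φ : Hom M N) : PreD A where
  X := M.X × N.X
  δ := A.tenMap (LinearMap.inl A.base M.X N.X) ∘ₗ M.δ ∘ₗ LinearMap.fst A.base M.X N.X +
    A.tenMap (LinearMap.inr A.base M.X N.X) ∘ₗ
      (N.δ ∘ₗ LinearMap.snd A.base M.X N.X + φ ∘ₗ LinearMap.fst A.base M.X N.X)

/-- The map of cones `(x, y) ↦ (a x, b y + c x)`. -/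
def coneMap {M N M' N' : PreD A} (φ : Hom M N) (φ' : Hom M' N')
    (a : Hom M M') (b : Hom N N') (c : Hom M N') : Hom (cone φ) (cone φ') :=
  A.tenMap (LinearMap.inl A.base M'.X N'.X) ∘ₗ a ∘ₗ LinearMap.fst A.base M.X N.X +
    A.tenMap (LinearMap.inr A.base M'.X N'.X) ∘ₗ
      (b ∘ₗ LinearMap.snd A.base M.X N.X + c ∘ₗ LinearMap.fst A.base M.X N.X)

/-- The components of a morphism of cones, from the summand selected by `i` to the summand selected
by `p`. -/
def component {M N M' N' : PreD A} {φ : Hom M N} {φ' : Hom M' N'} {Y Z : Type u} [AddCommGroup Y]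
    [Module A.base Y] [AddCommGroup Z] [Module A.base Z] (T : Hom (cone φ) (cone φ'))
    (i : Y →ₗ[A.base] M.X × N.X) (p : M'.X × N'.X →ₗ[A.base] Z) : Y →ₗ[A.base] A.Ten Z :=
  A.tenMap p ∘ₗ T ∘ₗ i

end PreD

/-! ### Tensor products of algebras, the algebra `𝒯`, and `DD` bimodules -/

namespace DGAlgebra

/-- The tensor product over `𝔽₂`, with differential `∂ ⊗ id + id ⊗ ∂`. -/
def tensor (A : DGAlgebra.{u}) (B : DGAlgebra.{v}) : DGAlgebra.{max u v} where
  carrier := A.carrier ⊗[ZMod 2] B.carrier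
  base := A.base ⊗[ZMod 2] B.base
  unit := Algebra.TensorProduct.map A.unit B.unit
  base_idem c := by
    induction c using TensorProduct.induction_on with
    | zero => rw [mul_zero]
    | tmul a b => rw [Algebra.TensorProduct.tmul_mul_tmul, A.base_idem, B.base_idem]
    | add s t hs ht =>
      have h2 : s * t + s * t = 0 := by
        have : (2 : ZMod 2) • (s * t) = 0 := by
          rw [show (2 : ZMod 2) = 0 from rfl, zero_smul]
        rwa [two_smul] at this
      calc (s + t) * (s + t) = s * s + t * t + (s * t + s * t) := by ring
        _ = s + t := by rw [h2, hs, ht, add_zero]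
  d := TensorProduct.map A.d LinearMap.id + TensorProduct.map LinearMap.id B.d
  d_d t := by
    induction t using TensorProduct.induction_on with
    | zero => rw [map_zero, map_zero]
    | tmul a b =>
      have h2 : A.d a ⊗ₜ[ZMod 2] B.d b + A.d a ⊗ₜ[ZMod 2] B.d b = 0 := by
        have : (2 : ZMod 2) • (A.d a ⊗ₜ[ZMod 2] B.d b) = 0 := by
          rw [show (2 : ZMod 2) = 0 from rfl, zero_smul]
        rwa [two_smul] at this
      simp [A.d_d, B.d_d, h2]
    | add s t hs ht => rw [map_add, map_add, hs, ht, add_zero]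
  leibniz s t := by
    induction s using TensorProduct.induction_on with
    | zero => simp
    | add s s' hs hs' => rw [add_mul, map_add, hs, hs', map_add]; noncomm_ring
    | tmul a b =>
      induction t using TensorProduct.induction_on with
      | zero => simp
      | add t t' ht ht' => rw [mul_add, map_add, ht, ht', map_add]; noncomm_ring
      | tmul a' b' =>
        simp [A.leibniz, B.leibniz, TensorProduct.add_tmul, TensorProduct.tmul_add, mul_add,
          add_mul]
        abel
  d_unit c := by
    induction c using TensorProduct.induction_on with
    | zero => rw [map_zero, map_zero]
    | tmul a b => simp [A.d_unit, B.d_unit]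
    | add s t hs ht => rw [map_add, map_add, hs, ht, add_zero]

end DGAlgebra

namespace Torus

/-- The trivial paths and the arrows `f, h : 0 → 1` and `g : 1 → 0` of the quiver. -/
inductive Gen
  | i0 | i1 | f | g | h

/-- The relations of the path algebra of the quiver (a product `x * y` is the path `x` followed by
the path `y`), together with `g f = 0` and `h g = 0`. -/
inductive Rel : FreeAlgebra (ZMod 2) Gen → FreeAlgebra (ZMod 2) Gen → Prop
  | one : Rel (FreeAlgebra.ι _ .i0 + FreeAlgebra.ι _ .i1) 1
  | i0i0 : Rel (FreeAlgebra.ι _ .i0 * FreeAlgebra.ι _ .i0) (FreeAlgebra.ι _ .i0)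
  | i1i1 : Rel (FreeAlgebra.ι _ .i1 * FreeAlgebra.ι _ .i1) (FreeAlgebra.ι _ .i1)
  | i0i1 : Rel (FreeAlgebra.ι _ .i0 * FreeAlgebra.ι _ .i1) 0
  | i1i0 : Rel (FreeAlgebra.ι _ .i1 * FreeAlgebra.ι _ .i0) 0
  | i0f : Rel (FreeAlgebra.ι _ .i0 * FreeAlgebra.ι _ .f) (FreeAlgebra.ι _ .f)
  | fi1 : Rel (FreeAlgebra.ι _ .f * FreeAlgebra.ι _ .i1) (FreeAlgebra.ι _ .f)
  | i1g : Rel (FreeAlgebra.ι _ .i1 * FreeAlgebra.ι _ .g) (FreeAlgebra.ι _ .g)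
  | gi0 : Rel (FreeAlgebra.ι _ .g * FreeAlgebra.ι _ .i0) (FreeAlgebra.ι _ .g)
  | i0h : Rel (FreeAlgebra.ι _ .i0 * FreeAlgebra.ι _ .h) (FreeAlgebra.ι _ .h)
  | hi1 : Rel (FreeAlgebra.ι _ .h * FreeAlgebra.ι _ .i1) (FreeAlgebra.ι _ .h)
  | gf : Rel (FreeAlgebra.ι _ .g * FreeAlgebra.ι _ .f) 0
  | hg : Rel (FreeAlgebra.ι _ .h * FreeAlgebra.ι _ .g) 0

/-- The underlying ring of `𝒯`. -/
abbrev T : Type := RingQuot Rel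

def gen (x : Gen) : T := RingQuot.mkAlgHom (ZMod 2) Rel (FreeAlgebra.ι _ x)

theorem rel {a b : FreeAlgebra (ZMod 2) Gen} (h : Rel a b) :
    RingQuot.mkAlgHom (ZMod 2) Rel a = RingQuot.mkAlgHom (ZMod 2) Rel b :=
  RingQuot.mkAlgHom_rel (ZMod 2) h

theorem i0_add_i1 : gen .i0 + gen .i1 = 1 := by
  have := rel .one
  rwa [map_add, map_one] at this

theorem i0_i0 : gen .i0 * gen .i0 = gen .i0 := by have := rel .i0i0; rwa [map_mul] at this
theorem i1_i1 : gen .i1 * gen .i1 = gen .i1 := by have := rel .i1i1; rwa [map_mul] at this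
theorem i0_i1 : gen .i0 * gen .i1 = 0 := by have := rel .i0i1; rwa [map_mul, map_zero] at this
theorem i1_i0 : gen .i1 * gen .i0 = 0 := by have := rel .i1i0; rwa [map_mul, map_zero] at this
theorem i0_f : gen .i0 * gen .f = gen .f := by have := rel .i0f; rwa [map_mul] at this
theorem i1_g : gen .i1 * gen .g = gen .g := by have := rel .i1g; rwa [map_mul] at this
theorem i0_h : gen .i0 * gen .h = gen .h := by have := rel .i0h; rwa [map_mul] at this

/-- The algebra `𝒯`, with zero differential, over the ring of idempotents spanned by the trivial
paths. -/
def alg : DGAlgebra.{0} where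
  carrier := T
  base := ZMod 2 × ZMod 2
  unit := AlgHom.ofLinearMap
    ((LinearMap.toSpanSingleton (ZMod 2) T (gen .i0)) ∘ₗ LinearMap.fst (ZMod 2) _ _ +
      (LinearMap.toSpanSingleton (ZMod 2) T (gen .i1)) ∘ₗ LinearMap.snd (ZMod 2) _ _)
    (by simp [i0_add_i1])
    (by
      rintro ⟨a, b⟩ ⟨c, e⟩
      simp [mul_add, add_mul, i0_i0, i1_i1, i0_i1, i1_i0, smul_smul, mul_comm])
  base_idem := by decide
  d := 0
  d_d _ := rfl
  leibniz a b := by simp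
  d_unit _ := rfl

theorem alg_unit (c : ZMod 2 × ZMod 2) : alg.unit c = c.1 • gen .i0 + c.2 • gen .i1 := rfl

end Torus

/-- The category of `DD` bimodules over `(A, 𝒯)`: structure maps `M → A ⊗ M ⊗ 𝒯`, i.e. type `D`
structures over `A ⊗ 𝒯`. A word such as `fg` in `𝒯` is the path `f` followed by `g`, and accordingly
the structure equation pairs the composite `D_g ∘ D_f` with the product `f g`. -/
abbrev DDAlgebra (A : DGAlgebra.{u}) : DGAlgebra.{u} := A.tensor Torus.alg

section DD

variable (A : DGAlgebra.{u})

/-- The two ring maps from the idempotents of `A ⊗ 𝒯` to those of `A`, which pick out the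
coefficient of one of the two trivial paths of `𝒯`. -/
def baseProj0 : (DDAlgebra A).base →ₐ[ZMod 2] A.base :=
  Algebra.TensorProduct.lift (AlgHom.id _ A.base)
    ((Algebra.ofId (ZMod 2) A.base).comp (AlgHom.fst (ZMod 2) (ZMod 2) (ZMod 2)))
    (fun _ _ => Commute.all _ _)

/-- The second of these maps. -/
def baseProj1 : (DDAlgebra A).base →ₐ[ZMod 2] A.base :=
  Algebra.TensorProduct.lift (AlgHom.id _ A.base)
    ((Algebra.ofId (ZMod 2) A.base).comp (AlgHom.snd (ZMod 2) (ZMod 2) (ZMod 2)))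
    (fun _ _ => Commute.all _ _)

/-- `X₀ ⊕ X₁` as a module over the idempotents of `A ⊗ 𝒯`: the trivial path at `s` acts as the
projection to `X_s`. -/
def Split (X₀ X₁ : Type u) : Type u := X₀ × X₁

variable (X₀ X₁ : Type u) [AddCommGroup X₀] [Module A.base X₀] [AddCommGroup X₁] [Module A.base X₁]

instance : AddCommGroup (Split X₀ X₁) := inferInstanceAs (AddCommGroup (X₀ × X₁))

instance : Module (DDAlgebra A).base (Split X₀ X₁) where
  smul c x := (baseProj0 A c • x.1, baseProj1 A c • x.2)
  one_smul x := Prod.ext (by change baseProj0 A 1 • x.1 = _; rw [map_one, one_smul])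
    (by change baseProj1 A 1 • x.2 = _; rw [map_one, one_smul])
  mul_smul c c' x := Prod.ext
    (by change baseProj0 A (c * c') • x.1 = _; rw [map_mul, mul_smul]; rfl)
    (by change baseProj1 A (c * c') • x.2 = _; rw [map_mul, mul_smul]; rfl)
  smul_zero c := Prod.ext (smul_zero _) (smul_zero _)
  smul_add c x x' := Prod.ext (smul_add _ _ _) (smul_add _ _ _)
  add_smul c c' x := Prod.ext
    (by change baseProj0 A (c + c') • x.1 = _; rw [map_add, add_smul]; rfl)
    (by change baseProj1 A (c + c') • x.2 = _; rw [map_add, add_smul]; rfl)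
  zero_smul x := Prod.ext (by change baseProj0 A 0 • x.1 = _; rw [map_zero, zero_smul]; rfl)
    (by change baseProj1 A 0 • x.2 = _; rw [map_zero, zero_smul]; rfl)

variable {A X₀ X₁}

/-- `c ⊗ 1`, as an idempotent of `A ⊗ 𝒯`. -/
def baseIncl (c : A.base) : (DDAlgebra A).base := c ⊗ₜ[ZMod 2] (1 : ZMod 2 × ZMod 2)

theorem baseProj0_incl (c : A.base) : baseProj0 A (baseIncl c) = c := by
  change c * algebraMap (ZMod 2) A.base 1 = c
  rw [map_one, mul_one]

theorem baseProj1_incl (c : A.base) : baseProj1 A (baseIncl c) = c := by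
  change c * algebraMap (ZMod 2) A.base 1 = c
  rw [map_one, mul_one]

/-- `a ⊗ t`, as an element of `A ⊗ 𝒯`. -/
def ddTmul (a : A.carrier) (t : Torus.T) : (DDAlgebra A).carrier := a ⊗ₜ[ZMod 2] t

theorem ddTmul_zero_left (t : Torus.T) : ddTmul (0 : A.carrier) t = 0 :=
  TensorProduct.zero_tmul _ _

theorem ddTmul_add_left (a b : A.carrier) (t : Torus.T) :
    ddTmul (a + b) t = ddTmul a t + ddTmul b t := TensorProduct.add_tmul _ _ _

theorem ddTmul_mul_unit (a : A.carrier) (t : Torus.T) (c : A.base) :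
    ddTmul (a * A.unit c) t = ddTmul a t * (DDAlgebra A).unit (baseIncl c) := by
  change (a * A.unit c) ⊗ₜ[ZMod 2] t = (a ⊗ₜ[ZMod 2] t : A.carrier ⊗[ZMod 2] Torus.T) *
    (A.unit c ⊗ₜ[ZMod 2] (show Torus.T from Torus.alg.unit 1))
  rw [Algebra.TensorProduct.tmul_mul_tmul, map_one]
  exact congrArg _ (mul_one t).symm

theorem unit_mul_ddTmul {t : Torus.T} (c : A.base) (e : ZMod 2 × ZMod 2) (r : ZMod 2)
    (hr : (e.1 • Torus.gen .i0 + e.2 • Torus.gen .i1) * t = r • t) (a : A.carrier) :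
    ddTmul (A.unit (c * algebraMap (ZMod 2) A.base r) * a) t =
      (DDAlgebra A).unit (c ⊗ₜ[ZMod 2] e) * ddTmul a t := by
  change (A.unit (c * algebraMap (ZMod 2) A.base r) * a) ⊗ₜ[ZMod 2] t =
    (A.unit c ⊗ₜ[ZMod 2] (e.1 • Torus.gen .i0 + e.2 • Torus.gen .i1)) *
      (a ⊗ₜ[ZMod 2] t : A.carrier ⊗[ZMod 2] Torus.T)
  rw [Algebra.TensorProduct.tmul_mul_tmul, hr, TensorProduct.tmul_smul, TensorProduct.smul_tmul',
    map_mul, AlgHom.commutes, ← Algebra.commutes, ← Algebra.smul_def, smul_mul_assoc]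

theorem base_induction {P : (DDAlgebra A).base → Prop} (c : (DDAlgebra A).base) (zero : P 0)
    (tmul : ∀ (c : A.base) (e : ZMod 2 × ZMod 2), P (c ⊗ₜ[ZMod 2] e))
    (add : ∀ s t, P s → P t → P (s + t)) : P c :=
  TensorProduct.induction_on (motive := P) c zero tmul add

theorem unit_mul0 {t : Torus.T} (ht : Torus.gen .i0 * t = t) (c : (DDAlgebra A).base)
    (a : A.carrier) :
    ddTmul (A.unit (baseProj0 A c) * a) t = (DDAlgebra A).unit c * ddTmul a t := by
  have ht1 : Torus.gen .i1 * t = 0 := by rw [← ht, ← mul_assoc, Torus.i1_i0, zero_mul]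
  induction c using base_induction with
  | zero => rw [map_zero, map_zero, zero_mul, ddTmul_zero_left, map_zero, zero_mul]
  | add s s' hs hs' => rw [map_add, map_add, add_mul, ddTmul_add_left, hs, hs', map_add, add_mul]
  | tmul c e =>
    exact unit_mul_ddTmul c e e.1 (by
      rw [add_mul, smul_mul_assoc, smul_mul_assoc, ht, ht1, smul_zero, add_zero]) a

theorem unit_mul1 {t : Torus.T} (ht : Torus.gen .i1 * t = t) (c : (DDAlgebra A).base)
    (a : A.carrier) :
    ddTmul (A.unit (baseProj1 A c) * a) t = (DDAlgebra A).unit c * ddTmul a t := by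
  have ht0 : Torus.gen .i0 * t = 0 := by rw [← ht, ← mul_assoc, Torus.i0_i1, zero_mul]
  induction c using base_induction with
  | zero => rw [map_zero, map_zero, zero_mul, ddTmul_zero_left, map_zero, zero_mul]
  | add s s' hs hs' => rw [map_add, map_add, add_mul, ddTmul_add_left, hs, hs', map_add, add_mul]
  | tmul c e =>
    exact unit_mul_ddTmul c e e.2 (by
      rw [add_mul, smul_mul_assoc, smul_mul_assoc, ht, ht0, smul_zero, zero_add]) a

/-- The map `A ⊗ Y → (A ⊗ 𝒯) ⊗ (X₀ ⊕ X₁)`, `a ⊗ y ↦ (a ⊗ t) ⊗ inc y`. -/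
def tensT {Y : Type u} [AddCommGroup Y] [Module A.base Y] (t : Torus.T) (inc : Y →+ Split X₀ X₁)
    (hinc : ∀ (c : A.base) y, inc (c • y) = baseIncl c • inc y) :
    A.Ten Y →+ (DDAlgebra A).Ten (Split X₀ X₁) :=
  A.tenLift
    { toFun := fun a =>
        { toFun := fun y => (DDAlgebra A).tm (ddTmul a t) (inc y)
          map_zero' := by rw [map_zero]; exact TensorProduct.tmul_zero _ _
          map_add' := fun x x' => by rw [map_add]; exact (DDAlgebra A).tm_add _ _ _ }
      map_zero' := by
        ext y
        change (DDAlgebra A).tm (ddTmul 0 t) _ = 0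
        rw [ddTmul_zero_left]
        exact TensorProduct.zero_tmul _ _
      map_add' := fun a b => by
        ext y
        change (DDAlgebra A).tm (ddTmul (a + b) t) _ = _
        rw [ddTmul_add_left]
        exact (DDAlgebra A).add_tm _ _ _ }
    (fun c a y => by
      change (DDAlgebra A).tm (ddTmul (a * A.unit c) t) (inc y) =
        (DDAlgebra A).tm (ddTmul a t) (inc (c • y))
      rw [hinc, (DDAlgebra A).tm_smul, ddTmul_mul_unit])

theorem tensT_smul {Y : Type u} [AddCommGroup Y] [Module A.base Y] {t : Torus.T}
    {inc : Y →+ Split X₀ X₁} (hinc : ∀ (c : A.base) y, inc (c • y) = baseIncl c • inc y)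
    {c : (DDAlgebra A).base} {c' : A.base}
    (hc : ∀ a : A.carrier, ddTmul (A.unit c' * a) t = (DDAlgebra A).unit c * ddTmul a t)
    (τ : A.Ten Y) : tensT t inc hinc (c' • τ) = c • tensT t inc hinc τ := by
  induction τ using A.ten_induction with
  | zero => rw [smul_zero, map_zero, smul_zero]
  | add s s' hs hs' => rw [smul_add, map_add, hs, hs', map_add, smul_add]
  | tm a y =>
    change (DDAlgebra A).tm (ddTmul (A.unit c' * a) t) (inc y) =
      (DDAlgebra A).tm ((DDAlgebra A).unit c * ddTmul a t) (inc y)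
    rw [hc]

/-- The inclusion of the summand at the trivial path `0`. -/
def splitInl : X₀ →+ Split X₀ X₁ := AddMonoidHom.inl X₀ X₁

/-- The inclusion of the summand at the trivial path `1`. -/
def splitInr : X₁ →+ Split X₀ X₁ := AddMonoidHom.inr X₀ X₁

theorem splitInl_smul (c : A.base) (x : X₀) :
    (splitInl (c • x) : Split X₀ X₁) = baseIncl c • (splitInl x : Split X₀ X₁) :=
  Prod.ext (congrArg (· • x) (baseProj0_incl c)).symm (smul_zero (baseProj1 A (baseIncl c))).symm

theorem splitInr_smul (c : A.base) (x : X₁) :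
    (splitInr (c • x) : Split X₀ X₁) = baseIncl c • (splitInr x : Split X₀ X₁) :=
  Prod.ext (smul_zero (baseProj0 A (baseIncl c))).symm (congrArg (· • x) (baseProj1_incl c)).symm

variable {Y₀ Y₁ : Type u} [AddCommGroup Y₀] [Module A.base Y₀] [AddCommGroup Y₁] [Module A.base Y₁]

/-- The map `D ⊗ t` for `D : Y₀ → A ⊗ X₀`, extended by zero to `Y₀ ⊕ Y₁`; similarly below. -/
def entry00 (D : Y₀ →ₗ[A.base] A.Ten X₀) (t : Torus.T) (ht : Torus.gen .i0 * t = t) :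
    Split Y₀ Y₁ →ₗ[(DDAlgebra A).base] (DDAlgebra A).Ten (Split X₀ X₁) where
  toFun x := tensT t splitInl splitInl_smul (D x.1)
  map_add' x x' := by
    change tensT t _ _ (D (x.1 + x'.1)) = _
    rw [map_add, map_add]
  map_smul' c x := by
    change tensT t _ _ (D (baseProj0 A c • x.1)) = _
    rw [map_smul]
    exact tensT_smul _ (unit_mul0 ht c) _

/-- Likewise, between the summands that the indices name. -/
def entry01 (D : Y₀ →ₗ[A.base] A.Ten X₁) (t : Torus.T) (ht : Torus.gen .i0 * t = t) :
    Split Y₀ Y₁ →ₗ[(DDAlgebra A).base] (DDAlgebra A).Ten (Split X₀ X₁) where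
  toFun x := tensT t splitInr splitInr_smul (D x.1)
  map_add' x x' := by
    change tensT t _ _ (D (x.1 + x'.1)) = _
    rw [map_add, map_add]
  map_smul' c x := by
    change tensT t _ _ (D (baseProj0 A c • x.1)) = _
    rw [map_smul]
    exact tensT_smul _ (unit_mul0 ht c) _

/-- Likewise, between the summands that the indices name. -/
def entry10 (D : Y₁ →ₗ[A.base] A.Ten X₀) (t : Torus.T) (ht : Torus.gen .i1 * t = t) :
    Split Y₀ Y₁ →ₗ[(DDAlgebra A).base] (DDAlgebra A).Ten (Split X₀ X₁) where
  toFun x := tensT t splitInl splitInl_smul (D x.2)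
  map_add' x x' := by
    change tensT t _ _ (D (x.2 + x'.2)) = _
    rw [map_add, map_add]
  map_smul' c x := by
    change tensT t _ _ (D (baseProj1 A c • x.2)) = _
    rw [map_smul]
    exact tensT_smul _ (unit_mul1 ht c) _

/-- Likewise, between the summands that the indices name. -/
def entry11 (D : Y₁ →ₗ[A.base] A.Ten X₁) (t : Torus.T) (ht : Torus.gen .i1 * t = t) :
    Split Y₀ Y₁ →ₗ[(DDAlgebra A).base] (DDAlgebra A).Ten (Split X₀ X₁) where
  toFun x := tensT t splitInr splitInr_smul (D x.2)
  map_add' x x' := by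
    change tensT t _ _ (D (x.2 + x'.2)) = _
    rw [map_add, map_add]
  map_smul' c x := by
    change tensT t _ _ (D (baseProj1 A c • x.2)) = _
    rw [map_smul]
    exact tensT_smul _ (unit_mul1 ht c) _

open Torus in
/-- The map `(E₀, E₁) ⊗ 1 + ∑ D_t ⊗ t`, the sum running over the nontrivial paths `t` of `𝒯`. (On
the summand at the trivial path `s`, tensoring with `1` is tensoring with that path.) -/
def ofCoefficients (E₀ : Y₀ →ₗ[A.base] A.Ten X₀) (E₁ : Y₁ →ₗ[A.base] A.Ten X₁)
    (Df Dh : Y₀ →ₗ[A.base] A.Ten X₁) (Dg : Y₁ →ₗ[A.base] A.Ten X₀)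
    (Dfg : Y₀ →ₗ[A.base] A.Ten X₀) (Dgh : Y₁ →ₗ[A.base] A.Ten X₁)
    (Dfgh : Y₀ →ₗ[A.base] A.Ten X₁) :
    Split Y₀ Y₁ →ₗ[(DDAlgebra A).base] (DDAlgebra A).Ten (Split X₀ X₁) :=
  entry00 E₀ (gen .i0) i0_i0 + entry11 E₁ (gen .i1) i1_i1 +
    entry01 Df (gen .f) i0_f + entry01 Dh (gen .h) i0_h + entry10 Dg (gen .g) i1_g +
    entry00 Dfg (gen .f * gen .g) (by rw [← mul_assoc, i0_f]) +
    entry11 Dgh (gen .g * gen .h) (by rw [← mul_assoc, i1_g]) +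
    entry01 Dfgh (gen .f * gen .g * gen .h) (by rw [← mul_assoc, ← mul_assoc, i0_f])

end DD

/-! ### Typewriters -/

/-- The data of a typewriter `(M₀, M₁; D_f, D_h; D_CR)`. -/
structure Typewriter (A : DGAlgebra.{u}) where
  M₀ : PreD A
  M₁ : PreD A
  Df : PreD.Hom M₀ M₁
  Dh : PreD.Hom M₀ M₁
  CR : PreD.Hom (PreD.cone Df) (PreD.cone Dh)

namespace Typewriter

open PreD

variable {A : DGAlgebra.{u}}

/-- A tuple `(T₀, T₁; T_f, T_h; T_CR)` of maps between the constituents of two typewriters. -/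
structure Tuple (M M' : Typewriter A) where
  T₀ : Hom M.M₀ M'.M₀
  T₁ : Hom M.M₁ M'.M₁
  Tf : Hom M.M₀ M'.M₁
  Th : Hom M.M₀ M'.M₁
  CR : Hom (cone M.Df) (cone M'.Dh)

namespace Tuple

variable {M M' M'' : Typewriter A}

/-- The map of cones `Cone(D_f) → Cone(D_f')` induced by a tuple. -/
def coneF (T : Tuple M M') : Hom (cone M.Df) (cone M'.Df) := coneMap _ _ T.T₀ T.T₁ T.Tf

/-- The map of cones `Cone(D_h) → Cone(D_h')` induced by a tuple. -/
def coneH (T : Tuple M M') : Hom (cone M.Dh) (cone M'.Dh) := coneMap _ _ T.T₀ T.T₁ T.Th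

/-- The map of cones `Cone(D_CR) → Cone(D_CR')` induced by a tuple. -/
def coneCR (T : Tuple M M') : Hom (cone M.CR) (cone M'.CR) := coneMap _ _ T.coneF T.coneH T.CR

/-- The tuple is a morphism of typewriters. -/
structure IsMor (T : Tuple M M') : Prop where
  mor₀ : PreD.IsMor T.T₀
  mor₁ : PreD.IsMor T.T₁
  f : IsHomotopy T.Tf (comp T.T₁ M.Df) (comp M'.Df T.T₀)
  h : IsHomotopy T.Th (comp T.T₁ M.Dh) (comp M'.Dh T.T₀)
  cr : IsHomotopy T.CR (comp T.coneH M.CR) (comp M'.CR T.coneF)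

/-- The tuple `H` is a homotopy of morphisms of typewriters from `T` to `T'`. -/
structure IsHomotopy (H T T' : Tuple M M') : Prop where
  h₀ : PreD.IsHomotopy H.T₀ T.T₀ T'.T₀
  h₁ : PreD.IsHomotopy H.T₁ T.T₁ T'.T₁
  f : PreD.IsHomotopy H.coneF T.coneF T'.coneF
  h : PreD.IsHomotopy H.coneH T.coneH T'.coneH
  cr : PreD.IsHomotopy H.coneCR T.coneCR T'.coneCR

def Homotopic (T T' : Tuple M M') : Prop := ∃ H, IsHomotopy H T T'

/-- Composition of morphisms of typewriters; the maps of cones induced by the composite are the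
composites of the induced maps of cones. -/
def comp (T' : Tuple M' M'') (T : Tuple M M') : Tuple M M'' where
  T₀ := PreD.comp T'.T₀ T.T₀
  T₁ := PreD.comp T'.T₁ T.T₁
  Tf := PreD.comp T'.T₁ T.Tf + PreD.comp T'.Tf T.T₀
  Th := PreD.comp T'.T₁ T.Th + PreD.comp T'.Th T.T₀
  CR := PreD.comp T'.coneH T.CR + PreD.comp T'.CR T.coneF

def id (M : Typewriter A) : Tuple M M := ⟨idHom _, idHom _, 0, 0, 0⟩

/-- `S` is a homotopy inverse of `T`. -/
def IsHInverse (T : Tuple M M') (S : Tuple M' M) : Prop :=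
  S.IsMor ∧ Homotopic (comp S T) (id M) ∧ Homotopic (comp T S) (id M')

/-- The map of `DD` bimodules with coefficient maps `(T₀, T₁)`, `T_f`, `T_h` and the components of
`T_CR(x, y) = (T_g y + T_fg x, T_gh y + T_fgh x)`. -/
def ddMap (T : Tuple M M') :
    Split M.M₀.X M.M₁.X →ₗ[(DDAlgebra A).base] (DDAlgebra A).Ten (Split M'.M₀.X M'.M₁.X) :=
  ofCoefficients T.T₀ T.T₁ T.Tf T.Th
    (component T.CR (LinearMap.inr _ _ _) (LinearMap.fst _ _ _))
    (component T.CR (LinearMap.inl _ _ _) (LinearMap.fst _ _ _))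
    (component T.CR (LinearMap.inr _ _ _) (LinearMap.snd _ _ _))
    (component T.CR (LinearMap.inl _ _ _) (LinearMap.snd _ _ _))

end Tuple

/-- The `DD` bimodule over `(A, 𝒯)` associated to a typewriter: its module is `M₀ ⊕ M₁`, and its
structure map has as coefficient maps the structure maps of `M₀` and `M₁`, the maps `D_f` and `D_h`,
and the components of `D_CR(x, y) = (D_g y + D_fg x, D_gh y + D_fgh x)`. -/
def dd (M : Typewriter A) : PreD (DDAlgebra A) where
  X := Split M.M₀.X M.M₁.X
  δ := ofCoefficients M.M₀.δ M.M₁.δ M.Df M.Dh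
    (component M.CR (LinearMap.inr _ _ _) (LinearMap.fst _ _ _))
    (component M.CR (LinearMap.inl _ _ _) (LinearMap.fst _ _ _))
    (component M.CR (LinearMap.inr _ _ _) (LinearMap.snd _ _ _))
    (component M.CR (LinearMap.inl _ _ _) (LinearMap.snd _ _ _))

/-- The map of `DD` bimodules associated to a morphism of typewriters. -/
def Tuple.dd {M M' : Typewriter A} (T : Tuple M M') : Hom M.dd M'.dd := T.ddMap

end Typewriter

/-! ### Bordered-sutured three-manifolds -/

namespace BorderedSutured

open Set Filter Topology

/-- The Euclidean space `ℝ³`. -/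
abbrev E3 : Type := EuclideanSpace ℝ (Fin 3)

/-- The model of three-manifolds with boundary, the half space `{x | 0 ≤ x 0}`. -/
abbrev I3 : ModelWithCorners ℝ E3 (EuclideanHalfSpace 3) := 𝓡∂ 3

/-- A compact oriented smooth three-manifold with boundary. The orientation `or` records whether the
preferred identification of the tangent space at `x` with `ℝ³` preserves orientations. -/
structure Mfd where
  Y : Type
  [top : TopologicalSpace Y]
  [charted : ChartedSpace (EuclideanHalfSpace 3) Y]
  [isManifold : IsManifold I3 ∞ Y]
  [t2 : T2Space Y]
  [compact : CompactSpace Y]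
  or : Y → ℤˣ
  or_compat : ∀ x₀ : Y, ∀ᶠ x in 𝓝 x₀,
    0 < ((or x₀ : ℤ) : ℝ) * ((or x : ℤ) : ℝ) * (tangentCoordChange I3 x₀ x x).det

attribute [instance] Mfd.top Mfd.charted Mfd.isManifold Mfd.t2 Mfd.compact

/-- The boundary. -/
def Mfd.bd (M : Mfd) : Set M.Y := I3.boundary M.Y

/-- The determinant of three vectors of `ℝ³`. -/
def det3 (a b c : E3) : ℝ := Matrix.det (Matrix.of fun i j : Fin 3 => (![a, b, c] i) j)

/-- An arc diagram: `n` oriented intervals, `m i` marked points on the interval of index `i`, and a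
matching `M` of the marked points. -/
structure ArcDiagram where
  n : ℕ
  m : Fin n → ℕ
  M : Equiv.Perm (Σ i, Fin (m i))
  involutive : ∀ p, M (M p) = p
  ne_self : ∀ p, M p ≠ p
  /-- The result of surgery on the intervals along the matched pairs has no closed component.
  (Travelling along the result, one passes from `p` to the marked point that follows `M p`.) -/
  nondegenerate : ∀ p, ¬ Relation.TransGen
    (fun p q : Σ i, Fin (m i) => q.1 = (M p).1 ∧ (q.2 : ℕ) = (M p).2 + 1) p p

namespace ArcDiagram

/-- The marked points. -/
abbrev Pt (Z : ArcDiagram) : Type := Σ i, Fin (Z.m i)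

/-- The position of a marked point on its interval `[0, 1]`. -/
def pos (Z : ArcDiagram) (p : Z.Pt) : ℝ := (((p.2 : ℕ) : ℝ) + 1) / ((Z.m p.1 : ℝ) + 1)

end ArcDiagram

/-- The velocity of a curve defined on `[0, 1]`. -/
def velocity {M : Mfd} (γ : ℝ → M.Y) (t : ℝ) : TangentSpace I3 (γ t) :=
  mfderivWithin 𝓘(ℝ, ℝ) I3 γ (Icc 0 1) t (1 : ℝ)

/-- `γ` is smooth on `[0, 1]`, and its velocity does not vanish. -/
def RegularCurve {M : Mfd} (γ : ℝ → M.Y) : Prop :=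
  ContMDiffOn 𝓘(ℝ, ℝ) I3 ∞ γ (Icc 0 1) ∧ ∀ t ∈ Icc (0 : ℝ) 1, velocity γ t ≠ 0

/-- The sutures `∂Y ∖ (R₊ ∪ R₋)`. -/
def sutures (M : Mfd) (Rp Rm : Set M.Y) : Set M.Y := M.bd \ (Rp ∪ Rm)

/-- The smooth function `s` cuts the boundary into `R₊ = {s > 0}` and `R₋ = {s < 0}` along the
sutures, on which `s` vanishes transversely. -/
structure Cuts {M : Mfd} (Rp Rm : Set M.Y) (s : M.Y → ℝ) : Prop where
  smooth : ContMDiff I3 𝓘(ℝ, ℝ) ∞ s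
  pos : Rp = {x ∈ M.bd | 0 < s x}
  neg : Rm = {x ∈ M.bd | s x < 0}
  regular : ∀ x ∈ M.bd, s x = 0 → ∃ w : E3, w 0 = 0 ∧
    (show E3 →L[ℝ] ℝ from mfderiv I3 𝓘(ℝ, ℝ) s x) w ≠ 0

/-- A bordered-sutured three-manifold `(Y, Γ, 𝒵, φ)`. The set `Γ` of sutures is `∂Y ∖ (R₊ ∪ R₋)`.
The parameterisation `φ` of part of the boundary is given on the intervals of the arc diagram `𝒵` by
the curves `arc`, and on the edge of the graph `G(𝒵)` that joins `p` to its match by `chord p`. -/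
structure BorSut where
  mfd : Mfd
  Rp : Set mfd.Y
  Rm : Set mfd.Y
  Z : ArcDiagram
  arc : Fin Z.n → ℝ → mfd.Y
  chord : Z.Pt → ℝ → mfd.Y
  arc_regular : ∀ i, RegularCurve (arc i)
  chord_regular : ∀ p, RegularCurve (chord p)
  arc_mem : ∀ i, ∀ t ∈ Icc (0 : ℝ) 1, arc i t ∈ sutures mfd Rp Rm
  arc_inj : ∀ i i', ∀ t ∈ Icc (0 : ℝ) 1, ∀ t' ∈ Icc (0 : ℝ) 1, arc i t = arc i' t' →
    i = i' ∧ t = t'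
  /-- The sutures separate `R₊` from `R₋`, and the intervals are embedded in the sutures, oriented
  as the boundary of `R₊`: an outward normal `ν` of `Y`, a vector `w` tangent to the boundary and
  pointing out of `R₊`, and the velocity form a positive frame. -/
  cut : ∃ s, Cuts Rp Rm s ∧ ∀ i, ∀ t ∈ Icc (0 : ℝ) 1, ∃ ν w : E3, ν 0 < 0 ∧ w 0 = 0 ∧
    (show E3 →L[ℝ] ℝ from mfderiv I3 𝓘(ℝ, ℝ) s (arc i t)) w < 0 ∧
    0 < ((mfd.or (arc i t) : ℤ) : ℝ) * det3 ν w (velocity (arc i) t)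
  chord_zero : ∀ p, chord p 0 = arc p.1 (Z.pos p)
  chord_symm : ∀ p, ∀ t ∈ Icc (0 : ℝ) 1, chord (Z.M p) t = chord p (1 - t)
  chord_mem : ∀ p, ∀ t ∈ Ioo (0 : ℝ) 1, chord p t ∈ Rm
  chord_inj : ∀ p p', ∀ t ∈ Ioo (0 : ℝ) 1, ∀ t' ∈ Ioo (0 : ℝ) 1, chord p t = chord p' t' →
    (p = p' ∧ t = t') ∨ (p' = Z.M p ∧ t' = 1 - t)
  /-- The edges leave the sutures transversely. -/
  chord_transverse : ∀ p, ∃ s, Cuts Rp Rm s ∧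
    (show E3 →L[ℝ] ℝ from mfderiv I3 𝓘(ℝ, ℝ) s (chord p 0)) (velocity (chord p) 0) < 0
  /-- Every component of `Y` has boundary. -/
  meets_bd : ∀ x : mfd.Y, (connectedComponent x ∩ mfd.bd).Nonempty
  /-- Every component of the complement of the graph in the boundary contains part of a suture. -/
  meets_sutures : ∀ x ∈ mfd.bd \ ((⋃ i, arc i '' Icc 0 1) ∪ ⋃ p, chord p '' Icc 0 1),
    (connectedComponentIn (mfd.bd \ ((⋃ i, arc i '' Icc 0 1) ∪ ⋃ p, chord p '' Icc 0 1)) x ∩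
      sutures mfd Rp Rm).Nonempty

namespace BorSut

/-- The points. -/
abbrev Y (M : BorSut) : Type := M.mfd.Y

/-- The boundary. -/
abbrev bd (M : BorSut) : Set M.Y := M.mfd.bd

/-- The image of the graph `G(𝒵)`. -/
def graph (M : BorSut) : Set M.Y :=
  (⋃ i, M.arc i '' Icc 0 1) ∪ ⋃ p, M.chord p '' Icc 0 1

/-- The union of the balanced sutured boundary components, those that the graph misses. -/
def bdS (M : BorSut) : Set M.Y := {x ∈ M.bd | connectedComponentIn M.bd x ∩ M.graph = ∅}

/-- The union of the remaining boundary components. -/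
def bdB (M : BorSut) : Set M.Y := M.bd \ M.bdS

/-- The orientation sign at a point, as a real number. -/
def sgn (M : BorSut) (x : M.Y) : ℝ := ((M.mfd.or x : ℤ) : ℝ)

/-- The derivative of a map of three-manifolds at a point. -/
def D {M N : BorSut} (i : M.Y → N.Y) (x : M.Y) : E3 →L[ℝ] E3 := mfderiv I3 I3 i x

/-- The identification `h` of arc diagrams carries the parameterisation of `M` followed by `i` to
that of `N`. -/
def ParamCompat {M N : BorSut} (i : M.Y → N.Y) : Prop :=
  ∃ h : M.Z = N.Z,
    (∀ k, ∀ t ∈ Icc (0 : ℝ) 1, i (M.arc k t) = N.arc (cast (by rw [h]) k) t) ∧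
    (∀ p, ∀ t ∈ Icc (0 : ℝ) 1, i (M.chord p t) = N.chord (cast (by rw [h]) p) t)

/-- A diffeomorphism of bordered-sutured manifolds. -/
structure Diffeo (M N : BorSut) where
  toDiffeo : Diffeomorph I3 I3 M.Y N.Y ∞
  orientation : ∀ x, 0 < M.sgn x * N.sgn (toDiffeo x) * (D (M := M) (N := N) toDiffeo x).det
  Rp : toDiffeo '' M.Rp = N.Rp
  Rm : toDiffeo '' M.Rm = N.Rm
  param : ParamCompat (M := M) (N := N) toDiffeo

/-- An embedding of `M` into `N` such that the complement of the interior of the image has as its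
boundary the balanced sutured boundary components of `M` and `N`. -/
structure CollarEmb (M N : BorSut) where
  i : M.Y → N.Y
  smooth : ContMDiff I3 I3 ∞ i
  injective : Function.Injective i
  orientation : ∀ x, 0 < M.sgn x * N.sgn (i x) * (D i x).det
  sutured : ∀ x ∈ M.bdS, i x ∉ N.bd
  bordered : i '' M.bdB = N.bdB
  Rp : i '' (M.Rp ∩ M.bdB) = N.Rp ∩ N.bdB
  Rm : i '' (M.Rm ∩ M.bdB) = N.Rm ∩ N.bdB
  param : ParamCompat i

/-- The complement of the interior of the image (the interior being taken relative to the common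
bordered boundary). -/
def CollarEmb.A {M N : BorSut} (i : CollarEmb M N) : Set N.Y := (i.i '' (M.bdS)ᶜ)ᶜ

/-! ### Contact structures on collars -/

/-- A one-form on the manifold. -/
abbrev OneForm (N : BorSut) : Type := N.Y → (E3 →L[ℝ] ℝ)

/-- The expression of a one-form in the preferred chart at `x`. -/
def localForm {N : BorSut} (α : OneForm N) (x : N.Y) (e : E3) : E3 →L[ℝ] ℝ :=
  (α ((extChartAt I3 x).symm e)).comp
    (tangentCoordChange I3 x ((extChartAt I3 x).symm e) ((extChartAt I3 x).symm e))

/-- A family of one-forms which is smooth on `[0, 1]`, jointly in the parameter and the point. -/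
def SmoothFamily {N : BorSut} (α : ℝ → OneForm N) : Prop :=
  ∀ x : N.Y, ContDiffOn ℝ ∞ (fun p : ℝ × E3 => localForm (α p.1) x p.2)
    (Icc (0 : ℝ) 1 ×ˢ (extChartAt I3 x).target)

/-- A smooth one-form. -/
def SmoothForm {N : BorSut} (α : OneForm N) : Prop :=
  ∀ x : N.Y, ContDiffOn ℝ ∞ (localForm α x) (extChartAt I3 x).target

/-- The exterior derivative at a point. -/
def extD {N : BorSut} (α : OneForm N) (x : N.Y) (u v : E3) : ℝ :=
  fderivWithin ℝ (localForm α x) (range I3) (extChartAt I3 x x) u v -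
    fderivWithin ℝ (localForm α x) (range I3) (extChartAt I3 x x) v u

/-- The standard basis vectors of `ℝ³`. -/
def e3 (k : Fin 3) : E3 := EuclideanSpace.single k 1

/-- `α` is a positive contact form at `x`: `α ∧ dα > 0`. -/
def IsContactAt {N : BorSut} (α : OneForm N) (x : N.Y) : Prop :=
  0 < N.sgn x * (α x (e3 0) * extD α x (e3 1) (e3 2) + α x (e3 1) * extD α x (e3 2) (e3 0) +
    α x (e3 2) * extD α x (e3 0) (e3 1))

/-- A vector field. -/
abbrev VField (N : BorSut) : Type := N.Y → E3

/-- A smooth vector field. -/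
def SmoothField {N : BorSut} (v : VField N) : Prop :=
  ContMDiff I3 I3.tangent ∞ fun x : N.Y => (⟨x, v x⟩ : TangentBundle I3 N.Y)

/-- The vector field `v` is a contact vector field at `x`: the Lie derivative
`d (α v) + dα (v, ·)` vanishes on the kernel of `α`. -/
def IsContactFieldAt {N : BorSut} (α : OneForm N) (v : VField N) (x : N.Y) : Prop :=
  ∀ u : E3, α x u = 0 →
    (show E3 →L[ℝ] ℝ from mfderiv I3 𝓘(ℝ, ℝ) (fun y => α y (v y)) x) u + extD α x (v x) u = 0

/-- The kernel of the one-form `α` is a positive contact structure on the complement `A` of the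
interior of `M` in `N`, for which the boundary of `A` is convex, with the sutures of `M` and `N` as
dividing set: near the boundary of `A` there is a contact vector field `v` that points out of `M`
and out of `N`, and `R₊` and `R₋` are the regions where `α v` is positive and negative. -/
structure IsContactCollar {M N : BorSut} (i : CollarEmb M N) (α : OneForm N) : Prop where
  smooth : SmoothForm α
  contact : ∀ x ∈ i.A, IsContactAt α x
  convex : ∃ (v : VField N) (U : Set N.Y), SmoothField v ∧ IsOpen U ∧ i.i '' M.bdS ⊆ U ∧
    N.bdS ⊆ U ∧ (∀ x ∈ U ∩ i.A, IsContactFieldAt α v x) ∧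
    (∀ y ∈ M.bdS, (∃ w : E3, w 0 < 0 ∧ v (i.i y) = D i.i y w) ∧
      (y ∈ M.Rp ↔ 0 < α (i.i y) (v (i.i y))) ∧ (y ∈ M.Rm ↔ α (i.i y) (v (i.i y)) < 0)) ∧
    (∀ x ∈ N.bdS, v x 0 < 0 ∧ (x ∈ N.Rp ↔ 0 < α x (v x)) ∧ (x ∈ N.Rm ↔ α x (v x) < 0))

/-- The contact structures on the complement of the interior of `M` in `N`. -/
def ContactCollar {M N : BorSut} (i : CollarEmb M N) : Type :=
  {α : OneForm N // IsContactCollar i α}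

/-- Two such contact structures are isotopic if they are joined by a path of such. -/
def Isotopic {M N : BorSut} {i : CollarEmb M N} (α β : ContactCollar i) : Prop :=
  ∃ γ : ℝ → OneForm N, SmoothFamily γ ∧ (∀ t ∈ Icc (0 : ℝ) 1, IsContactCollar i (γ t)) ∧
    (∀ x ∈ i.A, γ 0 x = α.1 x) ∧ ∀ x ∈ i.A, γ 1 x = β.1 x

/-- The isotopy classes of contact structures. -/
def ContactClass {M N : BorSut} (i : CollarEmb M N) : Type := Quot (Isotopic (i := i))

/-- The morphisms of `ContDiffBorSut`, of two types: sutured gluing maps, given by an embedding and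
an isotopy class of contact structures on the complement, and diffeomorphisms. -/
instance : Quiver BorSut where
  Hom M N := (Σ i : CollarEmb M N, ContactClass i) ⊕ Diffeo M N

/-! ### Basic slices and orthogonal pairs -/

/-- The universal cover `ℝ² × [0, 1]` of the thickened torus. -/
def slab : Set E3 := {q | 0 ≤ q 2 ∧ q 2 ≤ 1}

/-- The deck transformations, translations by `ℤ² × 0`. -/
def shift (a b : ℤ) : E3 := (a : ℝ) • e3 0 + (b : ℝ) • e3 1

/-- The exterior derivative of a one-form on a subset of `ℝ³`. -/
def flatD (β : E3 → (E3 →L[ℝ] ℝ)) (q u v : E3) : ℝ :=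
  fderiv ℝ β q u v - fderiv ℝ β q v u

/-- The plane `ℝ²`. -/
abbrev E2 : Type := EuclideanSpace ℝ (Fin 2)

/-- The kernel of the periodic one-form `β` on the slab is a tight contact structure on the
thickened torus: there is no embedded disc that is tangent to the kernel along its boundary. -/
def IsTight (β : E3 → (E3 →L[ℝ] ℝ)) : Prop :=
  ¬ ∃ δ : E2 → E3, ContDiff ℝ ∞ δ ∧
    (∀ z ∈ Metric.closedBall (0 : E2) 1, δ z ∈ slab ∧ Function.Injective (fderiv ℝ δ z)) ∧
    (∀ z ∈ Metric.closedBall (0 : E2) 1, ∀ z' ∈ Metric.closedBall (0 : E2) 1, ∀ a b : ℤ,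
      δ z = δ z' + shift a b → z = z') ∧
    (∀ z ∈ Metric.sphere (0 : E2) 1, ∀ w, β (δ z) (fderiv ℝ δ z w) = 0)

/-- The contact structure that is the kernel of the periodic one-form `β` is minimally twisting,
between the boundary slopes `(1, 0)` and `(0, 1)`: there is no embedded convex torus parallel to the
boundary with a closed dividing curve in a class `(p, r)` with `p r > 0`. The torus is the image of
an equivariant map `j`, and `v` is a contact vector field transverse to it. -/
def IsMinimallyTwisting (β : E3 → (E3 →L[ℝ] ℝ)) : Prop :=
  ¬ ∃ (j : E2 → E3) (v : E3 → E3) (U : Set E3) (c : ℝ → E2) (p r : ℤ),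
    ContDiff ℝ ∞ j ∧ ContDiff ℝ ∞ v ∧ IsOpen U ∧
    (∀ z, 0 < j z 2 ∧ j z 2 < 1) ∧ (∀ z, j z ∈ U) ∧
    (∀ z (a b : ℤ), j (z + (a : ℝ) • EuclideanSpace.single 0 1 +
      (b : ℝ) • EuclideanSpace.single 1 1) = j z + shift a b) ∧
    (∀ z z', j z = j z' → z = z') ∧
    (∀ q (a b : ℤ), v (q + shift a b) = v q) ∧
    (∀ z, LinearIndependent ℝ ![fderiv ℝ j z (EuclideanSpace.single 0 1),
      fderiv ℝ j z (EuclideanSpace.single 1 1), v (j z)]) ∧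
    (∀ q ∈ U ∩ slab, ∀ u, β q u = 0 →
      fderiv ℝ (fun q' => β q' (v q')) q u + flatD β q (v q) u = 0) ∧
    Continuous c ∧ (∀ t, c (t + 1) = c t + (p : ℝ) • EuclideanSpace.single 0 1 +
      (r : ℝ) • EuclideanSpace.single 1 1) ∧
    (∀ t, β (j (c t)) (v (j (c t))) = 0) ∧ 0 < p * r

/-- The derivative on the slab of a map from the slab. -/
def slabD {N : BorSut} (P : E3 → N.Y) (q : E3) : E3 →L[ℝ] E3 :=
  mfderivWithin 𝓘(ℝ, E3) I3 P slab q

/-- `P` identifies the thickened torus with `B`, a component of the complement of the interior of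
`M` in `N`, with its boundary component `t = 0` in `M` and its boundary component `t = 1` in the
boundary of `N`. The sutures on the two boundary components are pairs of parallel curves of slopes
`(1, 0)` and `(0, 1)`. -/
structure IsTorusChart {M N : BorSut} (i : CollarEmb M N) (B : Set N.Y) (P : E3 → N.Y) :
    Prop where
  smooth : ContMDiffOn 𝓘(ℝ, E3) I3 ∞ P slab
  periodic : ∀ q ∈ slab, ∀ q' ∈ slab, P q = P q' ↔ ∃ a b : ℤ, q' = q + shift a b
  orientation : ∀ q ∈ slab, 0 < N.sgn (P q) * (slabD P q).det
  image : P '' slab = B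
  subset : B ⊆ i.A
  isolated : IsClosed (i.A \ B)
  inner : P '' {q | q 2 = 0} = B ∩ i.i '' M.bdS
  outer : P '' {q | q 2 = 1} = B ∩ N.bdS
  inner_Rp : ∀ q : E3, q 2 = 0 → (P q ∈ i.i '' M.Rp ↔ 0 < Real.sin (2 * Real.pi * q 1))
  inner_Rm : ∀ q : E3, q 2 = 0 → (P q ∈ i.i '' M.Rm ↔ Real.sin (2 * Real.pi * q 1) < 0)
  outer_Rp : ∀ q : E3, q 2 = 1 → (P q ∈ N.Rp ↔ 0 < Real.sin (2 * Real.pi * q 0))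
  outer_Rm : ∀ q : E3, q 2 = 1 → (P q ∈ N.Rm ↔ Real.sin (2 * Real.pi * q 0) < 0)

/-- The kernel of `α` is a product extension of a basic slice on `B`: it is tight and minimally
twisting on the thickened torus `B`, and a product contact structure on the rest (where the flow of
a contact vector field `v` with `dτ (v) = 1` yields the product structure). -/
def IsBasicSlice {M N : BorSut} (i : CollarEmb M N) (B : Set N.Y) (α : OneForm N) : Prop :=
  (∃ P : E3 → N.Y, IsTorusChart i B P ∧
    IsTight (fun q => (α (P q)).comp (slabD P q)) ∧
    IsMinimallyTwisting (fun q => (α (P q)).comp (slabD P q))) ∧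
  ∃ (τ : N.Y → ℝ) (v : VField N), ContMDiff I3 𝓘(ℝ, ℝ) ∞ τ ∧ SmoothField v ∧
    (∀ x ∈ i.A \ B, IsContactFieldAt α v x ∧
      (show E3 →L[ℝ] ℝ from mfderiv I3 𝓘(ℝ, ℝ) τ x) (v x) = 1) ∧
    (∀ x ∈ i.i '' M.bdS \ B, τ x = 0) ∧ ∀ x ∈ N.bdS \ B, τ x = 1

end BorSut

open BorSut

/-- An object `(Y, f)` of `DiffBorSutTor₂^⊥`: an embedding of `inner` into `outer`, and an isotopy
class `f` of contact structures on the complement which is a product extension of a basic slice,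
along with the conjugate class `h`, given by the other basic slice. -/
structure OrthPair where
  inner : BorSut
  outer : BorSut
  emb : CollarEmb inner outer
  f : ContactClass emb
  h : ContactClass emb
  ne : f ≠ h
  conjugate : ∃ (B : Set outer.Y) (α β : ContactCollar emb), Quot.mk _ α = f ∧ Quot.mk _ β = h ∧
    IsBasicSlice emb B α.1 ∧ IsBasicSlice emb B β.1 ∧ ∀ x ∈ emb.A \ B, α.1 x = β.1 x

namespace OrthPair

/-- The gluing map `f`. -/
def fHom (p : OrthPair) : p.inner ⟶ p.outer := Sum.inl ⟨p.emb, p.f⟩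

/-- The conjugate gluing map `h`. -/
def hHom (p : OrthPair) : p.inner ⟶ p.outer := Sum.inl ⟨p.emb, p.h⟩

/-- A morphism of `DiffBorSutTor₂^⊥`: diffeomorphisms compatible with the embeddings, which pull
the contact structure of the target back to that of the source. -/
structure Mor (p q : OrthPair) where
  inner : Diffeo p.inner q.inner
  outer : Diffeo p.outer q.outer
  comm : ∀ x, outer.toDiffeo (p.emb.i x) = q.emb.i (inner.toDiffeo x)
  pullback : ∃ (α : ContactCollar p.emb) (β : ContactCollar q.emb), Quot.mk _ α = p.f ∧
    Quot.mk _ β = q.f ∧ ∀ x ∈ p.emb.A,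
      α.1 x = (β.1 (outer.toDiffeo x)).comp (D (M := p.outer) (N := q.outer) outer.toDiffeo x)

instance : Quiver OrthPair where
  Hom := Mor

end OrthPair

end BorderedSutured

/-! ### Auxiliary data, and weak and strong homotopy invariants -/

/-- A graph (directed, with multiple edges and loops allowed). -/
structure AuxGraph where
  V : Type v
  E : V → V → Type w

namespace AuxGraph

/-- Nonempty, and any two vertices are joined by a path, whose edges may be traversed in either
direction. -/
def Connected (Γ : AuxGraph.{v, w}) : Prop :=
  Nonempty Γ.V ∧ ∀ a b : Γ.V, Relation.EqvGen (fun a b => Nonempty (Γ.E a b)) a b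

/-- The product: vertices and edges are pairs of vertices and pairs of edges. -/
def prod (Γ Δ : AuxGraph.{v, w}) : AuxGraph.{v, w} where
  V := Γ.V × Δ.V
  E a b := Γ.E a.1 b.1 × Δ.E a.2 b.2

/-- A subgraph. -/
structure Sub (Γ : AuxGraph.{v, w}) where
  verts : Set Γ.V
  edges : ∀ a b : Γ.V, Set (Γ.E a b)
  source_mem : ∀ {a b : Γ.V} {e : Γ.E a b}, e ∈ edges a b → a ∈ verts
  target_mem : ∀ {a b : Γ.V} {e : Γ.E a b}, e ∈ edges a b → b ∈ verts

/-- A subgraph as a graph. -/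
def Sub.toGraph {Γ : AuxGraph.{v, w}} (S : Γ.Sub) : AuxGraph.{v, w} where
  V := S.verts
  E a b := S.edges a.1 b.1

end AuxGraph

/-- A set of auxiliary data for a category (whose composition plays no role): a connected graph for
every object, and for every morphism a connected nonempty subgraph of the product of the graphs of
its source and its target. -/
structure AuxData (S : Type y) [Quiver.{x} S] where
  graph : S → AuxGraph.{v, w}
  connected : ∀ O, (graph O).Connected
  mor : ∀ {O O' : S}, (O ⟶ O') → ((graph O).prod (graph O')).Sub
  mor_connected : ∀ {O O' : S} (f : O ⟶ O'), (mor f).toGraph.Connected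

/-- A morphism of graphs to the dg category of type `D` structures: a type `D` structure for every
vertex and a map for every edge. -/
structure GraphFun (Γ : AuxGraph.{v, w}) (A : DGAlgebra.{u}) where
  obj : Γ.V → PreD A
  map : ∀ {a b : Γ.V}, Γ.E a b → PreD.Hom (obj a) (obj b)

namespace GraphFun

variable {Γ : AuxGraph.{v, w}} {A : DGAlgebra.{u}}

/-- The vertices are sent to objects of `ᴬMod` and the edges to homotopy equivalences, so that the
induced map of graphs to the homotopy category sends edges to isomorphisms. -/
structure IsWeak (Φ : GraphFun Γ A) : Prop where
  obj : ∀ a, (Φ.obj a).IsObj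
  map : ∀ {a b : Γ.V} (e : Γ.E a b), PreD.IsHEquiv (Φ.map e)

/-- The maps assigned to the paths from `a` to `b`: composites of maps of edges and of homotopy
inverses of such maps, where an edge is traversed backwards. -/
inductive PathMap (Φ : GraphFun Γ A) (a : Γ.V) : ∀ b : Γ.V, PreD.Hom (Φ.obj a) (Φ.obj b) → Prop
  | nil : PathMap Φ a a (PreD.idHom (Φ.obj a))
  | forward {b c : Γ.V} {T : PreD.Hom (Φ.obj a) (Φ.obj b)} (h : PathMap Φ a b T) (e : Γ.E b c) :
      PathMap Φ a c (PreD.comp (Φ.map e) T)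
  | backward {b c : Γ.V} {T : PreD.Hom (Φ.obj a) (Φ.obj b)} (h : PathMap Φ a b T) (e : Γ.E c b)
      {S : PreD.Hom (Φ.obj b) (Φ.obj c)} (hS : PreD.IsHInverse (Φ.map e) S) :
      PathMap Φ a c (PreD.comp S T)

/-- The homotopy class of the map assigned to a path depends only on its ends. -/
def PathIndependent (Φ : GraphFun Γ A) : Prop :=
  ∀ (a b : Γ.V) (T T' : PreD.Hom (Φ.obj a) (Φ.obj b)), Φ.PathMap a b T → Φ.PathMap a b T' →
    PreD.Homotopic T T'

end GraphFun

/-- The data of a homotopy invariant, for a set `G` of auxiliary data: a map of graphs for every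
object, and, for every morphism `f : O ⟶ O'` and every vertex `(𝒟₁, 𝒟₂)` of the graph of `f`, a map
`F_f (𝒟₁, 𝒟₂) : F 𝒟₁ → F 𝒟₂`. -/
structure Invariant {S : Type y} [Quiver.{x} S] (G : AuxData.{v, w} S) (A : DGAlgebra.{u}) where
  onObj : ∀ O : S, GraphFun (G.graph O) A
  mor : ∀ {O O' : S} (f : O ⟶ O') (d : (G.mor f).toGraph.V),
    PreD.Hom ((onObj O).obj d.1.1) ((onObj O').obj d.1.2)

namespace Invariant

open PreD

variable {S : Type y} [Quiver.{x} S] {G : AuxData.{v, w} S} {A : DGAlgebra.{u}}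

/-- `F` is a weak homotopy invariant valued in `ᴬMod`. -/
structure IsWeak (F : Invariant G A) : Prop where
  onObj : ∀ O, (F.onObj O).IsWeak
  mor : ∀ {O O' : S} (f : O ⟶ O') (d : (G.mor f).toGraph.V), IsMor (F.mor f d)
  square : ∀ {O O' : S} (f : O ⟶ O') {d d' : (G.mor f).toGraph.V} (e : (G.mor f).toGraph.E d d'),
    Homotopic (comp ((F.onObj O').map e.1.2) (F.mor f d))
      (comp (F.mor f d') ((F.onObj O).map e.1.1))

/-- `F` is a strong homotopy invariant valued in `ᴬMod`. -/
structure IsStrong (F : Invariant G A) : Prop where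
  weak : F.IsWeak
  independent : ∀ O, (F.onObj O).PathIndependent

/-- A set of witnesses for `F`: homotopies `F_f (e₁, e₂)` for all edges `(e₁, e₂)` of the graph of a
morphism `f`, such that the squares commute by means of these homotopies and the induced maps of
cones are homotopy equivalences. -/
structure Witnesses (F : Invariant G A) where
  wit : ∀ {O O' : S} (f : O ⟶ O') {d d' : (G.mor f).toGraph.V} (_ : (G.mor f).toGraph.E d d'),
    Hom ((F.onObj O).obj d.1.1) ((F.onObj O').obj d'.1.2)
  isHomotopy : ∀ {O O' : S} (f : O ⟶ O') {d d' : (G.mor f).toGraph.V}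
    (e : (G.mor f).toGraph.E d d'),
    IsHomotopy (wit f e) (comp ((F.onObj O').map e.1.2) (F.mor f d))
      (comp (F.mor f d') ((F.onObj O).map e.1.1))
  isHEquiv : ∀ {O O' : S} (f : O ⟶ O') {d d' : (G.mor f).toGraph.V}
    (e : (G.mor f).toGraph.E d d'),
    IsHEquiv (coneMap (F.mor f d) (F.mor f d') ((F.onObj O).map e.1.1) ((F.onObj O').map e.1.2)
      (wit f e))

namespace Witnesses

variable {F : Invariant G A}

/-- The cones `Cone (F_f (𝒟₁, 𝒟₂))` and the induced maps `𝐅_f (e₁, e₂)` between them. -/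
def cones (W : F.Witnesses) {O O' : S} (f : O ⟶ O') : GraphFun (G.mor f).toGraph A where
  obj d := cone (F.mor f d)
  map {d d'} e := coneMap (F.mor f d) (F.mor f d') ((F.onObj O).map e.1.1)
    ((F.onObj O').map e.1.2) (W.wit f e)

/-- The homotopy class of the maps induced on cones depends only on the ends of a path. -/
def IsStrong (W : F.Witnesses) : Prop :=
  ∀ {O O' : S} (f : O ⟶ O'), (W.cones f).PathIndependent

end Witnesses

end Invariant

/-! ### Carriage returns -/

namespace Typewriter

open PreD

variable {A : DGAlgebra.{u}}

/-- The typewriter `(M₀, M₁; D_f, D_h; D_CR)` for which `D_h` is given as a map `N₀ → N₁` between the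
same modules. -/
def mk' {M₀ M₁ : PreD A} : ∀ {N₀ N₁ : PreD A} (_ : M₀ = N₀) (_ : M₁ = N₁) (Df : Hom M₀ M₁)
    (Dh : Hom N₀ N₁) (_ : Hom (cone Df) (cone Dh)), Typewriter A
  | _, _, rfl, rfl, Df, Dh, CR => ⟨M₀, M₁, Df, Dh, CR⟩

/-- The tuple `(T₀, T₁; T_f, T_h; T_CR)` between two such typewriters. -/
def Tuple.mk' {M₀ M₁ M₀' M₁' : PreD A} : ∀ {N₀ N₁ N₀' N₁' : PreD A} (h₀ : M₀ = N₀) (h₁ : M₁ = N₁)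
    (h₀' : M₀' = N₀') (h₁' : M₁' = N₁') (Df : Hom M₀ M₁) (Dh : Hom N₀ N₁)
    (CR : Hom (cone Df) (cone Dh)) (Df' : Hom M₀' M₁') (Dh' : Hom N₀' N₁')
    (CR' : Hom (cone Df') (cone Dh')) (_ : Hom M₀ M₀') (_ : Hom M₁ M₁') (_ : Hom M₀ M₁')
    (_ : Hom N₀ N₁') (_ : Hom (cone Df) (cone Dh')),
    Tuple (Typewriter.mk' h₀ h₁ Df Dh CR) (Typewriter.mk' h₀' h₁' Df' Dh' CR')
  | _, _, _, _, rfl, rfl, rfl, rfl, _, _, _, _, _, _, T₀, T₁, Tf, Th, TCR => ⟨T₀, T₁, Tf, Th, TCR⟩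

end Typewriter

section

open PreD BorderedSutured

/-- Carriage returns for a witnessed homotopy invariant of `ContDiffBorSut`. For every orthogonal
pair, `graph p` is a subgraph of the product of the graphs of the two conjugate gluing maps `f` and
`h`, consisting of vertices `((𝒟₀, 𝒟₁), (𝒟₀', 𝒟₁'))` with `F 𝒟ᵢ = F 𝒟ᵢ'` and edges
`((e₀, e₁), (e₀', e₁'))` with `F eᵢ = F eᵢ'`. To its vertices and edges are assigned morphisms
between cones and homotopies between the composites of these morphisms with the maps of cones
induced by the witnesses. -/
structure CarriageReturns {A : DGAlgebra.{u}} {G : AuxData.{v, w} BorSut} {F : Invariant G A}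
    (W : F.Witnesses) where
  graph : ∀ p : OrthPair, ((G.mor p.fHom).toGraph.prod (G.mor p.hHom).toGraph).Sub
  connected : ∀ p, (graph p).toGraph.Connected
  obj_eq₀ : ∀ p (d : (graph p).toGraph.V),
    (F.onObj p.inner).obj d.1.1.1.1 = (F.onObj p.inner).obj d.1.2.1.1
  obj_eq₁ : ∀ p (d : (graph p).toGraph.V),
    (F.onObj p.outer).obj d.1.1.1.2 = (F.onObj p.outer).obj d.1.2.1.2
  map_eq₀ : ∀ p {d d' : (graph p).toGraph.V} (e : (graph p).toGraph.E d d'),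
    HEq ((F.onObj p.inner).map e.1.1.1.1) ((F.onObj p.inner).map e.1.2.1.1)
  map_eq₁ : ∀ p {d d' : (graph p).toGraph.V} (e : (graph p).toGraph.E d d'),
    HEq ((F.onObj p.outer).map e.1.1.1.2) ((F.onObj p.outer).map e.1.2.1.2)
  cr : ∀ p (d : (graph p).toGraph.V), Hom (cone (F.mor p.fHom d.1.1)) (cone (F.mor p.hHom d.1.2))
  cr_mor : ∀ p (d : (graph p).toGraph.V), IsMor (cr p d)
  hom : ∀ p {d d' : (graph p).toGraph.V} (_ : (graph p).toGraph.E d d'),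
    Hom (cone (F.mor p.fHom d.1.1)) (cone (F.mor p.hHom d'.1.2))
  isHomotopy : ∀ p {d d' : (graph p).toGraph.V} (e : (graph p).toGraph.E d d'),
    IsHomotopy (hom p e) (comp ((W.cones p.hHom).map e.1.2) (cr p d))
      (comp (cr p d') ((W.cones p.fHom).map e.1.1))
  isHEquiv : ∀ p {d d' : (graph p).toGraph.V} (e : (graph p).toGraph.E d d'),
    IsHEquiv (coneMap (cr p d) (cr p d') ((W.cones p.fHom).map e.1.1)
      ((W.cones p.hHom).map e.1.2) (hom p e))

namespace CarriageReturns

variable {A : DGAlgebra.{u}} {G : AuxData.{v, w} BorSut} {F : Invariant G A} {W : F.Witnesses}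

/-- The typewriter
`(F 𝒟₀, F 𝒟₁; F_f (𝒟₀, 𝒟₁), F_h (𝒟₀', 𝒟₁'); F (𝒟₀, 𝒟₁; 𝒟₀', 𝒟₁'))` of a vertex. -/
def typewriter (C : CarriageReturns W) (p : OrthPair) (d : (C.graph p).toGraph.V) :
    Typewriter A :=
  Typewriter.mk' (C.obj_eq₀ p d) (C.obj_eq₁ p d) (F.mor p.fHom d.1.1) (F.mor p.hHom d.1.2)
    (C.cr p d)

/-- The morphism of typewriters
`(F e₀, F e₁; F_f (e₀, e₁), F_h (e₀', e₁'); F (e₀, e₁; e₀', e₁'))` of an edge. -/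
def tuple (C : CarriageReturns W) (p : OrthPair) {d d' : (C.graph p).toGraph.V}
    (e : (C.graph p).toGraph.E d d') :
    Typewriter.Tuple (C.typewriter p d) (C.typewriter p d') :=
  Typewriter.Tuple.mk' (C.obj_eq₀ p d) (C.obj_eq₁ p d) (C.obj_eq₀ p d') (C.obj_eq₁ p d')
    (F.mor p.fHom d.1.1) (F.mor p.hHom d.1.2) (C.cr p d)
    (F.mor p.fHom d'.1.1) (F.mor p.hHom d'.1.2) (C.cr p d')
    ((F.onObj p.inner).map e.1.1.1.1) ((F.onObj p.outer).map e.1.1.1.2)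
    (W.wit p.fHom e.1.1) (W.wit p.hHom e.1.2) (C.hom p e)

/-- The tuples assigned to the paths from `a` to `b`: composites of tuples of edges and of homotopy
inverses of such tuples, where an edge is traversed backwards. -/
inductive PathTuple (C : CarriageReturns W) (p : OrthPair) (a : (C.graph p).toGraph.V) :
    ∀ b : (C.graph p).toGraph.V, Typewriter.Tuple (C.typewriter p a) (C.typewriter p b) → Prop
  | nil : PathTuple C p a a (Typewriter.Tuple.id (C.typewriter p a))
  | forward {b c : (C.graph p).toGraph.V}
      {T : Typewriter.Tuple (C.typewriter p a) (C.typewriter p b)} (h : PathTuple C p a b T)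
      (e : (C.graph p).toGraph.E b c) : PathTuple C p a c ((C.tuple p e).comp T)
  | backward {b c : (C.graph p).toGraph.V}
      {T : Typewriter.Tuple (C.typewriter p a) (C.typewriter p b)} (h : PathTuple C p a b T)
      (e : (C.graph p).toGraph.E c b)
      {S : Typewriter.Tuple (C.typewriter p b) (C.typewriter p c)} (hS : (C.tuple p e).IsHInverse S) :
      PathTuple C p a c (S.comp T)

/-- The carriage returns are strong: the homotopy class of the morphism of typewriters assigned to a
path depends only on its ends. -/
def IsStrong (C : CarriageReturns W) : Prop :=
  ∀ p (a b : (C.graph p).toGraph.V) (T T' : Typewriter.Tuple (C.typewriter p a) (C.typewriter p b)),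
    C.PathTuple p a b T → C.PathTuple p a b T' → T.Homotopic T'

/-- An extension of the typewriters of the orthogonal pairs to the morphisms of
`DiffBorSutTor₂^⊥`: auxiliary data for the morphisms of pairs, with a morphism of typewriters for
every vertex, compatible up to homotopy with the morphisms of typewriters of the edges. -/
structure PairMaps (C : CarriageReturns W) where
  mor : ∀ {p q : OrthPair}, (p ⟶ q) → ((C.graph p).toGraph.prod (C.graph q).toGraph).Sub
  mor_connected : ∀ {p q : OrthPair} (φ : p ⟶ q), (mor φ).toGraph.Connected
  tup : ∀ {p q : OrthPair} (φ : p ⟶ q) (d : (mor φ).toGraph.V),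
    Typewriter.Tuple (C.typewriter p d.1.1) (C.typewriter q d.1.2)
  isMor : ∀ {p q : OrthPair} (φ : p ⟶ q) (d : (mor φ).toGraph.V), (tup φ d).IsMor
  square : ∀ {p q : OrthPair} (φ : p ⟶ q) {d d' : (mor φ).toGraph.V} (e : (mor φ).toGraph.E d d'),
    Typewriter.Tuple.Homotopic ((C.tuple q e.1.2).comp (tup φ d))
      ((tup φ d').comp (C.tuple p e.1.1))

/-- The auxiliary data for `DiffBorSutTor₂^⊥`. -/
def PairMaps.aux {C : CarriageReturns W} (X : C.PairMaps) : AuxData.{v, w} OrthPair where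
  graph p := (C.graph p).toGraph
  connected := C.connected
  mor φ := X.mor φ
  mor_connected φ := X.mor_connected φ

/-- The invariant `BFD` of `DiffBorSutTor₂^⊥` valued in `DD` bimodules over `(A, 𝒯)`. -/
def BFD {C : CarriageReturns W} (X : C.PairMaps) : Invariant X.aux (DDAlgebra A) where
  onObj p :=
    { obj := fun d => (C.typewriter p d).dd
      map := fun e => (C.tuple p e).dd }
  mor φ d := (X.tup φ d).dd

end CarriageReturns

end

end

/-! The passage `Θ` from typewriters to `DD` bimodules is an algebraic functor, and the theorem is a
list of its properties. Tuples of maps between typewriters carry a differential `Tuple.d`, which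
kills morphisms of typewriters and sends a homotopy from `T` to `T'` to `T + T'`. The map `Tuple.dd`
is strictly compatible with sums, identities, composition and differentials (`dd_add`, `dd_id`,
`dd_comp`, `diff_dd`). This holds coefficient by coefficient: since `gf = hg = 0`, each path of `𝒯`
has only a few factorizations. The trivial paths record the structure equations of `M₀` and `M₁`,
the paths `f` and `h` the cycle equations of `D_f` and `D_h`, and the four paths through `g` the
four components of `d D_CR`. Hence `Θ` preserves structure equations, morphisms, homotopies and
homotopy inverses.

Two points need more than functoriality.

Edges must go to homotopy equivalences. A tuple whose `T₀` and `T₁` are homotopy equivalences has a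
homotopy inverse tuple (`IsMor.exists_isHInverse`). To build it, a homotopy inverse is made coherent
by a second-order homotopy (`IsHEquiv.exists_isCohInverse`). Coherent inverses of the two ends of a
square extend to a coherent inverse of the map of cones (`IsCohInverse.exists_coneMap`), so the
extension can be repeated for the cones of the carriage returns.

Objects must be homotopy equivalent to bounded ones. Even for bounded `M₀` and `M₁` this is not
immediate: boundedness concerns iterates in which nothing is multiplied, and there `D_f` or `D_h`
can alternate with `D_g` forever. Without the carriage return the structure map of `Θ` is
triangular, and `M₀` and `M₁` can be replaced by bounded models (`isObj_dd_of_CR_eq_zero`). The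
carriage return part factors as `ρ π` through the bimodule of the auxiliary typewriter `coneBox`,
which has no carriage return either. The composite `π ρ` is null homotopic by a homotopy `θ` with `ρ
θ = 0` and `θ² = 0`. Cancellation then exhibits `Θ(M)` as an iterated cone of objects already
treated (`IsObj.of_factorization`). Cones of bounded structures are bounded; the proof uses that
every module over a ring of idempotents is flat, so that boundedness supports induction along `δ`.

Auxiliary data for morphisms of pairs exist because zero tuples are compatible with all edges. In
the strong case, homotopy inverses are unique up to homotopy, so the map of bimodules assigned to a
path is homotopic to the image of a tuple assigned to a path, and path independence carries over. -/

noncomputable section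

set_option linter.unusedSimpArgs false

/-! ### The calculus of morphism spaces -/

namespace DGAlgebra

variable (A : DGAlgebra.{u}) {X Y Z : Type u} [AddCommGroup X] [Module A.base X]
  [AddCommGroup Y] [Module A.base Y] [AddCommGroup Z] [Module A.base Z]

theorem ten_add_self (t : A.Ten X) : t + t = 0 := by
  have h : (1 + 1 : A.carrier) = 0 := by
    have := one_smul (ZMod 2) (1 : A.carrier)
    calc (1 + 1 : A.carrier) = (2 : ZMod 2) • (1 : A.carrier) := by rw [two_smul]
      _ = 0 := by rw [show (2 : ZMod 2) = 0 from rfl, zero_smul]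
  calc t + t = (1 + 1 : A.carrier) • t := by rw [add_smul, one_smul]
    _ = 0 := by rw [h, zero_smul]

theorem ext_tm (ψ : X →ₗ[A.base] A.Ten Y) (a : A.carrier) (x : X) :
    A.ext ψ (A.tm a x) = a • ψ x := rfl

theorem tenMap_tm (f : X →ₗ[A.base] Y) (a : A.carrier) (x : X) :
    A.tenMap f (A.tm a x) = A.tm a (f x) := rfl

theorem tenD_tm (a : A.carrier) (x : X) : A.tenD (A.tm a x) = A.tm (A.d a) x := rfl

theorem ext_smul (ψ : X →ₗ[A.base] A.Ten Y) (a : A.carrier) (t : A.Ten X) :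
    A.ext ψ (a • t) = a • A.ext ψ t := by
  induction t using A.ten_induction with
  | zero => simp
  | tm b x => rw [smul_tm, ext_tm, ext_tm, mul_smul]
  | add s t hs ht => rw [smul_add, map_add, hs, ht, map_add, smul_add]

theorem tenD_smul (a : A.carrier) (t : A.Ten X) :
    A.tenD (a • t) = A.d a • t + a • A.tenD t := by
  induction t using A.ten_induction with
  | zero => simp
  | tm b x => rw [smul_tm, tenD_tm, tenD_tm, A.leibniz, add_tm, smul_tm, smul_tm]
  | add s t hs ht => rw [smul_add, map_add, hs, ht, map_add, smul_add, smul_add]; abel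

theorem ext_comp (ψ : Y →ₗ[A.base] A.Ten Z) (φ : X →ₗ[A.base] A.Ten Y) :
    A.ext (A.ext ψ ∘ₗ φ) = A.ext ψ ∘ₗ A.ext φ := by
  ext t
  induction t using A.ten_induction with
  | zero => simp
  | tm a x => simp [ext_tm, ext_smul]
  | add s t hs ht => rw [map_add, hs, ht, map_add]

theorem ext_add (ψ ψ' : X →ₗ[A.base] A.Ten Y) : A.ext (ψ + ψ') = A.ext ψ + A.ext ψ' := by
  ext t
  induction t using A.ten_induction with
  | zero => simp
  | tm a x => simp [ext_tm]
  | add s t hs ht => rw [map_add, hs, ht, map_add]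

theorem ext_zero : A.ext (0 : X →ₗ[A.base] A.Ten Y) = 0 := by
  ext t
  induction t using A.ten_induction with
  | zero => simp
  | tm a x => simp [ext_tm]
  | add s t hs ht => rw [map_add, hs, ht, map_add]

theorem tenD_ext (ψ : X →ₗ[A.base] A.Ten Y) (t : A.Ten X) :
    A.tenD (A.ext ψ t) = A.ext (A.tenD ∘ₗ ψ) t + A.ext ψ (A.tenD t) := by
  induction t using A.ten_induction with
  | zero => simp
  | tm a x => rw [ext_tm, tenD_smul, ext_tm, tenD_tm, ext_tm, add_comm]; rfl
  | add s t hs ht => simp only [map_add, hs, ht]; abel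

/-- The strict map `x ↦ 1 ⊗ f x`. -/
def lin (f : X →ₗ[A.base] Y) : X →ₗ[A.base] A.Ten Y where
  toFun x := A.tm 1 (f x)
  map_add' x x' := by rw [map_add, tm_add]
  map_smul' c x := by
    change A.tm 1 (f (c • x)) = A.unit c • A.tm 1 (f x)
    rw [map_smul, A.tm_smul, A.smul_tm, one_mul, mul_one]

theorem ext_lin (f : X →ₗ[A.base] Y) : A.ext (A.lin f) = A.tenMap f := by
  ext t
  induction t using A.ten_induction with
  | zero => simp
  | tm a x =>
    change a • A.tm 1 (f x) = A.tm a (f x)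
    rw [smul_tm, mul_one]
  | add s t hs ht => rw [map_add, hs, ht, map_add]

theorem ext_comp_lin (ψ : Y →ₗ[A.base] A.Ten Z) (f : X →ₗ[A.base] Y) :
    A.ext ψ ∘ₗ A.lin f = ψ ∘ₗ f := by
  ext x
  change (1 : A.carrier) • ψ (f x) = _
  rw [one_smul]; rfl

theorem tenD_comp_lin (f : X →ₗ[A.base] Y) : A.tenD ∘ₗ A.lin f = 0 := by
  ext x
  have h : A.d 1 = 0 := by rw [← map_one A.unit, A.d_unit]
  change A.tm (A.d 1) (f x) = 0
  rw [h]; exact TensorProduct.zero_tmul _ _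

end DGAlgebra

namespace PreD

variable {A : DGAlgebra.{u}} {L M N P Q : PreD A}

theorem hom_add_self (φ : Hom M N) : φ + φ = 0 := by
  ext x; exact A.ten_add_self _

theorem hom_add_self_left (φ ψ : Hom M N) : φ + (φ + ψ) = ψ := by
  rw [← add_assoc, hom_add_self, zero_add]

theorem hom_eq_iff (φ ψ : Hom M N) : φ = ψ ↔ φ + ψ = 0 := by
  constructor
  · rintro rfl; exact hom_add_self _
  · intro h
    rw [← add_zero φ, ← hom_add_self ψ, ← add_assoc, h, zero_add]

theorem hom_four_zsmul (φ : Hom M N) : (4 : ℤ) • φ = 0 := by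
  rw [show (4 : ℤ) = 2 + 2 from rfl, add_smul, two_zsmul, hom_add_self]

theorem comp_assoc (χ : Hom N P) (ψ : Hom M N) (φ : Hom L M) :
    comp (comp χ ψ) φ = comp χ (comp ψ φ) := by
  unfold comp; rw [A.ext_comp, LinearMap.comp_assoc]

theorem comp_add (ψ : Hom M N) (φ φ' : Hom L M) : comp ψ (φ + φ') = comp ψ φ + comp ψ φ' :=
  LinearMap.comp_add _ _ _

theorem add_comp (ψ ψ' : Hom M N) (φ : Hom L M) : comp (ψ + ψ') φ = comp ψ φ + comp ψ' φ := by
  unfold comp; rw [A.ext_add, LinearMap.add_comp]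

theorem comp_zero (ψ : Hom M N) : comp ψ (0 : Hom L M) = 0 := LinearMap.comp_zero _

theorem zero_comp (φ : Hom L M) : comp (0 : Hom M N) φ = 0 := by
  unfold comp; rw [A.ext_zero, LinearMap.zero_comp]

theorem idHom_eq : idHom M = A.lin LinearMap.id := rfl

theorem comp_id (φ : Hom M N) : comp φ (idHom M) = φ := A.ext_comp_lin φ LinearMap.id

theorem id_comp (φ : Hom M N) : comp (idHom N) φ = φ := by
  unfold comp; rw [idHom_eq, A.ext_lin]
  ext x
  exact LinearMap.congr_fun (LinearMap.lTensor_id A.Bimod N.X) (φ x)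

theorem diff_add (φ ψ : Hom M N) : diff (φ + ψ) = diff φ + diff ψ := by
  unfold diff; rw [comp_add, add_comp, LinearMap.comp_add]; abel

theorem diff_zero : diff (0 : Hom M N) = 0 := by
  unfold diff; rw [comp_zero, zero_comp, LinearMap.comp_zero]; abel

/-- The Leibniz rule `tenD_ext` handles the differential of the algebra; the terms through the
structure map of the middle object `M` occur twice and cancel in characteristic 2. -/
theorem diff_comp (ψ : Hom M N) (φ : Hom L M) :
    diff (comp ψ φ) = comp (diff ψ) φ + comp ψ (diff φ) := by
  have h : A.tenD ∘ₗ comp ψ φ = comp (N := M) (A.tenD ∘ₗ ψ) φ + comp ψ (A.tenD ∘ₗ φ) := by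
    ext x; exact A.tenD_ext ψ (φ x)
  have h2 := hom_add_self (comp (comp ψ M.δ) φ)
  unfold diff
  rw [h, add_comp, add_comp, comp_add, comp_add, comp_assoc ψ M.δ φ] at *
  rw [← comp_assoc, ← comp_assoc ψ φ L.δ]
  calc _ = comp (comp N.δ ψ) φ + comp (comp ψ φ) L.δ +
        (comp (N := M) (A.tenD ∘ₗ ψ) φ + comp ψ (A.tenD ∘ₗ φ)) +
        (comp ψ (comp M.δ φ) + comp ψ (comp M.δ φ)) := by rw [h2, add_zero]
    _ = _ := by abel

theorem diff_id : diff (idHom M) = 0 := by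
  unfold diff
  rw [comp_id, id_comp, hom_add_self, idHom_eq, A.tenD_comp_lin, add_zero]

end PreD

namespace PreD

variable {A : DGAlgebra.{u}} {L M N P Q M' N' M'' N'' : PreD A}

/-! ### Inclusions and projections of a mapping cone -/

def coneInl (φ : Hom M N) : Hom M (cone φ) := A.lin (LinearMap.inl A.base M.X N.X)

def coneInr (φ : Hom M N) : Hom N (cone φ) := A.lin (LinearMap.inr A.base M.X N.X)

def coneFst (φ : Hom M N) : Hom (cone φ) M := A.lin (LinearMap.fst A.base M.X N.X)

def coneSnd (φ : Hom M N) : Hom (cone φ) N := A.lin (LinearMap.snd A.base M.X N.X)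

section

variable (φ : Hom M N)

theorem coneFst_coneInl : comp (coneFst φ) (coneInl φ) = idHom M :=
  (A.ext_comp_lin _ _).trans rfl

theorem coneSnd_coneInr : comp (coneSnd φ) (coneInr φ) = idHom N :=
  (A.ext_comp_lin _ _).trans rfl

theorem coneFst_coneInr : comp (coneFst φ) (coneInr φ) = 0 :=
  (A.ext_comp_lin _ _).trans (by ext x; exact TensorProduct.tmul_zero _ _)

theorem coneSnd_coneInl : comp (coneSnd φ) (coneInl φ) = 0 :=
  (A.ext_comp_lin _ _).trans (by ext x; exact TensorProduct.tmul_zero _ _)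

theorem coneInl_coneFst_add :
    comp (coneInl φ) (coneFst φ) + comp (coneInr φ) (coneSnd φ) = idHom (cone φ) := by
  refine (congrArg₂ (· + ·) (A.ext_comp_lin _ _) (A.ext_comp_lin _ _)).trans ?_
  refine LinearMap.ext fun x => ?_
  change A.tm (X := (cone φ).X) 1 (x.1, 0) + A.tm (X := (cone φ).X) 1 (0, x.2) =
    A.tm (X := (cone φ).X) 1 x
  refine (A.tm_add _ _ _).symm.trans (congrArg (A.tm (X := (cone φ).X) 1) ?_)
  exact Prod.ext (add_zero _) (zero_add _)

theorem diff_coneInr : diff (coneInr φ) = 0 := by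
  have h1 : comp (cone φ).δ (coneInr φ) = comp (coneInr φ) N.δ := by
    refine (A.ext_comp_lin _ _).trans (Eq.trans ?_ (congrArg (· ∘ₗ N.δ) (A.ext_lin _)).symm)
    refine LinearMap.ext fun x => ?_
    change A.tenMap (LinearMap.inl A.base M.X N.X) (M.δ 0) +
      A.tenMap (LinearMap.inr A.base M.X N.X) (N.δ x + φ 0) = _
    rw [map_zero, map_zero, map_zero, zero_add, add_zero]; rfl
  have h2 : A.tenD ∘ₗ coneInr φ = 0 := A.tenD_comp_lin _
  unfold diff
  rw [h1, h2, hom_add_self, add_zero]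

/-- The off-diagonal entry of the structure map of the cone is the whole defect: the target of `φ`
sits in the cone as a subobject, the source only as a quotient. -/
theorem diff_coneInl : diff (coneInl φ) = comp (coneInr φ) φ := by
  have h1 : comp (cone φ).δ (coneInl φ) = comp (coneInl φ) M.δ + comp (coneInr φ) φ := by
    refine (A.ext_comp_lin _ _).trans (Eq.trans ?_ (congrArg₂ (· + ·)
      (congrArg (· ∘ₗ M.δ) (A.ext_lin _)) (congrArg (· ∘ₗ φ) (A.ext_lin _))).symm)
    refine LinearMap.ext fun x => ?_
    change A.tenMap (LinearMap.inl A.base M.X N.X) (M.δ x) +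
      A.tenMap (LinearMap.inr A.base M.X N.X) (N.δ 0 + φ x) = _
    rw [map_zero, zero_add]; rfl
  have h2 : A.tenD ∘ₗ coneInl φ = 0 := A.tenD_comp_lin _
  unfold diff
  rw [h1, h2, add_zero, add_comm, ← add_assoc, hom_add_self, zero_add]

theorem cone_hom_ext {χ χ' : Hom (cone φ) L} (h₀ : comp χ (coneInl φ) = comp χ' (coneInl φ))
    (h₁ : comp χ (coneInr φ) = comp χ' (coneInr φ)) : χ = χ' := by
  rw [← comp_id χ, ← comp_id χ', ← coneInl_coneFst_add, comp_add, comp_add, ← comp_assoc,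
    ← comp_assoc, ← comp_assoc, ← comp_assoc, h₀, h₁]

/-- The differentials of the projections are forced by those of the inclusions: differentiate the
identities between inclusions and projections, and use that a map out of a cone is determined by its
restrictions to the summands. -/
theorem diff_coneFst : diff (coneFst φ) = 0 := by
  refine cone_hom_ext φ ?_ ?_
  · have h := diff_comp (coneFst φ) (coneInl φ)
    rw [coneFst_coneInl, diff_id, diff_coneInl, ← comp_assoc, coneFst_coneInr, zero_comp,
      add_zero] at h
    rw [← h, zero_comp]
  · have h := diff_comp (coneFst φ) (coneInr φ)
    rw [coneFst_coneInr, diff_zero, diff_coneInr, comp_zero, add_zero] at h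
    rw [← h, zero_comp]

theorem diff_coneSnd : diff (coneSnd φ) = comp φ (coneFst φ) := by
  refine cone_hom_ext φ ?_ ?_
  · have h := diff_comp (coneSnd φ) (coneInl φ)
    rw [coneSnd_coneInl, diff_zero, diff_coneInl, ← comp_assoc, coneSnd_coneInr, id_comp] at h
    rw [comp_assoc, coneFst_coneInl, comp_id, hom_eq_iff, ← h]
  · have h := diff_comp (coneSnd φ) (coneInr φ)
    rw [coneSnd_coneInr, diff_id, diff_coneInr, comp_zero, add_zero] at h
    rw [← h, comp_assoc, coneFst_coneInr, comp_zero]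

theorem coneFst_coneInl_comp (χ : Hom L M) : comp (coneFst φ) (comp (coneInl φ) χ) = χ := by
  rw [← comp_assoc, coneFst_coneInl, id_comp]

theorem coneSnd_coneInr_comp (χ : Hom L N) : comp (coneSnd φ) (comp (coneInr φ) χ) = χ := by
  rw [← comp_assoc, coneSnd_coneInr, id_comp]

theorem coneFst_coneInr_comp (χ : Hom L N) : comp (coneFst φ) (comp (coneInr φ) χ) = 0 := by
  rw [← comp_assoc, coneFst_coneInr, zero_comp]

theorem coneSnd_coneInl_comp (χ : Hom L M) : comp (coneSnd φ) (comp (coneInl φ) χ) = 0 := by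
  rw [← comp_assoc, coneSnd_coneInl, zero_comp]

theorem ext_lin_comp_lin {X Y Z W : Type u} [AddCommGroup X] [Module A.base X] [AddCommGroup Y]
    [Module A.base Y] [AddCommGroup Z] [Module A.base Z] [AddCommGroup W] [Module A.base W]
    (T : Y →ₗ[A.base] A.Ten Z) (i : X →ₗ[A.base] Y) (p : Z →ₗ[A.base] W) :
    A.ext (A.lin p) ∘ₗ A.ext T ∘ₗ A.lin i = A.tenMap p ∘ₗ T ∘ₗ i := by
  rw [A.ext_comp_lin, A.ext_lin]

section

variable {φ} {φ' : Hom M' N'} (T : Hom (cone φ) (cone φ'))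

/-- Here and in the three variants below, components become composites in the dg category, to which
`diff_comp` and `comp_assoc` apply. -/
theorem component_inl_fst : component T (LinearMap.inl _ _ _) (LinearMap.fst _ _ _) =
    comp (coneFst φ') (comp T (coneInl φ)) := (ext_lin_comp_lin _ _ _).symm

theorem component_inl_snd : component T (LinearMap.inl _ _ _) (LinearMap.snd _ _ _) =
    comp (coneSnd φ') (comp T (coneInl φ)) := (ext_lin_comp_lin _ _ _).symm

theorem component_inr_fst : component T (LinearMap.inr _ _ _) (LinearMap.fst _ _ _) =
    comp (coneFst φ') (comp T (coneInr φ)) := (ext_lin_comp_lin _ _ _).symm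

theorem component_inr_snd : component T (LinearMap.inr _ _ _) (LinearMap.snd _ _ _) =
    comp (coneSnd φ') (comp T (coneInr φ)) := (ext_lin_comp_lin _ _ _).symm

end

end

/-! ### Maps of cones -/

section coneMap

variable (φ : Hom M N) (φ' : Hom M' N') (φ'' : Hom M'' N'')

/-- With this expansion, matrix calculations reduce to rewriting with the relations between
inclusions and projections. -/
theorem coneMap_eq (a : Hom M M') (b : Hom N N') (c : Hom M N') :
    coneMap φ φ' a b c = comp (coneInl φ') (comp a (coneFst φ)) +
      comp (coneInr φ') (comp b (coneSnd φ) + comp c (coneFst φ)) := by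
  have h : ∀ {X Y Z W : Type u} [AddCommGroup X] [Module A.base X] [AddCommGroup Y]
      [Module A.base Y] [AddCommGroup Z] [Module A.base Z] [AddCommGroup W] [Module A.base W]
      (T : Y →ₗ[A.base] A.Ten Z) (i : X →ₗ[A.base] Y) (p : Z →ₗ[A.base] W),
      A.tenMap p ∘ₗ T ∘ₗ i = A.ext (A.lin p) ∘ₗ A.ext T ∘ₗ A.lin i :=
    fun T i p => (ext_lin_comp_lin T i p).symm
  rw [comp_add, ← add_assoc]
  unfold coneMap
  rw [LinearMap.comp_add, ← add_assoc, h, h, h]; rfl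

theorem comp_coneMap (a : Hom M M') (b : Hom N N') (c : Hom M N')
    (a' : Hom M' M'') (b' : Hom N' N'') (c' : Hom M' N'') :
    comp (coneMap φ' φ'' a' b' c') (coneMap φ φ' a b c) =
      coneMap φ φ'' (comp a' a) (comp b' b) (comp b' c + comp c' a) := by
  simp only [coneMap_eq, comp_add, add_comp, comp_assoc, coneFst_coneInl_comp,
    coneFst_coneInr_comp, coneSnd_coneInl_comp, coneSnd_coneInr_comp, comp_zero, zero_comp,
    add_zero, zero_add]
  abel

theorem add_coneMap (a a' : Hom M M') (b b' : Hom N N') (c c' : Hom M N') :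
    coneMap φ φ' a b c + coneMap φ φ' a' b' c' = coneMap φ φ' (a + a') (b + b') (c + c') := by
  simp only [coneMap_eq, comp_add, add_comp]; abel

theorem coneMap_id : coneMap φ φ (idHom M) (idHom N) 0 = idHom (cone φ) := by
  rw [coneMap_eq, id_comp, id_comp, zero_comp, add_zero, coneInl_coneFst_add]

theorem coneMap_zero : coneMap φ φ' 0 0 0 = 0 := by
  simp only [coneMap_eq, zero_comp, add_zero, comp_zero]

/-- The two extra off-diagonal terms come from `diff_coneInl` and `diff_coneSnd`. A map of cones is
therefore a cycle exactly when its diagonal entries are cycles and `c` is a homotopy for the square.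
-/
theorem diff_coneMap (a : Hom M M') (b : Hom N N') (c : Hom M N') :
    diff (coneMap φ φ' a b c) =
      coneMap φ φ' (diff a) (diff b) (diff c + comp b φ + comp φ' a) := by
  simp only [coneMap_eq, diff_add, diff_comp, diff_coneInl, diff_coneInr, diff_coneFst,
    diff_coneSnd, comp_add, add_comp, comp_assoc, zero_comp, comp_zero, zero_add, add_zero]
  abel

theorem coneFst_coneMap_coneInl (a : Hom M M') (b : Hom N N') (c : Hom M N') :
    comp (coneFst φ') (comp (coneMap φ φ' a b c) (coneInl φ)) = a := by
  simp only [coneMap_eq, comp_add, add_comp, comp_assoc, coneFst_coneInl_comp, coneFst_coneInl,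
    coneFst_coneInr_comp, coneSnd_coneInl, comp_zero, comp_id, add_zero]

theorem coneSnd_coneMap_coneInr (a : Hom M M') (b : Hom N N') (c : Hom M N') :
    comp (coneSnd φ') (comp (coneMap φ φ' a b c) (coneInr φ)) = b := by
  simp only [coneMap_eq, comp_add, add_comp, comp_assoc, coneSnd_coneInl_comp,
    coneSnd_coneInr_comp, coneFst_coneInr, coneSnd_coneInr, comp_zero, comp_id, zero_add, add_zero]

theorem coneSnd_coneMap_coneInl (a : Hom M M') (b : Hom N N') (c : Hom M N') :
    comp (coneSnd φ') (comp (coneMap φ φ' a b c) (coneInl φ)) = c := by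
  simp only [coneMap_eq, comp_add, add_comp, comp_assoc, coneSnd_coneInl_comp,
    coneSnd_coneInr_comp, coneFst_coneInl, coneSnd_coneInl, comp_zero, comp_id, zero_add]

variable {φ φ'} in
theorem coneMap_inj {a a' : Hom M M'} {b b' : Hom N N'} {c c' : Hom M N'}
    (h : coneMap φ φ' a b c = coneMap φ φ' a' b' c') : a = a' ∧ b = b' ∧ c = c' := by
  refine ⟨?_, ?_, ?_⟩
  · rw [← coneFst_coneMap_coneInl φ φ' a b c, h, coneFst_coneMap_coneInl]
  · rw [← coneSnd_coneMap_coneInr φ φ' a b c, h, coneSnd_coneMap_coneInr]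
  · rw [← coneSnd_coneMap_coneInl φ φ' a b c, h, coneSnd_coneMap_coneInl]

end coneMap

theorem isTypeD_iff : M.IsTypeD ↔ comp M.δ M.δ + A.tenD ∘ₗ M.δ = 0 := Iff.rfl

/-- The structure map of the cone is itself the cone map with entries `M.δ`, `N.δ` and `φ`. Its
structure equation has those of `M` and `N` on the diagonal and the cycle equation of `φ` off it. -/
theorem IsTypeD.cone {φ : Hom M N} (hM : M.IsTypeD) (hN : N.IsTypeD) (hφ : IsMor φ) :
    (cone φ).IsTypeD := by
  have hδ : (PreD.cone φ).δ = coneMap φ φ M.δ N.δ φ := rfl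
  have h0 : A.tenD ∘ₗ coneMap φ φ M.δ N.δ φ =
      coneMap φ φ (A.tenD ∘ₗ M.δ) (A.tenD ∘ₗ N.δ) (A.tenD ∘ₗ φ) := by
    have h : ∀ (L M N : PreD A) (ψ : Hom M N) (φ : Hom L M),
        A.tenD ∘ₗ comp ψ φ = comp (N := M) (A.tenD ∘ₗ ψ) φ + comp ψ (A.tenD ∘ₗ φ) := by
      intros; ext x; exact A.tenD_ext _ _
    have e1 : A.tenD ∘ₗ coneInl φ = 0 := A.tenD_comp_lin _
    have e2 : A.tenD ∘ₗ coneInr φ = 0 := A.tenD_comp_lin _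
    have e3 : A.tenD ∘ₗ coneFst φ = 0 := A.tenD_comp_lin _
    have e4 : A.tenD ∘ₗ coneSnd φ = 0 := A.tenD_comp_lin _
    simp only [coneMap_eq, LinearMap.comp_add, h, e1, e2, e3, e4, comp_zero, zero_comp, zero_add,
      add_zero]
  rw [isTypeD_iff, hδ, comp_coneMap, h0, add_coneMap, ← coneMap_zero]
  congr 1

end PreD

namespace PreD

variable {A : DGAlgebra.{u}} {L M N P Q M' N' M'' N'' : PreD A}

/-! ### Homotopies and homotopy equivalences -/

theorem isMor_id : IsMor (idHom M) := diff_id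

theorem IsMor.comp {ψ : Hom M N} {φ : Hom L M} (hψ : IsMor ψ) (hφ : IsMor φ) :
    IsMor (comp ψ φ) := by
  unfold IsMor at *; rw [diff_comp, hψ, hφ, zero_comp, comp_zero, add_zero]

theorem Homotopic.refl (φ : Hom M N) : Homotopic φ φ :=
  ⟨0, by rw [IsHomotopy, hom_add_self, diff_zero]⟩

theorem Homotopic.symm {φ ψ : Hom M N} (h : Homotopic φ ψ) : Homotopic ψ φ := by
  obtain ⟨H, hH⟩ := h
  exact ⟨H, by rw [IsHomotopy, add_comm, hH]⟩

theorem Homotopic.trans {φ ψ χ : Hom M N} (h : Homotopic φ ψ) (h' : Homotopic ψ χ) :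
    Homotopic φ χ := by
  obtain ⟨H, hH⟩ := h
  obtain ⟨H', hH'⟩ := h'
  refine ⟨H + H', ?_⟩
  rw [IsHomotopy, diff_add, ← hH, ← hH', add_assoc, hom_add_self_left]

theorem Homotopic.comp_left {φ φ' : Hom L M} {ψ : Hom M N} (hψ : IsMor ψ)
    (h : Homotopic φ φ') : Homotopic (comp ψ φ) (comp ψ φ') := by
  obtain ⟨H, hH⟩ := h
  refine ⟨PreD.comp ψ H, ?_⟩
  rw [IsHomotopy, diff_comp, hψ, zero_comp, zero_add, ← hH, comp_add]

theorem Homotopic.comp_right {ψ ψ' : Hom M N} {φ : Hom L M} (hφ : IsMor φ)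
    (h : Homotopic ψ ψ') : Homotopic (comp ψ φ) (comp ψ' φ) := by
  obtain ⟨H, hH⟩ := h
  refine ⟨PreD.comp H φ, ?_⟩
  rw [IsHomotopy, diff_comp, hφ, comp_zero, add_zero, ← hH, add_comp]

theorem IsHInverse.symm {φ : Hom M N} {ψ : Hom N M} (hφ : IsMor φ) (h : IsHInverse φ ψ) :
    IsHInverse ψ φ := ⟨hφ, h.2.2, h.2.1⟩

theorem IsHInverse.comp {φ : Hom M N} {ψ : Hom N M} {φ' : Hom N P} {ψ' : Hom P N}
    (hφ : IsMor φ) (h : IsHInverse φ ψ) (hφ' : IsMor φ') (h' : IsHInverse φ' ψ') :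
    IsHInverse (comp φ' φ) (comp ψ ψ') := by
  refine ⟨h.1.comp h'.1, ?_, ?_⟩
  · rw [comp_assoc, ← comp_assoc ψ' φ' φ]
    refine ((h'.2.1.comp_right hφ).comp_left h.1).trans ?_
    rw [id_comp]; exact h.2.1
  · rw [comp_assoc, ← comp_assoc φ ψ ψ']
    refine ((h.2.2.comp_right h'.1).comp_left hφ').trans ?_
    rw [id_comp]; exact h'.2.2

theorem IsHEquiv.comp {φ : Hom M N} {φ' : Hom N P} (h' : IsHEquiv φ') (h : IsHEquiv φ) :
    IsHEquiv (comp φ' φ) := by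
  obtain ⟨ψ, hψ⟩ := h.2
  obtain ⟨ψ', hψ'⟩ := h'.2
  exact ⟨h'.1.comp h.1, _, hψ.comp h.1 h'.1 hψ'⟩

/-- Both inverses are homotopic to the composite `ψ φ ψ'`. -/
theorem IsHInverse.homotopic {φ : Hom M N} {ψ ψ' : Hom N M} (h : IsHInverse φ ψ)
    (h' : IsHInverse φ ψ') : Homotopic ψ ψ' := by
  have h1 := h'.2.2.symm.comp_left h.1
  have h2 := h.2.1.comp_right h'.1
  rw [comp_id] at h1
  rw [id_comp, comp_assoc] at h2
  exact h1.trans h2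

/-- A homotopy inverse `S` of `T`, with homotopies `H` and `H'` for the two composites that are
compatible by means of `K`. -/
structure IsCohInverse (T : Hom M N) (S : Hom N M) (H : Hom M M) (H' : Hom N N) (K : Hom M N) :
    Prop where
  mor : diff S = 0
  left : diff H = comp S T + idHom M
  right : diff H' = comp T S + idHom N
  coh : diff K = comp T H + comp H' T

/-- For arbitrary homotopies, the defect `c = T H + H' T` is a cycle. Replacing `H'` by `H' + c S`
leaves its differential unchanged and turns the defect into `c + c S T = c (dH) = d(c H)`, so `K = c
H` works. -/
theorem IsHEquiv.exists_isCohInverse {T : Hom M N} (hT : IsHEquiv T) :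
    ∃ S H H' K, IsCohInverse T S H H' K := by
  obtain ⟨hT, S, hS, ⟨H, hH⟩, ⟨H', hH'⟩⟩ := hT
  unfold IsMor IsHomotopy at *
  refine ⟨S, H, H' + PreD.comp T (PreD.comp H S) + PreD.comp H' (PreD.comp T S),
    PreD.comp (PreD.comp T H + PreD.comp H' T) H,
    hS, hH.symm, ?_, ?_⟩
  · simp only [diff_add, diff_comp, hT, hS, ← hH, ← hH', comp_add, add_comp, comp_assoc,
      comp_id, id_comp, zero_comp, comp_zero, add_zero, zero_add]
    -- With everything on one side, `abel_nf` collects repeated terms into even multiples, which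
    -- vanish in characteristic 2.
    rw [hom_eq_iff]
    abel_nf
    simp only [two_zsmul, hom_add_self, hom_four_zsmul, add_zero, zero_add]
  · simp only [diff_add, diff_comp, hT, ← hH, ← hH', comp_add, add_comp, comp_assoc,
      comp_id, id_comp, zero_comp, comp_zero, add_zero, zero_add]
    rw [hom_eq_iff]
    abel_nf
    simp only [two_zsmul, hom_add_self, hom_four_zsmul, add_zero, zero_add]

/-- Coherent homotopy inverses of the components of a map of cones extend to one of the map. -/
theorem IsCohInverse.exists_coneMap {D : Hom M N} {D' : Hom M' N'} {T₀ : Hom M M'}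
    {S₀ : Hom M' M} {H₀ : Hom M M} {H₀' : Hom M' M'} {K₀ : Hom M M'} {T₁ : Hom N N'}
    {S₁ : Hom N' N} {H₁ : Hom N N} {H₁' : Hom N' N'} {K₁ : Hom N N'}
    (h₀ : IsCohInverse T₀ S₀ H₀ H₀' K₀) (h₁ : IsCohInverse T₁ S₁ H₁ H₁' K₁) (hD : IsMor D)
    (hD' : IsMor D') {E : Hom M N'} (hE : IsHomotopy E (comp T₁ D) (comp D' T₀)) :
    ∃ S H H' K, IsCohInverse (coneMap D D' T₀ T₁ E) (coneMap D' D S₀ S₁ S)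
      (coneMap D D H₀ H₁ H) (coneMap D' D' H₀' H₁' H') (coneMap D D' K₀ K₁ K) := by
  -- The first witness joins `S₁ D'` to `D S₀` by way of `S₁ D' T₀ S₀` and `S₁ T₁ D S₀`, using
  -- `H₀'`, `E` and `H₁` in turn. The other three come from the same formula on replacing `(S₀,
  -- H₀')` by `(H₀, K₀)` on the right, `(S₁, H₁)` by `(H₁', K₁)` on the left, or both.
  refine ⟨comp H₁ (comp D S₀) + comp S₁ (comp E S₀ + comp D' H₀'),
    comp H₁ (comp D H₀) + comp S₁ (comp E H₀ + comp D' K₀),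
    comp K₁ (comp D S₀) + comp H₁' (comp E S₀ + comp D' H₀'),
    comp K₁ (comp D H₀) + comp H₁' (comp E H₀ + comp D' K₀), ?_⟩
  have hE' : diff E = comp T₁ D + comp D' T₀ := hE.symm
  unfold IsMor at *
  obtain ⟨a₀, b₀, c₀, d₀⟩ := h₀
  obtain ⟨a₁, b₁, c₁, d₁⟩ := h₁
  constructor
  · rw [diff_coneMap, ← coneMap_zero]
    congr 1
    simp only [diff_add, diff_comp, hD, hD', hE', a₀, b₀, c₀, d₀, a₁, b₁, c₁, d₁,
      comp_add, add_comp, comp_assoc, comp_id, id_comp, zero_comp, comp_zero, add_zero, zero_add]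
    abel_nf
    simp only [two_zsmul, hom_add_self, add_zero]
  · rw [diff_coneMap, comp_coneMap, ← coneMap_id, add_coneMap]
    congr 1
    simp only [diff_add, diff_comp, hD, hD', hE', a₀, b₀, c₀, d₀, a₁, b₁, c₁, d₁,
      comp_add, add_comp, comp_assoc, comp_id, id_comp, zero_comp, comp_zero, add_zero, zero_add]
    rw [hom_eq_iff]
    abel_nf
    simp only [two_zsmul, hom_add_self, add_zero]
  · rw [diff_coneMap, comp_coneMap, ← coneMap_id, add_coneMap]
    congr 1
    simp only [diff_add, diff_comp, hD, hD', hE', a₀, b₀, c₀, d₀, a₁, b₁, c₁, d₁,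
      comp_add, add_comp, comp_assoc, comp_id, id_comp, zero_comp, comp_zero, add_zero, zero_add]
    rw [hom_eq_iff]
    abel_nf
    simp only [two_zsmul, hom_add_self, add_zero]
  · rw [diff_coneMap, comp_coneMap, comp_coneMap, add_coneMap]
    congr 1
    simp only [diff_add, diff_comp, hD, hD', hE', a₀, b₀, c₀, d₀, a₁, b₁, c₁, d₁,
      comp_add, add_comp, comp_assoc, comp_id, id_comp, zero_comp, comp_zero, add_zero, zero_add]
    rw [hom_eq_iff]
    abel_nf
    simp only [two_zsmul, hom_add_self, add_zero]

theorem isMor_coneMap {D : Hom M N} {D' : Hom M' N'} {T₀ : Hom M M'} {T₁ : Hom N N'}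
    (hT₀ : IsMor T₀) (hT₁ : IsMor T₁) {E : Hom M N'}
    (hE : IsHomotopy E (comp T₁ D) (comp D' T₀)) : IsMor (coneMap D D' T₀ T₁ E) := by
  unfold IsMor IsHomotopy at *
  rw [diff_coneMap, hT₀, hT₁, ← hE, ← coneMap_zero]
  congr 1
  rw [add_assoc, hom_add_self]

theorem isHomotopy_of_isMor_coneMap {D : Hom M N} {D' : Hom M' N'} {T₀ : Hom M M'}
    {T₁ : Hom N N'} {E : Hom M N'} (h : IsMor (coneMap D D' T₀ T₁ E)) :
    IsHomotopy E (comp T₁ D) (comp D' T₀) := by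
  unfold IsMor at h
  rw [diff_coneMap, ← coneMap_zero] at h
  rw [IsHomotopy, hom_eq_iff, ← (coneMap_inj h).2.2]
  abel

theorem IsCohInverse.isHInverse {T : Hom M N} {S : Hom N M} {H : Hom M M} {H' : Hom N N}
    {K : Hom M N} (h : IsCohInverse T S H H' K) : IsHInverse T S :=
  ⟨h.mor, ⟨H, h.left.symm⟩, ⟨H', h.right.symm⟩⟩

end PreD

/-! ### Homotopy inverses of morphisms of typewriters -/

namespace Typewriter

open PreD

variable {A : DGAlgebra.{u}}

/-- The constituents of a typewriter satisfy the structure equations. -/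
structure IsValid (M : Typewriter A) : Prop where
  obj₀ : M.M₀.IsTypeD
  obj₁ : M.M₁.IsTypeD
  f : PreD.IsMor M.Df
  h : PreD.IsMor M.Dh
  cr : PreD.IsMor M.CR

namespace Tuple

variable {M M' M'' : Typewriter A}

theorem IsMor.isMor_coneF {T : Tuple M M'} (hT : T.IsMor) : PreD.IsMor T.coneF :=
  isMor_coneMap hT.mor₀ hT.mor₁ hT.f

theorem IsMor.isMor_coneH {T : Tuple M M'} (hT : T.IsMor) : PreD.IsMor T.coneH :=
  isMor_coneMap hT.mor₀ hT.mor₁ hT.h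

/-- A morphism of typewriters with homotopy equivalences `T₀` and `T₁` has a homotopy inverse. -/
theorem IsMor.exists_isHInverse {T : Tuple M M'} (hM : M.IsValid) (hM' : M'.IsValid)
    (hT : T.IsMor) (h₀ : IsHEquiv T.T₀) (h₁ : IsHEquiv T.T₁) :
    ∃ S : Tuple M' M, T.IsHInverse S := by
  obtain ⟨S₀, H₀, H₀', K₀, c₀⟩ := h₀.exists_isCohInverse
  obtain ⟨S₁, H₁, H₁', K₁, c₁⟩ := h₁.exists_isCohInverse
  -- The extension is used on two levels: over the cones of `D_f` and `D_h`, and then, with the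
  -- resulting inverses as ends of a square, over the cone of the carriage return. The coherences
  -- `Kf` and `Kh` are what permits the second use.
  obtain ⟨Sf, Hf, Hf', Kf, cf⟩ := c₀.exists_coneMap c₁ hM.f hM'.f hT.f
  obtain ⟨Sh, Hh, Hh', Kh, ch⟩ := c₀.exists_coneMap c₁ hM.h hM'.h hT.h
  obtain ⟨Sc, Hc, Hc', Kc, cc⟩ := cf.exists_coneMap ch hM.cr hM'.cr hT.cr
  refine ⟨⟨S₀, S₁, Sf, Sh, Sc⟩, ⟨c₀.mor, c₁.mor, isHomotopy_of_isMor_coneMap cf.mor,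
    isHomotopy_of_isMor_coneMap ch.mor, isHomotopy_of_isMor_coneMap cc.mor⟩,
    ⟨⟨H₀, H₁, Hf, Hh, Hc⟩, c₀.left.symm, c₁.left.symm, ?_, ?_, ?_⟩,
    ⟨⟨H₀', H₁', Hf', Hh', Hc'⟩, c₀.right.symm, c₁.right.symm, ?_, ?_, ?_⟩⟩
  · exact (cf.left.trans (by rw [comp_coneMap, ← coneMap_id]; rfl)).symm
  · exact (ch.left.trans (by rw [comp_coneMap, ← coneMap_id]; rfl)).symm
  · refine (cc.left.trans ?_).symm
    rw [comp_coneMap, ← coneMap_id, ← coneMap_id, ← coneMap_id, comp_coneMap, comp_coneMap]; rfl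
  · exact (cf.right.trans (by rw [comp_coneMap, ← coneMap_id]; rfl)).symm
  · exact (ch.right.trans (by rw [comp_coneMap, ← coneMap_id]; rfl)).symm
  · refine (cc.right.trans ?_).symm
    rw [comp_coneMap, ← coneMap_id, ← coneMap_id, ← coneMap_id, comp_coneMap, comp_coneMap]; rfl

end Tuple

end Typewriter

/-! ### Composition of coefficient maps -/

namespace Torus

theorem f_i1 : gen .f * gen .i1 = gen .f := by have := rel .fi1; rwa [map_mul] at this
theorem g_i0 : gen .g * gen .i0 = gen .g := by have := rel .gi0; rwa [map_mul] at this
theorem h_i1 : gen .h * gen .i1 = gen .h := by have := rel .hi1; rwa [map_mul] at this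
theorem g_f : gen .g * gen .f = 0 := by have := rel .gf; rwa [map_mul, map_zero] at this
theorem h_g : gen .h * gen .g = 0 := by have := rel .hg; rwa [map_mul, map_zero] at this

theorem i0_f_mul (x : T) : gen .i0 * (gen .f * x) = gen .f * x := by rw [← mul_assoc, i0_f]
theorem i1_g_mul (x : T) : gen .i1 * (gen .g * x) = gen .g * x := by rw [← mul_assoc, i1_g]
theorem g_f_mul (x : T) : gen .g * (gen .f * x) = 0 := by rw [← mul_assoc, g_f, zero_mul]
theorem h_g_mul (x : T) : gen .h * (gen .g * x) = 0 := by rw [← mul_assoc, h_g, zero_mul]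

end Torus

section DD

variable {A : DGAlgebra.{u}} {X₀ X₁ Y₀ Y₁ Z₀ Z₁ Y Z : Type u}
  [AddCommGroup X₀] [Module A.base X₀] [AddCommGroup X₁] [Module A.base X₁]
  [AddCommGroup Y₀] [Module A.base Y₀] [AddCommGroup Y₁] [Module A.base Y₁]
  [AddCommGroup Z₀] [Module A.base Z₀] [AddCommGroup Z₁] [Module A.base Z₁]
  [AddCommGroup Y] [Module A.base Y] [AddCommGroup Z] [Module A.base Z]

theorem ddTmul_mul (a b : A.carrier) (s t : Torus.T) :
    ddTmul a s * ddTmul b t = ddTmul (a * b) (s * t) :=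
  Algebra.TensorProduct.tmul_mul_tmul _ _ _ _

theorem tensT_tm {t : Torus.T} {inc : Y →+ Split X₀ X₁}
    (hinc : ∀ (c : A.base) y, inc (c • y) = baseIncl c • inc y) (a : A.carrier) (y : Y) :
    tensT t inc hinc (A.tm a y) = (DDAlgebra A).tm (ddTmul a t) (inc y) := rfl

theorem ddTmul_smul_tensT (a : A.carrier) (s : Torus.T) {t : Torus.T} {inc : Y →+ Split X₀ X₁}
    (hinc : ∀ (c : A.base) y, inc (c • y) = baseIncl c • inc y) (τ : A.Ten Y) :
    ddTmul a s • tensT t inc hinc τ = tensT (s * t) inc hinc (a • τ) := by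
  induction τ using A.ten_induction with
  | zero => simp
  | tm b y =>
    rw [tensT_tm, DGAlgebra.smul_tm, DGAlgebra.smul_tm, tensT_tm, ddTmul_mul]
  | add s t hs ht => rw [map_add, smul_add, hs, ht, smul_add, map_add]

theorem tensT_zero {inc : Y →+ Split X₀ X₁}
    (hinc : ∀ (c : A.base) y, inc (c • y) = baseIncl c • inc y) (τ : A.Ten Y) :
    tensT 0 inc hinc τ = 0 := by
  induction τ using A.ten_induction with
  | zero => simp
  | tm b y =>
    rw [tensT_tm]
    have : ddTmul b (0 : Torus.T) = 0 := TensorProduct.tmul_zero _ _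
    rw [this]; exact TensorProduct.zero_tmul _ _
  | add s t hs ht => rw [map_add, hs, ht, add_zero]

theorem tenD_tensT {t : Torus.T} {inc : Y →+ Split X₀ X₁}
    (hinc : ∀ (c : A.base) y, inc (c • y) = baseIncl c • inc y) (τ : A.Ten Y) :
    (DDAlgebra A).tenD (tensT t inc hinc τ) = tensT t inc hinc (A.tenD τ) := by
  induction τ using A.ten_induction with
  | zero => simp
  | tm b y =>
    rw [tensT_tm, DGAlgebra.tenD_tm, DGAlgebra.tenD_tm, tensT_tm]
    congr 1
    change A.d b ⊗ₜ[ZMod 2] t + b ⊗ₜ[ZMod 2] (0 : Torus.T) = A.d b ⊗ₜ[ZMod 2] t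
    rw [TensorProduct.tmul_zero, add_zero]
  | add s t hs ht => rw [map_add, map_add, hs, ht, map_add, map_add]

open Torus

section

variable (E₀ : X₀ →ₗ[A.base] A.Ten Z₀) (E₁ : X₁ →ₗ[A.base] A.Ten Z₁)
    (Df Dh : X₀ →ₗ[A.base] A.Ten Z₁) (Dg : X₁ →ₗ[A.base] A.Ten Z₀)
    (Dfg : X₀ →ₗ[A.base] A.Ten Z₀) (Dgh : X₁ →ₗ[A.base] A.Ten Z₁)
    (Dfgh : X₀ →ₗ[A.base] A.Ten Z₁)

theorem ofCoefficients_apply (x : Split X₀ X₁) :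
    ofCoefficients E₀ E₁ Df Dh Dg Dfg Dgh Dfgh x =
      tensT (gen .i0) splitInl splitInl_smul (E₀ x.1) +
      tensT (gen .i1) splitInr splitInr_smul (E₁ x.2) +
      tensT (gen .f) splitInr splitInr_smul (Df x.1) +
      tensT (gen .h) splitInr splitInr_smul (Dh x.1) +
      tensT (gen .g) splitInl splitInl_smul (Dg x.2) +
      tensT (gen .f * gen .g) splitInl splitInl_smul (Dfg x.1) +
      tensT (gen .g * gen .h) splitInr splitInr_smul (Dgh x.2) +
      tensT (gen .f * gen .g * gen .h) splitInr splitInr_smul (Dfgh x.1) := rfl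

theorem ext_ofCoefficients_inl (t : Torus.T) (τ : A.Ten X₀) :
    (DDAlgebra A).ext (ofCoefficients E₀ E₁ Df Dh Dg Dfg Dgh Dfgh)
        (tensT t splitInl splitInl_smul τ) =
      tensT (t * gen .i0) splitInl splitInl_smul (A.ext E₀ τ) +
      tensT (t * gen .f) splitInr splitInr_smul (A.ext Df τ) +
      tensT (t * gen .h) splitInr splitInr_smul (A.ext Dh τ) +
      tensT (t * (gen .f * gen .g)) splitInl splitInl_smul (A.ext Dfg τ) +
      tensT (t * (gen .f * gen .g * gen .h)) splitInr splitInr_smul (A.ext Dfgh τ) := by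
  induction τ using A.ten_induction with
  | zero => simp only [map_zero, add_zero]
  | tm a y =>
    rw [tensT_tm, DGAlgebra.ext_tm, ofCoefficients_apply]
    have h1 : (splitInl y : Split X₀ X₁).1 = y := rfl
    have h2 : (splitInl y : Split X₀ X₁).2 = 0 := rfl
    simp only [h1, h2, map_zero, add_zero, smul_add, ddTmul_smul_tensT, DGAlgebra.ext_tm]
  | add s t hs ht => simp only [map_add, hs, ht]; abel

theorem ext_ofCoefficients_inr (t : Torus.T) (τ : A.Ten X₁) :
    (DDAlgebra A).ext (ofCoefficients E₀ E₁ Df Dh Dg Dfg Dgh Dfgh)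
        (tensT t splitInr splitInr_smul τ) =
      tensT (t * gen .i1) splitInr splitInr_smul (A.ext E₁ τ) +
      tensT (t * gen .g) splitInl splitInl_smul (A.ext Dg τ) +
      tensT (t * (gen .g * gen .h)) splitInr splitInr_smul (A.ext Dgh τ) := by
  induction τ using A.ten_induction with
  | zero => simp only [map_zero, add_zero]
  | tm a y =>
    rw [tensT_tm, DGAlgebra.ext_tm, ofCoefficients_apply]
    have h1 : (splitInr y : Split X₀ X₁).1 = 0 := rfl
    have h2 : (splitInr y : Split X₀ X₁).2 = y := rfl
    simp only [h1, h2, map_zero, add_zero, zero_add, smul_add, ddTmul_smul_tensT,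
      DGAlgebra.ext_tm]
  | add s t hs ht => simp only [map_add, hs, ht]; abel

variable (E₀' : Y₀ →ₗ[A.base] A.Ten X₀) (E₁' : Y₁ →ₗ[A.base] A.Ten X₁)
    (Df' Dh' : Y₀ →ₗ[A.base] A.Ten X₁) (Dg' : Y₁ →ₗ[A.base] A.Ten X₀)
    (Dfg' : Y₀ →ₗ[A.base] A.Ten X₀) (Dgh' : Y₁ →ₗ[A.base] A.Ten X₁)
    (Dfgh' : Y₀ →ₗ[A.base] A.Ten X₁)

/-- The coefficient at a path `t` is a sum over the factorizations of `t` into two paths, with the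
earlier factor coming from the map applied first. All other products contain `gf` or `hg`, or have
mismatched ends. -/
theorem ext_comp_ofCoefficients :
    (DDAlgebra A).ext (ofCoefficients E₀ E₁ Df Dh Dg Dfg Dgh Dfgh) ∘ₗ
        ofCoefficients E₀' E₁' Df' Dh' Dg' Dfg' Dgh' Dfgh' =
      ofCoefficients (A.ext E₀ ∘ₗ E₀') (A.ext E₁ ∘ₗ E₁')
        (A.ext E₁ ∘ₗ Df' + A.ext Df ∘ₗ E₀') (A.ext E₁ ∘ₗ Dh' + A.ext Dh ∘ₗ E₀')
        (A.ext E₀ ∘ₗ Dg' + A.ext Dg ∘ₗ E₁')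
        (A.ext E₀ ∘ₗ Dfg' + A.ext Dg ∘ₗ Df' + A.ext Dfg ∘ₗ E₀')
        (A.ext E₁ ∘ₗ Dgh' + A.ext Dh ∘ₗ Dg' + A.ext Dgh ∘ₗ E₁')
        (A.ext E₁ ∘ₗ Dfgh' + A.ext Dgh ∘ₗ Df' + A.ext Dh ∘ₗ Dfg' + A.ext Dfgh ∘ₗ E₀') := by
  refine LinearMap.ext fun x => ?_
  rw [LinearMap.comp_apply, ofCoefficients_apply, ofCoefficients_apply]
  simp only [map_add, ext_ofCoefficients_inl, ext_ofCoefficients_inr, mul_assoc, i0_i0, i1_i1,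
    i0_f, i0_h, i1_g, f_i1, g_i0, h_i1, g_f, h_g, i0_f_mul, i1_g_mul, g_f_mul, h_g_mul, mul_zero,
    tensT_zero, add_zero, zero_add, LinearMap.add_apply, LinearMap.comp_apply]
  abel

theorem tenD_comp_ofCoefficients :
    (DDAlgebra A).tenD ∘ₗ ofCoefficients E₀ E₁ Df Dh Dg Dfg Dgh Dfgh =
      ofCoefficients (A.tenD ∘ₗ E₀) (A.tenD ∘ₗ E₁) (A.tenD ∘ₗ Df) (A.tenD ∘ₗ Dh) (A.tenD ∘ₗ Dg)
        (A.tenD ∘ₗ Dfg) (A.tenD ∘ₗ Dgh) (A.tenD ∘ₗ Dfgh) := by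
  refine LinearMap.ext fun x => ?_
  rw [LinearMap.comp_apply, ofCoefficients_apply, ofCoefficients_apply]
  simp only [map_add, tenD_tensT, LinearMap.comp_apply]

variable (E₀' : X₀ →ₗ[A.base] A.Ten Z₀) (E₁' : X₁ →ₗ[A.base] A.Ten Z₁)
    (Df' Dh' : X₀ →ₗ[A.base] A.Ten Z₁) (Dg' : X₁ →ₗ[A.base] A.Ten Z₀)
    (Dfg' : X₀ →ₗ[A.base] A.Ten Z₀) (Dgh' : X₁ →ₗ[A.base] A.Ten Z₁)
    (Dfgh' : X₀ →ₗ[A.base] A.Ten Z₁)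

theorem add_ofCoefficients :
    ofCoefficients E₀ E₁ Df Dh Dg Dfg Dgh Dfgh +
        ofCoefficients E₀' E₁' Df' Dh' Dg' Dfg' Dgh' Dfgh' =
      ofCoefficients (E₀ + E₀') (E₁ + E₁') (Df + Df') (Dh + Dh') (Dg + Dg') (Dfg + Dfg')
        (Dgh + Dgh') (Dfgh + Dfgh') := by
  refine LinearMap.ext fun x => ?_
  rw [LinearMap.add_apply, ofCoefficients_apply, ofCoefficients_apply, ofCoefficients_apply]
  simp only [LinearMap.add_apply, map_add]
  abel

end

theorem ofCoefficients_zero :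
    ofCoefficients (A := A) (X₀ := X₀) (X₁ := X₁) (Y₀ := Y₀) (Y₁ := Y₁) 0 0 0 0 0 0 0 0 = 0 := by
  refine LinearMap.ext fun x => ?_
  rw [ofCoefficients_apply]
  simp only [LinearMap.zero_apply, map_zero, add_zero]

variable (A) in
/-- The trivial path at `0`, as an idempotent of `A ⊗ 𝒯`; similarly below. -/
def basePath0 : (DDAlgebra A).base := (1 : A.base) ⊗ₜ[ZMod 2] ((1 : ZMod 2), (0 : ZMod 2))

variable (A) in
/-- The trivial path at `1`. -/
def basePath1 : (DDAlgebra A).base := (1 : A.base) ⊗ₜ[ZMod 2] ((0 : ZMod 2), (1 : ZMod 2))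

/-- A trivial path can be moved across the tensor product, where it acts as the projection to its
summand, and the two trivial paths add up to `1`. -/
theorem ofCoefficients_id :
    ofCoefficients (A.lin LinearMap.id) (A.lin LinearMap.id) 0 0 0 0 0 0 =
      (DDAlgebra A).lin (LinearMap.id (M := Split X₀ X₁)) := by
  refine LinearMap.ext fun x => ?_
  rw [ofCoefficients_apply]
  simp only [LinearMap.zero_apply, map_zero, add_zero]
  change (DDAlgebra A).tm (ddTmul 1 (gen .i0)) (splitInl x.1) +
    (DDAlgebra A).tm (ddTmul 1 (gen .i1)) (splitInr x.2) = (DDAlgebra A).tm 1 x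
  have h0 : (splitInl x.1 : Split X₀ X₁) = basePath0 A • x := by
    refine Prod.ext ?_ ?_
    · change x.1 = ((1 : A.base) * algebraMap (ZMod 2) A.base 1) • x.1
      rw [map_one, one_mul, one_smul]
    · change 0 = ((1 : A.base) * algebraMap (ZMod 2) A.base 0) • x.2
      rw [map_zero, mul_zero, zero_smul]
  have h1 : (splitInr x.2 : Split X₀ X₁) = basePath1 A • x := by
    refine Prod.ext ?_ ?_
    · change 0 = ((1 : A.base) * algebraMap (ZMod 2) A.base 0) • x.1
      rw [map_zero, mul_zero, zero_smul]
    · change x.2 = ((1 : A.base) * algebraMap (ZMod 2) A.base 1) • x.2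
      rw [map_one, one_mul, one_smul]
  rw [h0, h1, DGAlgebra.tm_smul, DGAlgebra.tm_smul, ← DGAlgebra.add_tm]
  congr 1
  have e0 : (DDAlgebra A).unit (basePath0 A) = ddTmul 1 (gen .i0) := by
    change A.unit 1 ⊗ₜ[ZMod 2] ((1 : ZMod 2) • gen .i0 + (0 : ZMod 2) • gen .i1) = _
    rw [map_one, one_smul, zero_smul, add_zero]; rfl
  have e1 : (DDAlgebra A).unit (basePath1 A) = ddTmul 1 (gen .i1) := by
    change A.unit 1 ⊗ₜ[ZMod 2] ((0 : ZMod 2) • gen .i0 + (1 : ZMod 2) • gen .i1) = _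
    rw [map_one, one_smul, zero_smul, zero_add]; rfl
  rw [e0, e1, ddTmul_mul, ddTmul_mul, i0_i0, i1_i1, mul_one]
  change (1 : A.carrier) ⊗ₜ[ZMod 2] gen .i0 + (1 : A.carrier) ⊗ₜ[ZMod 2] gen .i1 = _
  rw [← TensorProduct.tmul_add, i0_add_i1]; rfl

end DD

/-! ### Components of the differential of a map of cones -/

namespace PreD

variable {A : DGAlgebra.{u}} {M N M' N' : PreD A} {φ : Hom M N} {φ' : Hom M' N'}

section

variable (T : Hom (cone φ) (cone φ'))

/-- In the four formulas, the corrections arise because `coneInl` and `coneSnd` are not cycles. When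
`T` is a carriage return they are the terms that the factorizations of `fg`, `gh` and `fgh` into
shorter paths contribute to the structure equation of `Θ`. -/
theorem coneFst_diff_coneInl : comp (coneFst φ') (comp (diff T) (coneInl φ)) =
    diff (comp (coneFst φ') (comp T (coneInl φ))) +
      comp (coneFst φ') (comp T (comp (coneInr φ) φ)) := by
  simp only [diff_comp, diff_coneFst, diff_coneInl, zero_comp, zero_add, comp_add]
  rw [add_assoc, hom_add_self, add_zero]

theorem coneFst_diff_coneInr : comp (coneFst φ') (comp (diff T) (coneInr φ)) =
    diff (comp (coneFst φ') (comp T (coneInr φ))) := by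
  simp only [diff_comp, diff_coneFst, diff_coneInr, zero_comp, zero_add, comp_zero, add_zero]

theorem coneSnd_diff_coneInl : comp (coneSnd φ') (comp (diff T) (coneInl φ)) =
    diff (comp (coneSnd φ') (comp T (coneInl φ))) +
      comp φ' (comp (coneFst φ') (comp T (coneInl φ))) +
      comp (coneSnd φ') (comp T (comp (coneInr φ) φ)) := by
  simp only [diff_comp, diff_coneSnd, diff_coneInl, comp_add, comp_assoc]
  rw [hom_eq_iff]
  abel_nf
  simp only [two_zsmul, hom_add_self, add_zero]

theorem coneSnd_diff_coneInr : comp (coneSnd φ') (comp (diff T) (coneInr φ)) =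
    diff (comp (coneSnd φ') (comp T (coneInr φ))) +
      comp φ' (comp (coneFst φ') (comp T (coneInr φ))) := by
  simp only [diff_comp, diff_coneSnd, diff_coneInr, comp_add, comp_assoc, comp_zero, add_zero]
  rw [hom_eq_iff]
  abel_nf
  simp only [two_zsmul, hom_add_self, add_zero]

end

end PreD

/-! ### Compatibility of `Θ` with composition and differentials -/

namespace Typewriter

open PreD

variable {A : DGAlgebra.{u}} {M M' M'' : Typewriter A}

namespace Tuple

@[ext]
theorem ext' {T T' : Tuple M M'} (h₀ : T.T₀ = T'.T₀) (h₁ : T.T₁ = T'.T₁) (hf : T.Tf = T'.Tf)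
    (hh : T.Th = T'.Th) (hc : T.CR = T'.CR) : T = T' := by
  cases T; cases T'; cases h₀; cases h₁; cases hf; cases hh; cases hc; rfl

instance : Zero (Tuple M M') := ⟨⟨0, 0, 0, 0, 0⟩⟩

instance : Add (Tuple M M') :=
  ⟨fun T T' => ⟨T.T₀ + T'.T₀, T.T₁ + T'.T₁, T.Tf + T'.Tf, T.Th + T'.Th, T.CR + T'.CR⟩⟩

/-- The differential of the space of tuples. -/
def d (T : Tuple M M') : Tuple M M' where
  T₀ := diff T.T₀
  T₁ := diff T.T₁
  Tf := diff T.Tf + PreD.comp T.T₁ M.Df + PreD.comp M'.Df T.T₀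
  Th := diff T.Th + PreD.comp T.T₁ M.Dh + PreD.comp M'.Dh T.T₀
  CR := diff T.CR + PreD.comp T.coneH M.CR + PreD.comp M'.CR T.coneF

theorem IsMor.d_eq_zero {T : Tuple M M'} (hT : T.IsMor) : T.d = 0 := by
  have hf := hT.f
  have hh := hT.h
  have hc := hT.cr
  unfold PreD.IsHomotopy at hf hh hc
  refine Tuple.ext' hT.mor₀ hT.mor₁ ?_ ?_ ?_
  · change diff _ + _ + _ = 0
    rw [← hf, add_assoc, hom_add_self]
  · change diff _ + _ + _ = 0
    rw [← hh, add_assoc, hom_add_self]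
  · change diff _ + _ + _ = 0
    rw [← hc, add_assoc, hom_add_self]

/-- The conditions on induced maps of cones are compared entry by entry; the off-diagonal entries
are the last three components of `Tuple.d`. -/
theorem IsHomotopy.add_eq_d {H T T' : Tuple M M'} (h : IsHomotopy H T T') : T + T' = H.d := by
  refine Tuple.ext' h.h₀ h.h₁ ?_ ?_ ?_
  · have h' := h.f
    unfold PreD.IsHomotopy coneF at h'
    rw [add_coneMap, diff_coneMap] at h'
    exact (coneMap_inj h').2.2
  · have h' := h.h
    unfold PreD.IsHomotopy coneH at h'
    rw [add_coneMap, diff_coneMap] at h'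
    exact (coneMap_inj h').2.2
  · have h' := h.cr
    unfold PreD.IsHomotopy coneCR at h'
    rw [add_coneMap, diff_coneMap] at h'
    exact (coneMap_inj h').2.2

end Tuple

section ddHom

/-- The map of `DD` bimodules with given coefficient maps. -/
def ddHom (M M' : Typewriter A) (E₀ : Hom M.M₀ M'.M₀) (E₁ : Hom M.M₁ M'.M₁)
    (Df Dh : Hom M.M₀ M'.M₁) (Dg : Hom M.M₁ M'.M₀) (Dfg : Hom M.M₀ M'.M₀)
    (Dgh : Hom M.M₁ M'.M₁) (Dfgh : Hom M.M₀ M'.M₁) : Hom M.dd M'.dd :=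
  ofCoefficients E₀ E₁ Df Dh Dg Dfg Dgh Dfgh

theorem comp_ddHom (E₀ : Hom M'.M₀ M''.M₀) (E₁ : Hom M'.M₁ M''.M₁)
    (Df Dh : Hom M'.M₀ M''.M₁) (Dg : Hom M'.M₁ M''.M₀) (Dfg : Hom M'.M₀ M''.M₀)
    (Dgh : Hom M'.M₁ M''.M₁) (Dfgh : Hom M'.M₀ M''.M₁) (E₀' : Hom M.M₀ M'.M₀)
    (E₁' : Hom M.M₁ M'.M₁) (Df' Dh' : Hom M.M₀ M'.M₁) (Dg' : Hom M.M₁ M'.M₀)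
    (Dfg' : Hom M.M₀ M'.M₀) (Dgh' : Hom M.M₁ M'.M₁) (Dfgh' : Hom M.M₀ M'.M₁) :
    comp (ddHom M' M'' E₀ E₁ Df Dh Dg Dfg Dgh Dfgh)
        (ddHom M M' E₀' E₁' Df' Dh' Dg' Dfg' Dgh' Dfgh') =
      ddHom M M'' (comp E₀ E₀') (comp E₁ E₁') (comp E₁ Df' + comp Df E₀')
        (comp E₁ Dh' + comp Dh E₀') (comp E₀ Dg' + comp Dg E₁')
        (comp E₀ Dfg' + comp Dg Df' + comp Dfg E₀')
        (comp E₁ Dgh' + comp Dh Dg' + comp Dgh E₁')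
        (comp E₁ Dfgh' + comp Dgh Df' + comp Dh Dfg' + comp Dfgh E₀') :=
  ext_comp_ofCoefficients ..

theorem tenD_comp_ddHom (E₀ : Hom M.M₀ M'.M₀) (E₁ : Hom M.M₁ M'.M₁)
    (Df Dh : Hom M.M₀ M'.M₁) (Dg : Hom M.M₁ M'.M₀) (Dfg : Hom M.M₀ M'.M₀)
    (Dgh : Hom M.M₁ M'.M₁) (Dfgh : Hom M.M₀ M'.M₁) :
    (DDAlgebra A).tenD ∘ₗ ddHom M M' E₀ E₁ Df Dh Dg Dfg Dgh Dfgh =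
      ddHom M M' (A.tenD ∘ₗ E₀) (A.tenD ∘ₗ E₁) (A.tenD ∘ₗ Df) (A.tenD ∘ₗ Dh) (A.tenD ∘ₗ Dg)
        (A.tenD ∘ₗ Dfg) (A.tenD ∘ₗ Dgh) (A.tenD ∘ₗ Dfgh) :=
  tenD_comp_ofCoefficients ..

theorem add_ddHom (E₀ E₀' : Hom M.M₀ M'.M₀) (E₁ E₁' : Hom M.M₁ M'.M₁)
    (Df Dh Df' Dh' : Hom M.M₀ M'.M₁) (Dg Dg' : Hom M.M₁ M'.M₀) (Dfg Dfg' : Hom M.M₀ M'.M₀)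
    (Dgh Dgh' : Hom M.M₁ M'.M₁) (Dfgh Dfgh' : Hom M.M₀ M'.M₁) :
    ddHom M M' E₀ E₁ Df Dh Dg Dfg Dgh Dfgh + ddHom M M' E₀' E₁' Df' Dh' Dg' Dfg' Dgh' Dfgh' =
      ddHom M M' (E₀ + E₀') (E₁ + E₁') (Df + Df') (Dh + Dh') (Dg + Dg') (Dfg + Dfg')
        (Dgh + Dgh') (Dfgh + Dfgh') :=
  add_ofCoefficients ..

theorem ddHom_zero : ddHom M M' 0 0 0 0 0 0 0 0 = 0 := ofCoefficients_zero

theorem ddHom_id : ddHom M M (idHom M.M₀) (idHom M.M₁) 0 0 0 0 0 0 = idHom M.dd :=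
  ofCoefficients_id

theorem dd_δ_eq (M : Typewriter A) : M.dd.δ =
    ddHom M M M.M₀.δ M.M₁.δ M.Df M.Dh
      (comp (coneFst M.Dh) (comp M.CR (coneInr M.Df)))
      (comp (coneFst M.Dh) (comp M.CR (coneInl M.Df)))
      (comp (coneSnd M.Dh) (comp M.CR (coneInr M.Df)))
      (comp (coneSnd M.Dh) (comp M.CR (coneInl M.Df))) := by
  rw [← component_inl_fst, ← component_inr_fst, ← component_inl_snd, ← component_inr_snd]; rfl

theorem Tuple.dd_eq (T : Tuple M M') : T.dd =
    ddHom M M' T.T₀ T.T₁ T.Tf T.Th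
      (PreD.comp (coneFst M'.Dh) (PreD.comp T.CR (coneInr M.Df)))
      (PreD.comp (coneFst M'.Dh) (PreD.comp T.CR (coneInl M.Df)))
      (PreD.comp (coneSnd M'.Dh) (PreD.comp T.CR (coneInr M.Df)))
      (PreD.comp (coneSnd M'.Dh) (PreD.comp T.CR (coneInl M.Df))) := by
  rw [← component_inl_fst, ← component_inr_fst, ← component_inl_snd, ← component_inr_snd]; rfl

end ddHom

namespace Tuple

theorem dd_zero : (0 : Tuple M M').dd = 0 := by
  have h : ((0 : Tuple M M').CR) = 0 := rfl
  rw [dd_eq, h]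
  simp only [PreD.zero_comp, PreD.comp_zero]
  exact ddHom_zero

theorem dd_add (T T' : Tuple M M') : (T + T').dd = T.dd + T'.dd := by
  have h : (T + T').CR = T.CR + T'.CR := rfl
  rw [dd_eq, dd_eq, dd_eq, h, add_ddHom]
  simp only [PreD.comp_add, PreD.add_comp]
  rfl

theorem dd_id : (Tuple.id M).dd = idHom M.dd := by
  have h : (Tuple.id M).CR = 0 := rfl
  rw [dd_eq, h]
  simp only [PreD.zero_comp, PreD.comp_zero]
  exact ddHom_id

/-- The entries of `T'.coneH` and `T.coneF` in the carriage return of the composite supply exactly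
the factorizations of the paths through `g`: those beginning with `f` use `T.Tf`, those ending with
`h` use `T'.Th`. -/
theorem dd_comp (T' : Tuple M' M'') (T : Tuple M M') :
    (Tuple.comp T' T).dd = PreD.comp T'.dd T.dd := by
  have h : (Tuple.comp T' T).CR = PreD.comp T'.coneH T.CR + PreD.comp T'.CR T.coneF := rfl
  rw [dd_eq, dd_eq, dd_eq, h, comp_ddHom]
  unfold coneH coneF
  simp only [coneMap_eq, PreD.comp_add, PreD.add_comp, PreD.comp_assoc, coneFst_coneInl_comp,
    coneFst_coneInr_comp, coneSnd_coneInl_comp, coneSnd_coneInr_comp, coneFst_coneInl,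
    coneSnd_coneInr, coneFst_coneInr, coneSnd_coneInl, PreD.comp_zero, PreD.zero_comp, add_zero,
    zero_add, PreD.comp_id]
  congr 1
  all_goals abel

/-- The structure map of `Θ(M)` has the same coefficient form as the image of a tuple, so the three
terms of the differential are given by the formulas for composition and for `tenD`. -/
theorem diff_dd (T : Tuple M M') : diff T.dd = T.d.dd := by
  have h : T.d.CR = diff T.CR + PreD.comp T.coneH M.CR + PreD.comp M'.CR T.coneF := rfl
  have h' : diff T.dd = PreD.comp M'.dd.δ T.dd + PreD.comp T.dd M.dd.δ +
    (DDAlgebra A).tenD ∘ₗ T.dd := rfl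
  rw [h', dd_eq, dd_eq, h, dd_δ_eq, dd_δ_eq, comp_ddHom, comp_ddHom, tenD_comp_ddHom, add_ddHom,
    add_ddHom]
  unfold coneH coneF
  simp only [coneMap_eq, PreD.comp_add, PreD.add_comp, PreD.comp_assoc, coneFst_coneInl_comp,
    coneFst_coneInr_comp, coneSnd_coneInl_comp, coneSnd_coneInr_comp, coneFst_coneInl,
    coneSnd_coneInr, coneFst_coneInr, coneSnd_coneInl, PreD.comp_zero, PreD.zero_comp, add_zero,
    zero_add, PreD.comp_id, coneFst_diff_coneInl, coneFst_diff_coneInr, coneSnd_diff_coneInl,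
    coneSnd_diff_coneInr]
  unfold d PreD.diff
  simp only [PreD.comp_assoc]
  congr 1
  all_goals abel

theorem IsMor.isMor_dd {T : Tuple M M'} (hT : T.IsMor) : PreD.IsMor T.dd := by
  rw [PreD.IsMor, diff_dd, hT.d_eq_zero, dd_zero]

theorem IsHomotopy.dd {H T T' : Tuple M M'} (h : IsHomotopy H T T') :
    PreD.IsHomotopy H.dd T.dd T'.dd := by
  rw [PreD.IsHomotopy, diff_dd, ← h.add_eq_d, dd_add]

theorem Homotopic.dd {T T' : Tuple M M'} (h : Homotopic T T') : PreD.Homotopic T.dd T'.dd :=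
  h.elim fun H hH => ⟨H.dd, hH.dd⟩

theorem IsHInverse.dd {T : Tuple M M'} {S : Tuple M' M} (h : IsHInverse T S) :
    PreD.IsHInverse T.dd S.dd := by
  refine ⟨h.1.isMor_dd, ?_, ?_⟩
  · rw [← dd_comp, ← dd_id]; exact h.2.1.dd
  · rw [← dd_comp, ← dd_id]; exact h.2.2.dd

end Tuple

/-- The eight coefficients of the structure equation are the structure equations of `M₀` and `M₁`,
the cycle equations of `D_f` and `D_h`, and the four components of that of `D_CR`. -/
theorem IsValid.isTypeD_dd (hM : M.IsValid) : M.dd.IsTypeD := by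
  have h₀ := hM.obj₀
  have h₁ := hM.obj₁
  have hf : diff M.Df = 0 := hM.f
  have hh : diff M.Dh = 0 := hM.h
  have hc : diff M.CR = 0 := hM.cr
  have e1 := coneFst_diff_coneInl M.CR
  have e2 := coneFst_diff_coneInr M.CR
  have e3 := coneSnd_diff_coneInl M.CR
  have e4 := coneSnd_diff_coneInr M.CR
  rw [isTypeD_iff] at *
  rw [hc, PreD.zero_comp, PreD.comp_zero] at e1 e2 e3 e4
  rw [dd_δ_eq, comp_ddHom, tenD_comp_ddHom, add_ddHom, ← ddHom_zero]
  simp only [PreD.comp_assoc] at *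
  congr 1
  · refine Eq.trans ?_ e2.symm; unfold diff; simp only [PreD.comp_assoc]
  · refine Eq.trans ?_ e1.symm; unfold diff; simp only [PreD.comp_assoc]; abel
  · refine Eq.trans ?_ e4.symm; unfold diff; simp only [PreD.comp_assoc]; abel
  · refine Eq.trans ?_ e3.symm; unfold diff; simp only [PreD.comp_assoc]; abel

end Typewriter

/-! ### Boundedness -/

namespace DGAlgebra

variable (A : DGAlgebra.{u}) {X Y : Type u} [AddCommGroup X] [Module A.base X]
  [AddCommGroup Y] [Module A.base Y]

/-- All modules over the ring of idempotents are flat. -/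
theorem flat_of_idem {R : Type u} [CommRing R] (hR : ∀ c : R, c * c = c) (M : Type u)
    [AddCommGroup M] [Module R M] : Module.Flat R M := by
  rw [Module.Flat.iff_lTensor_injective]
  intro I hI
  -- A finitely generated idempotent ideal is generated by an idempotent `e`. Multiplication by `e`
  -- retracts the ring onto it, so the inclusion splits and stays injective after tensoring.
  have h2 : IsIdempotentElem I := by
    refine le_antisymm Ideal.mul_le_left fun x hx => ?_
    rw [← hR x]; exact Ideal.mul_mem_mul hx hx
  obtain ⟨e, he, rfl⟩ := (Ideal.isIdempotentElem_iff_of_fg I hI).1 h2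
  let r : R →ₗ[R] Ideal.span {e} :=
    { toFun := fun x => ⟨x * e, Ideal.mul_mem_left _ _ (Ideal.subset_span rfl)⟩
      map_add' := fun x y => Subtype.ext (add_mul x y e)
      map_smul' := fun c x => Subtype.ext (mul_assoc c x e) }
  have hr : r ∘ₗ (Ideal.span {e}).subtype = LinearMap.id := by
    ext ⟨x, hx⟩
    obtain ⟨y, rfl⟩ := Ideal.mem_span_singleton'.1 hx
    change y * e * e = y * e
    rw [mul_assoc, hR]
  refine Function.LeftInverse.injective (g := r.lTensor M) fun t => ?_
  rw [← LinearMap.comp_apply, ← LinearMap.lTensor_comp]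
  exact (congrArg (fun f => LinearMap.lTensor M f t) hr).trans (LinearMap.lTensor_id_apply M _ t)

/-- The sums of elements `a ⊗ x` such that `P x`. -/
def tenSpan (P : X → Prop) : AddSubgroup (A.Ten X) :=
  AddSubgroup.closure {t | ∃ a x, P x ∧ A.tm a x = t}

variable {A}

theorem tm_mem_tenSpan {P : X → Prop} (a : A.carrier) {x : X} (hx : P x) :
    A.tm a x ∈ A.tenSpan P := AddSubgroup.subset_closure ⟨a, x, hx, rfl⟩

theorem tenSpan_induction {P : X → Prop} {Q : A.Ten X → Prop} {t : A.Ten X}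
    (ht : t ∈ A.tenSpan P) (zero : Q 0) (tm : ∀ a x, P x → Q (A.tm a x))
    (add : ∀ s t, Q s → Q t → Q (s + t)) : Q t := by
  refine AddSubgroup.closure_induction (p := fun t _ => Q t) ?_ zero
    (fun s t _ _ hs ht => add s t hs ht) (fun s _ hs => ?_) ht
  · rintro _ ⟨a, x, hx, rfl⟩; exact tm a x hx
  · rwa [neg_eq_of_add_eq_zero_left (A.ten_add_self s)]

/-- By flatness the kernel of `id ⊗ f` is the image of `A ⊗ ker f`. This converts vanishing of an
iterate on a tensor into vanishing on its factors. -/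
theorem mem_tenSpan_of_tenMap_eq_zero (f : X →ₗ[A.base] Y) (t : A.Ten X)
    (h : A.tenMap f t = 0) : t ∈ A.tenSpan fun x => f x = 0 := by
  have := flat_of_idem A.base_idem A.Bimod
  have hex := Module.Flat.lTensor_exact A.Bimod (LinearMap.exact_subtype_ker_map f)
  obtain ⟨s, rfl⟩ := (hex t).1 h
  induction s using TensorProduct.induction_on with
  | zero => rw [map_zero]; exact zero_mem _
  | tmul a x => exact tm_mem_tenSpan (P := fun x => f x = 0) a x.2
  | add s t hs ht =>
    rw [map_add]
    have hz : ∀ s, A.tenMap f ((LinearMap.lTensor A.Bimod (LinearMap.ker f).subtype) s) = 0 :=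
      fun s => (hex _).2 ⟨s, rfl⟩
    exact add_mem (hs (hz s)) (ht (hz t))

theorem mem_tenSpan_of_forall {P : X → Prop} (h : ∀ x, P x) (t : A.Ten X) : t ∈ A.tenSpan P := by
  induction t using A.ten_induction with
  | zero => exact zero_mem _
  | tm a x => exact tm_mem_tenSpan a (h x)
  | add s t hs ht => exact add_mem hs ht

end DGAlgebra

namespace PreD

open DGAlgebra

variable {A : DGAlgebra.{u}} {M N : PreD A}

/-- The iterates of the structure map eventually vanish at `x`. -/
def IsNil (M : PreD A) (x : M.X) : Prop := ∃ n, ∀ i, n < i → iter M i x = 0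

theorem IsNil.add {x y : M.X} (hx : M.IsNil x) (hy : M.IsNil y) : M.IsNil (x + y) := by
  obtain ⟨m, hm⟩ := hx
  obtain ⟨n, hn⟩ := hy
  refine ⟨max m n, fun i hi => ?_⟩
  rw [map_add, hm i (lt_of_le_of_lt (le_max_left _ _) hi),
    hn i (lt_of_le_of_lt (le_max_right _ _) hi), add_zero]

/-- An element of the span is a finite sum of tensors, so the bounds of its terms have a maximum;
applying `δ` once more raises it by one. -/
theorem isNil_of_δ {x : M.X} (h : M.δ x ∈ A.tenSpan M.IsNil) : M.IsNil x := by
  have key : ∃ n, ∀ i, n < i → A.tenMap (iter M i) (M.δ x) = 0 := by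
    refine tenSpan_induction (Q := fun t => ∃ n, ∀ i, n < i → A.tenMap (iter M i) t = 0) h
      ⟨0, fun i _ => map_zero _⟩ ?_ ?_
    · rintro a y ⟨n, hn⟩
      refine ⟨n, fun i hi => ?_⟩
      rw [tenMap_tm, hn i hi]
      exact TensorProduct.tmul_zero _ _
    · rintro s t ⟨m, hm⟩ ⟨n, hn⟩
      refine ⟨max m n, fun i hi => ?_⟩
      rw [map_add, hm i (lt_of_le_of_lt (le_max_left _ _) hi),
        hn i (lt_of_le_of_lt (le_max_right _ _) hi), add_zero]
  obtain ⟨n, hn⟩ := key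
  refine ⟨n + 1, fun i hi => ?_⟩
  obtain ⟨j, rfl⟩ := Nat.exists_eq_succ_of_ne_zero (by omega : i ≠ 0)
  exact hn j (by omega)

/-- Induction on the number of iterates that kill `x`: if `δⁿ⁺¹ x = 0`, then `δ x` is a sum of terms
`a ⊗ y` with `δⁿ y = 0`. -/
theorem IsBounded.induction (hM : M.IsBounded) {P : M.X → Prop}
    (h : ∀ x, M.δ x ∈ A.tenSpan P → P x) (x : M.X) : P x := by
  have key : ∀ n x, iter M n x = 0 → P x := by
    intro n
    induction n with
    | zero =>
      intro x hx
      have hx' : x = 0 := hx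
      refine h x ?_
      rw [hx', map_zero]; exact zero_mem _
    | succ n ih =>
      intro x hx
      refine h x ?_
      refine tenSpan_induction (mem_tenSpan_of_tenMap_eq_zero (iter M n) (M.δ x) hx) (zero_mem _)
        (fun a y hy => tm_mem_tenSpan a (ih y hy)) (fun _ _ => add_mem)
  obtain ⟨n, hn⟩ := hM x
  exact key (n + 1) x (hn _ (Nat.lt_succ_self n))

/-- Triangularity: the summand `N` is handled alone, and then every term of `φ x` is already known
to be nilpotent when the induction runs over `M`. -/
theorem IsBounded.cone {φ : Hom M N} (hM : M.IsBounded) (hN : N.IsBounded) :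
    (cone φ).IsBounded := by
  have h1 : ∀ y : N.X, (PreD.cone φ).IsNil ((0, y) : M.X × N.X) := by
    refine hN.induction fun y hy => isNil_of_δ ?_
    have e : (PreD.cone φ).δ ((0, y) : M.X × N.X) = A.tenMap (LinearMap.inr A.base M.X N.X) (N.δ y) := by
      change A.tenMap (LinearMap.inl A.base M.X N.X) (M.δ 0) +
        A.tenMap (LinearMap.inr A.base M.X N.X) (N.δ y + φ 0) = _
      rw [map_zero, map_zero, map_zero, zero_add, add_zero]
    rw [e]
    refine tenSpan_induction (Q := fun t => A.tenMap (LinearMap.inr A.base M.X N.X) t ∈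
      A.tenSpan (PreD.cone φ).IsNil) hy ?_ (fun a y hy => tm_mem_tenSpan a hy) fun s t hs ht => ?_
    · rw [map_zero]; exact zero_mem _
    · rw [map_add]; exact add_mem hs ht
  have h0 : ∀ x : M.X, (PreD.cone φ).IsNil ((x, 0) : M.X × N.X) := by
    refine hM.induction fun x hx => isNil_of_δ ?_
    have e : (PreD.cone φ).δ ((x, 0) : M.X × N.X) =
        A.tenMap (LinearMap.inl A.base M.X N.X) (M.δ x) +
          A.tenMap (LinearMap.inr A.base M.X N.X) (φ x) := by
      change A.tenMap (LinearMap.inl A.base M.X N.X) (M.δ x) +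
        A.tenMap (LinearMap.inr A.base M.X N.X) (N.δ 0 + φ x) = _
      rw [map_zero, zero_add]
    rw [e]
    refine add_mem ?_ ?_
    · refine tenSpan_induction (Q := fun t => A.tenMap (LinearMap.inl A.base M.X N.X) t ∈
        A.tenSpan (PreD.cone φ).IsNil) hx ?_ (fun a y hy => tm_mem_tenSpan a hy)
        fun s t hs ht => ?_
      · rw [map_zero]; exact zero_mem _
      · rw [map_add]; exact add_mem hs ht
    · refine tenSpan_induction (Q := fun t => A.tenMap (LinearMap.inr A.base M.X N.X) t ∈
        A.tenSpan (PreD.cone φ).IsNil) (mem_tenSpan_of_forall (P := fun _ => True)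
        (fun _ => trivial) (φ x)) ?_ (fun a y _ => tm_mem_tenSpan a (h1 y)) fun s t hs ht => ?_
      · rw [map_zero]; exact zero_mem _
      · rw [map_add]; exact add_mem hs ht
  rintro ⟨x, y⟩
  have h := (h0 x).add (h1 y)
  have e : ((x, 0) : M.X × N.X) + (0, y) = (x, y) := Prod.ext (add_zero x) (zero_add y)
  exact e ▸ h

/-- The objects of `ᴬMod` are closed under homotopy equivalence of type `D` structures. -/
theorem IsObj.of_isHEquiv (hM : M.IsTypeD) (hN : N.IsObj) {φ : Hom M N} (hφ : IsHEquiv φ) :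
    M.IsObj := by
  obtain ⟨_, P, hP, hb, ψ, hψ⟩ := hN
  exact ⟨hM, P, hP, hb, PreD.comp ψ φ, hψ.comp hφ⟩

/-- Homotopy equivalences of the source and target of a morphism extend to one of its cone. -/
theorem exists_isHomotopy_square {M' N' : PreD A} {φ : Hom M N} (hφ : IsMor φ) {α : Hom M M'}
    {α' : Hom M' M} (hα : IsHInverse α α') {β : Hom N N'} (hβ : IsMor β) :
    ∃ c, IsHomotopy c (PreD.comp β φ) (PreD.comp (PreD.comp β (PreD.comp φ α')) α) := by
  obtain ⟨_, ⟨H, hH⟩, _⟩ := hα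
  have hH' : diff H = PreD.comp α' α + idHom M := hH.symm
  refine ⟨PreD.comp β (PreD.comp φ H), ?_⟩
  have hφ' : diff φ = 0 := hφ
  have hβ' : diff β = 0 := hβ
  rw [IsHomotopy, diff_comp, diff_comp, hφ', hβ', hH', zero_comp, zero_comp, zero_add, zero_add,
    comp_add, comp_add, comp_id, add_comm, comp_assoc, comp_assoc]

/-- The morphism is transported to `β φ α'` between bounded models. Coherent inverses of `α` and `β`
then extend to the cones, and the cone of the models is bounded. -/
theorem IsObj.cone (hM : M.IsObj) (hN : N.IsObj) {φ : Hom M N} (hφ : IsMor φ) :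
    (cone φ).IsObj := by
  obtain ⟨hMD, P, hP, hPb, α, hα⟩ := hM
  obtain ⟨hND, Q, hQ, hQb, β, hβ⟩ := hN
  have ⟨hαm, α', hα'⟩ := hα
  obtain ⟨c, hc⟩ := exists_isHomotopy_square hφ hα' hβ.1
  have hψ : IsMor (PreD.comp β (PreD.comp φ α')) := hβ.1.comp (hφ.comp hα'.1)
  obtain ⟨_, _, _, _, h₀⟩ := hα.exists_isCohInverse
  obtain ⟨_, _, _, _, h₁⟩ := hβ.exists_isCohInverse
  obtain ⟨_, _, _, _, h⟩ := h₀.exists_coneMap h₁ hφ hψ hc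
  exact ⟨hMD.cone hND hφ, PreD.cone (PreD.comp β (PreD.comp φ α')), hP.cone hQ hψ,
    hPb.cone hQb, _, isMor_coneMap hαm hβ.1 hc, _, h.isHInverse⟩

end PreD

/-! ### Typewriters without carriage return -/

namespace Typewriter

open PreD DGAlgebra

variable {A : DGAlgebra.{u}}

/-- Without `D_CR` nothing leads from `M₁` back to `M₀`, so the argument for cones applies with the
two maps `D_f` and `D_h` in place of one. -/
theorem isBounded_dd {M : Typewriter A} (h₀ : M.M₀.IsBounded) (h₁ : M.M₁.IsBounded)
    (hCR : M.CR = 0) : M.dd.IsBounded := by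
  have hδ : M.dd.δ = ddHom M M M.M₀.δ M.M₁.δ M.Df M.Dh 0 0 0 0 := by
    rw [dd_δ_eq, hCR]; simp only [PreD.zero_comp, PreD.comp_zero]
  have hn1 : ∀ y : M.M₁.X, M.dd.IsNil (splitInr y : Split M.M₀.X M.M₁.X) := by
    refine h₁.induction fun y hy => isNil_of_δ ?_
    have e : M.dd.δ (splitInr y : Split M.M₀.X M.M₁.X) =
        tensT (Torus.gen .i1) splitInr splitInr_smul (M.M₁.δ y) := by
      rw [hδ]
      refine (ofCoefficients_apply ..).trans ?_
      have h1 : (splitInr y : Split M.M₀.X M.M₁.X).1 = 0 := rfl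
      have h2 : (splitInr y : Split M.M₀.X M.M₁.X).2 = y := rfl
      simp only [h1, h2, map_zero, LinearMap.zero_apply, add_zero, zero_add]
    rw [e]
    refine tenSpan_induction (Q := fun t => tensT (Torus.gen .i1) splitInr splitInr_smul t ∈
      (DDAlgebra A).tenSpan M.dd.IsNil) hy ?_ (fun a y hy => tm_mem_tenSpan _ hy)
      fun s t hs ht => ?_
    · rw [map_zero]; exact zero_mem _
    · rw [map_add]; exact add_mem hs ht
  have hn1' : ∀ (t : Torus.T) (τ : A.Ten M.M₁.X), tensT t splitInr splitInr_smul τ ∈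
      (DDAlgebra A).tenSpan M.dd.IsNil := by
    intro t τ
    induction τ using A.ten_induction with
    | zero => rw [map_zero]; exact zero_mem _
    | tm a y => exact tm_mem_tenSpan _ (hn1 y)
    | add s t hs ht => rw [map_add]; exact add_mem hs ht
  have hn0 : ∀ x : M.M₀.X, M.dd.IsNil (splitInl x : Split M.M₀.X M.M₁.X) := by
    refine h₀.induction fun x hx => isNil_of_δ ?_
    have e : M.dd.δ (splitInl x : Split M.M₀.X M.M₁.X) =
        tensT (Torus.gen .i0) splitInl splitInl_smul (M.M₀.δ x) +
          tensT (Torus.gen .f) splitInr splitInr_smul (M.Df x) +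
          tensT (Torus.gen .h) splitInr splitInr_smul (M.Dh x) := by
      rw [hδ]
      refine (ofCoefficients_apply ..).trans ?_
      have h1 : (splitInl x : Split M.M₀.X M.M₁.X).1 = x := rfl
      have h2 : (splitInl x : Split M.M₀.X M.M₁.X).2 = 0 := rfl
      simp only [h1, h2, map_zero, LinearMap.zero_apply, add_zero, zero_add]
      rfl
    rw [e]
    refine add_mem (add_mem ?_ (hn1' _ _)) (hn1' _ _)
    refine tenSpan_induction (Q := fun t => tensT (Torus.gen .i0) splitInl splitInl_smul t ∈
      (DDAlgebra A).tenSpan M.dd.IsNil) hx ?_ (fun a y hy => tm_mem_tenSpan _ hy)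
      fun s t hs ht => ?_
    · rw [map_zero]; exact zero_mem _
    · rw [map_add]; exact add_mem hs ht
  rintro ⟨x, y⟩
  have h := (hn0 x).add (hn1 y)
  have e : (splitInl x : Split M.M₀.X M.M₁.X) + splitInr y = (x, y) :=
    Prod.ext (add_zero x) (zero_add y)
  exact e ▸ h

theorem isObj_dd_of_CR_eq_zero {M : Typewriter A} (h₀ : M.M₀.IsObj) (h₁ : M.M₁.IsObj)
    (hf : IsMor M.Df) (hh : IsMor M.Dh) (hCR : M.CR = 0) : M.dd.IsObj := by
  have hM : M.IsValid := ⟨h₀.1, h₁.1, hf, hh, by rw [hCR]; exact diff_zero⟩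
  obtain ⟨_, P, hP, hPb, α, hα⟩ := h₀
  obtain ⟨_, Q, hQ, hQb, β, hβ⟩ := h₁
  have ⟨hαm, α', hα'⟩ := hα
  obtain ⟨cf, hcf⟩ := exists_isHomotopy_square hf hα' hβ.1
  obtain ⟨ch, hch⟩ := exists_isHomotopy_square hh hα' hβ.1
  let M' : Typewriter A := ⟨P, Q, PreD.comp β (PreD.comp M.Df α'),
    PreD.comp β (PreD.comp M.Dh α'), 0⟩
  have hM' : M'.IsValid := ⟨hP, hQ, hβ.1.comp (hf.comp hα'.1), hβ.1.comp (hh.comp hα'.1),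
    diff_zero⟩
  let T : Tuple M M' := ⟨α, β, cf, ch, 0⟩
  have hT : T.IsMor := by
    refine ⟨hαm, hβ.1, hcf, hch, ?_⟩
    rw [hCR]
    change PreD.IsHomotopy 0 _ (PreD.comp 0 _)
    rw [PreD.comp_zero, PreD.zero_comp, PreD.IsHomotopy, diff_zero, add_zero]
  obtain ⟨S, hS⟩ := hT.exists_isHInverse hM hM' hα hβ
  exact ⟨hM.isTypeD_dd, M'.dd, hM'.isTypeD_dd, isBounded_dd hPb hQb rfl, T.dd,
    hT.isMor_dd, S.dd, hS.dd⟩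

end Typewriter

/-! ### The `DD` bimodule of a typewriter is homotopy equivalent to a bounded one -/

namespace PreD

variable {A : DGAlgebra.{u}}

/-- If the structure map of `X` differs from that of `Y` by `ρ π`, where `π : Y → C` and `ρ : C → Y`
are morphisms with `π ρ = dθ`, `ρ θ = 0` and `θ² = 0`, then `X` is an iterated cone of `C`, `Y` and
`C` up to homotopy. -/
theorem IsObj.of_factorization {X Y C : PreD A} (hX : X.IsTypeD) (hY : Y.IsObj) (hC : C.IsObj)
    {j : Hom X Y} {j' : Hom Y X} {p : Hom Y C} {r : Hom C Y} {θ : Hom C C}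
    (hjj' : comp j j' = idHom Y) (hj'j : comp j' j = idHom X) (hp : IsMor p) (hr : IsMor r)
    (hj : diff j = comp r (comp p j)) (hθ : diff θ = comp p r) (hrθ : comp r θ = 0)
    (hθθ : comp θ θ = 0) : X.IsObj := by
  unfold IsMor at hp hr
  have hj' : diff j' = comp j' (comp r p) := by
    have h := diff_comp j j'
    rw [hjj', diff_id, hj, comp_assoc, comp_assoc, hjj', comp_id] at h
    have h2 := congrArg (comp j') h
    rw [comp_zero, comp_add, ← comp_assoc j' j, hj'j, id_comp, eq_comm, ← hom_eq_iff] at h2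
    exact h2.symm
  -- Differentiating `θ θ = 0` and `r θ = 0` gives `θ p r = 0` and `r p r = 0`, since the remaining
  -- terms contain `r θ` or `dr`.
  have e1 : comp θ (comp p r) = 0 := by
    have h := diff_comp θ θ
    rw [hθθ, diff_zero, hθ, comp_assoc, hrθ, comp_zero, zero_add] at h
    exact h.symm
  have e2 : comp r (comp p r) = 0 := by
    have h := diff_comp r θ
    rw [hrθ, diff_zero, hr, hθ, zero_comp, zero_add] at h
    exact h.symm
  have e1' : ∀ {L : PreD A} (χ : Hom L C), comp θ (comp p (comp r χ)) = 0 := fun χ => by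
    rw [← comp_assoc p, ← comp_assoc, e1, zero_comp]
  have e2' : ∀ {L : PreD A} (χ : Hom L C), comp r (comp p (comp r χ)) = 0 := fun χ => by
    rw [← comp_assoc p, ← comp_assoc, e2, zero_comp]
  have hrθ' : ∀ {L : PreD A} (χ : Hom L C), comp r (comp θ χ) = 0 := fun χ => by
    rw [← comp_assoc, hrθ, zero_comp]
  have hθθ' : ∀ {L : PreD A} (χ : Hom L C), comp θ (comp θ χ) = 0 := fun χ => by
    rw [← comp_assoc, hθθ, zero_comp]
  have hjj'' : ∀ {L : PreD A} (χ : Hom L Y), comp j (comp j' χ) = χ := fun χ => by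
    rw [← comp_assoc, hjj', id_comp]
  -- The cone of `w` has underlying module `C ⊕ Y ⊕ C`, and `w` joins the two copies of `C` by `id +
  -- θ`, which is its own inverse because `θ² = 0`. Cancelling these copies leaves `Y` with the
  -- zigzag term `r (id + θ) p = r p` added to its structure map, which is `X`.
  obtain ⟨w, hω⟩ : ∃ w : Hom C (PreD.cone p),
    w = comp (coneInl p) r + comp (coneInr p) (idHom C + θ) := ⟨_, rfl⟩
  have hdl := diff_coneInl w
  have hds := diff_coneSnd w
  rw [congrArg (comp (coneInr w)) hω] at hdl
  rw [congrArg (fun φ => comp φ (coneFst w)) hω] at hds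
  have hωm : IsMor w := by
    unfold IsMor
    simp only [hω, diff_add, diff_comp, diff_coneInl, diff_coneInr, diff_id, hr, hθ, comp_zero,
      zero_comp, add_zero, zero_add, comp_assoc, hom_add_self]
  refine IsObj.of_isHEquiv hX (hC.cone (hY.cone hC hp) hωm)
    (φ := comp (coneInr w) (comp (coneInl p) j) +
      comp (coneInl w) (comp (idHom C + θ) (comp p j))) ⟨?_, ?_⟩
  · unfold IsMor
    simp only [diff_add, diff_comp, hdl, diff_coneInl p, diff_coneInr, diff_id, hr, hp, hθ, hj,
      comp_zero, zero_comp, add_zero, zero_add, comp_assoc, comp_add, add_comp, id_comp, comp_id,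
      e1, e2, e1', e2', hrθ, hrθ', hθθ, hθθ']
    abel_nf
    simp only [two_zsmul, hom_add_self, add_zero, zero_add]
  -- The inverse of the cancellation. One composite is the identity on the nose; the homotopy for
  -- the other runs backwards along `id + θ` between the two copies of `C`.
  · refine ⟨comp j' (comp (coneFst p) (coneSnd w)) +
      comp j' (comp r (comp (coneSnd p) (coneSnd w))), ?_, ⟨0, ?_⟩,
      ⟨comp (coneInl w) (comp (idHom C + θ) (comp (coneSnd p) (coneSnd w))), ?_⟩⟩
    · unfold IsMor
      simp only [diff_add, diff_comp, diff_coneFst, hds, diff_coneSnd p, hr, hp, hθ, hj',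
        comp_zero, zero_comp, add_zero, zero_add, comp_assoc, comp_add, add_comp, id_comp, comp_id,
        coneFst_coneInl_comp, coneFst_coneInr_comp, coneSnd_coneInl_comp, coneSnd_coneInr_comp,
        e1, e2, e1', e2', hrθ, hrθ', hθθ, hθθ']
      abel_nf
      simp only [two_zsmul, hom_add_self, add_zero, zero_add]
    · unfold IsHomotopy
      simp only [comp_zero, zero_comp, add_zero, zero_add, comp_assoc, comp_add, add_comp,
        coneFst_coneInl_comp, coneFst_coneInr_comp, coneSnd_coneInl_comp, coneSnd_coneInr_comp,
        hj'j, diff_zero, hom_add_self]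
    · unfold IsHomotopy
      have hid : idHom (PreD.cone w) = comp (coneInl w) (coneFst w) +
          (comp (coneInr w) (comp (coneInl p) (comp (coneFst p) (coneSnd w))) +
          comp (coneInr w) (comp (coneInr p) (comp (coneSnd p) (coneSnd w)))) := by
        rw [← comp_add, ← comp_assoc (coneInl p), ← comp_assoc (coneInr p), ← add_comp,
          coneInl_coneFst_add, id_comp, coneInl_coneFst_add]
      rw [hid]
      simp only [diff_add, diff_comp, hdl, diff_coneInl p, diff_coneInr, diff_coneFst, hds,
        diff_coneSnd p, diff_id, hr, hp, hθ,
        comp_zero, zero_comp, add_zero, zero_add, comp_assoc, comp_add, add_comp, id_comp, comp_id,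
        coneFst_coneInl_comp, coneFst_coneInr_comp, coneSnd_coneInl_comp, coneSnd_coneInr_comp,
        e1, e2, e1', e2', hrθ, hrθ', hθθ, hθθ', hjj', hjj'']
      rw [hom_eq_iff]
      abel_nf
      simp only [two_zsmul, hom_add_self, hom_four_zsmul, add_zero, zero_add]

end PreD

namespace Typewriter

open PreD

variable {A : DGAlgebra.{u}} (M : Typewriter A)

/-- The typewriter with the carriage return removed. -/
abbrev core : Typewriter A := ⟨M.M₀, M.M₁, M.Df, M.Dh, 0⟩

/-- The typewriter `(V, V; 0, id; 0)` on the cone `V` of `D_f`. -/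
abbrev coneBox : Typewriter A := ⟨cone M.Df, cone M.Df, 0, idHom _, 0⟩

/-- The identity maps from `M` to its core. -/
def toCore : Tuple M M.core := ⟨idHom _, idHom _, 0, 0, 0⟩

/-- The identity maps from the core of `M` to `M`. -/
def ofCore : Tuple M.core M := ⟨idHom _, idHom _, 0, 0, 0⟩

/-- The first factor of the carriage return part of the structure map of `M`. -/
def coreToBox : Tuple M.core M.coneBox :=
  ⟨comp (coneInr M.Df) M.Dh, coneInr M.Df, coneInl M.Df, 0, 0⟩

/-- The second factor of the carriage return part of the structure map of `M`. -/
def boxToCore : Tuple M.coneBox M.core :=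
  ⟨0, 0, 0, 0, comp M.CR (coneSnd (0 : Hom (cone M.Df) (cone M.Df)))⟩

/-- The homotopy that trivializes the composite of the two factors. -/
def boxHomotopy : Tuple M.coneBox M.coneBox :=
  ⟨0, 0, 0, 0, comp (coneInl (idHom (cone M.Df))) (comp (coneInr M.Df)
    (comp (coneSnd M.Dh) (comp M.CR (coneSnd (0 : Hom (cone M.Df) (cone M.Df))))))⟩

namespace Tuple

theorem comp_ofCore_toCore : Tuple.comp M.ofCore M.toCore = Tuple.id M := by
  refine Tuple.ext' (PreD.comp_id _) (PreD.comp_id _) ?_ ?_ ?_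
  · change PreD.comp _ 0 + PreD.comp 0 _ = 0
    rw [PreD.comp_zero, PreD.zero_comp, add_zero]
  · change PreD.comp _ 0 + PreD.comp 0 _ = 0
    rw [PreD.comp_zero, PreD.zero_comp, add_zero]
  · change PreD.comp _ 0 + PreD.comp 0 _ = 0
    rw [PreD.comp_zero, PreD.zero_comp, add_zero]

theorem comp_toCore_ofCore : Tuple.comp M.toCore M.ofCore = Tuple.id M.core := by
  refine Tuple.ext' (PreD.comp_id _) (PreD.comp_id _) ?_ ?_ ?_
  · change PreD.comp _ 0 + PreD.comp 0 _ = 0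
    rw [PreD.comp_zero, PreD.zero_comp, add_zero]
  · change PreD.comp _ 0 + PreD.comp 0 _ = 0
    rw [PreD.comp_zero, PreD.zero_comp, add_zero]
  · change PreD.comp _ 0 + PreD.comp 0 _ = 0
    rw [PreD.comp_zero, PreD.zero_comp, add_zero]

variable {M}

/-- In the cone of `D_f` the composite of `D_f` with the inclusion of `M₁` is null homotopic by
`coneInl`, which fits the zero map of the box. The square for `D_h` commutes strictly because the
other map of the box is the identity. -/
theorem isMor_coreToBox (hM : M.IsValid) : M.coreToBox.IsMor := by
  have hh : diff M.Dh = 0 := hM.h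
  refine ⟨?_, diff_coneInr _, ?_, ?_, ?_⟩
  · change diff (PreD.comp (coneInr M.Df) M.Dh) = 0
    rw [diff_comp, hh, diff_coneInr, PreD.comp_zero, PreD.zero_comp, add_zero]
  · change PreD.comp (coneInr M.Df) M.Df + PreD.comp 0 _ = diff (coneInl M.Df)
    rw [PreD.zero_comp, add_zero, diff_coneInl]
  · change PreD.comp (coneInr M.Df) M.Dh +
      PreD.comp (idHom _) (PreD.comp (coneInr M.Df) M.Dh) = diff 0
    rw [PreD.id_comp, hom_add_self, diff_zero]
  · change PreD.comp _ 0 + PreD.comp 0 _ = diff 0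
    rw [PreD.comp_zero, PreD.zero_comp, add_zero, diff_zero]

theorem coneF_eq_zero {M' : Typewriter A} {T : Tuple M M'} (h₀ : T.T₀ = 0) (h₁ : T.T₁ = 0)
    (hf : T.Tf = 0) : T.coneF = 0 := by
  rw [coneF, h₀, h₁, hf, coneMap_zero]

theorem coneH_eq_zero {M' : Typewriter A} {T : Tuple M M'} (h₀ : T.T₀ = 0) (h₁ : T.T₁ = 0)
    (hh : T.Th = 0) : T.coneH = 0 := by
  rw [coneH, h₀, h₁, hh, coneMap_zero]

theorem isMor_boxToCore (hM : M.IsValid) : M.boxToCore.IsMor := by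
  have hc : diff M.CR = 0 := hM.cr
  refine ⟨diff_zero, diff_zero, ?_, ?_, ?_⟩
  · change PreD.comp 0 _ + PreD.comp _ 0 = diff 0
    simp only [PreD.comp_zero, PreD.zero_comp, add_zero, diff_zero]
  · change PreD.comp 0 _ + PreD.comp _ 0 = diff 0
    simp only [PreD.comp_zero, PreD.zero_comp, add_zero, diff_zero]
  · rw [coneF_eq_zero rfl rfl rfl, coneH_eq_zero rfl rfl rfl, PreD.comp_zero, PreD.zero_comp]
    change 0 + 0 = diff (PreD.comp M.CR (coneSnd _))
    rw [diff_comp, hc, diff_coneSnd, PreD.zero_comp, PreD.zero_comp, PreD.comp_zero]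

/-- The differential of the identity tuple measures the difference of the two structures, which is
`D_CR`. It equals the composite of the factors because `coreToBox` maps `Cone(D_f)` identically to
the second summand of `Cone(0)`, the one that `boxToCore` sees. -/
theorem d_toCore : M.toCore.d =
    Tuple.comp M.boxToCore (Tuple.comp M.coreToBox M.toCore) := by
  refine Tuple.ext' ?_ ?_ ?_ ?_ ?_
  · change diff (idHom _) = PreD.comp 0 _
    rw [diff_id, PreD.zero_comp]
  · change diff (idHom _) = PreD.comp 0 _
    rw [diff_id, PreD.zero_comp]
  · change diff 0 + PreD.comp (idHom _) M.Df + PreD.comp M.Df (idHom _) =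
      PreD.comp 0 _ + PreD.comp 0 _
    rw [diff_zero, PreD.comp_id, PreD.id_comp, PreD.zero_comp, PreD.zero_comp, zero_add,
      hom_add_self, add_zero]
  · change diff 0 + PreD.comp (idHom _) M.Dh + PreD.comp M.Dh (idHom _) =
      PreD.comp 0 _ + PreD.comp 0 _
    rw [diff_zero, PreD.comp_id, PreD.id_comp, PreD.zero_comp, PreD.zero_comp, zero_add,
      hom_add_self, add_zero]
  · change diff 0 + PreD.comp (coneMap M.Dh M.Dh (idHom _) (idHom _) 0) M.CR + PreD.comp 0 _ =
      PreD.comp M.boxToCore.coneH _ + PreD.comp (PreD.comp M.CR (coneSnd _))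
        (coneMap M.Df (0 : Hom (cone M.Df) (cone M.Df))
          (PreD.comp (PreD.comp (coneInr M.Df) M.Dh) (idHom _))
          (PreD.comp (coneInr M.Df) (idHom _))
          (PreD.comp (coneInr M.Df) 0 + PreD.comp (coneInl M.Df) (idHom _)))
    rw [coneH_eq_zero rfl rfl rfl, coneMap_id, diff_zero, PreD.id_comp, PreD.zero_comp,
      PreD.zero_comp, zero_add, zero_add, add_zero]
    simp only [coneMap_eq, PreD.comp_id, PreD.comp_zero, PreD.comp_add, PreD.comp_assoc,
      coneSnd_coneInl_comp, coneSnd_coneInr_comp, zero_add]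
    rw [← PreD.comp_add, add_comm, coneInl_coneFst_add, PreD.comp_id]

/-- In `Cone(id)` the differential of `coneInl` is `coneInr`, while that of `coneSnd M.Dh` produces
`D_h`. These give the two entries of the map of cones induced by `coreToBox`; this is why the box
has the identity as its second map. -/
theorem d_boxHomotopy (hM : M.IsValid) : M.boxHomotopy.d =
    Tuple.comp M.coreToBox M.boxToCore := by
  have hc : diff M.CR = 0 := hM.cr
  refine Tuple.ext' ?_ ?_ ?_ ?_ ?_
  · change diff 0 = PreD.comp _ 0
    rw [diff_zero, PreD.comp_zero]
  · change diff 0 = PreD.comp _ 0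
    rw [diff_zero, PreD.comp_zero]
  · change diff 0 + PreD.comp 0 _ + PreD.comp _ 0 = PreD.comp _ 0 + PreD.comp _ 0
    simp only [diff_zero, PreD.comp_zero, PreD.zero_comp, add_zero]
  · change diff 0 + PreD.comp 0 _ + PreD.comp _ 0 = PreD.comp _ 0 + PreD.comp _ 0
    simp only [diff_zero, PreD.comp_zero, PreD.zero_comp, add_zero]
  · change diff (PreD.comp (coneInl (idHom (cone M.Df))) (PreD.comp (coneInr M.Df)
      (PreD.comp (coneSnd M.Dh) (PreD.comp M.CR (coneSnd (0 : Hom (cone M.Df) (cone M.Df))))))) +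
        PreD.comp M.boxHomotopy.coneH _ + PreD.comp _ M.boxHomotopy.coneF =
      PreD.comp (coneMap M.Dh (idHom (cone M.Df)) (PreD.comp (coneInr M.Df) M.Dh)
        (coneInr M.Df) 0) (PreD.comp M.CR (coneSnd (0 : Hom (cone M.Df) (cone M.Df)))) +
        PreD.comp 0 _
    rw [coneF_eq_zero rfl rfl rfl, coneH_eq_zero rfl rfl rfl]
    simp only [coneMap_eq, diff_comp, diff_coneInl, diff_coneInr, diff_coneSnd, hc,
      PreD.comp_zero, PreD.zero_comp, PreD.id_comp, PreD.comp_id, PreD.comp_add, PreD.add_comp,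
      PreD.comp_assoc, zero_add, add_zero]
    abel

/-- A carriage return composes only with induced maps of cones, never with another carriage return:
no nonzero path of `𝒯` passes through `g` twice. This yields `ρ θ = 0` and `θ² = 0`. -/
theorem comp_eq_zero_of_CR {M' M'' : Typewriter A} {T' : Tuple M' M''} {T : Tuple M M'}
    (h₀ : T.T₀ = 0) (h₁ : T.T₁ = 0) (hf : T.Tf = 0) (hh : T.Th = 0) (h₀' : T'.T₀ = 0)
    (h₁' : T'.T₁ = 0) (hh' : T'.Th = 0) : Tuple.comp T' T = 0 := by
  refine Tuple.ext' ?_ ?_ ?_ ?_ ?_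
  · change PreD.comp T'.T₀ T.T₀ = 0
    rw [h₀, PreD.comp_zero]
  · change PreD.comp T'.T₁ T.T₁ = 0
    rw [h₁, PreD.comp_zero]
  · change PreD.comp T'.T₁ T.Tf + PreD.comp T'.Tf T.T₀ = 0
    rw [h₀, hf, PreD.comp_zero, PreD.comp_zero, add_zero]
  · change PreD.comp T'.T₁ T.Th + PreD.comp T'.Th T.T₀ = 0
    rw [h₀, hh, PreD.comp_zero, PreD.comp_zero, add_zero]
  · change PreD.comp T'.coneH T.CR + PreD.comp T'.CR T.coneF = 0
    rw [coneF_eq_zero h₀ h₁ hf, coneH_eq_zero h₀' h₁' hh', PreD.comp_zero, PreD.zero_comp,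
      add_zero]

end Tuple

variable {M}

/-- The `DD` bimodule of a typewriter is homotopy equivalent to a bounded one. -/
theorem IsValid.isObj_dd (hM : M.IsValid) (h₀ : M.M₀.IsObj) (h₁ : M.M₁.IsObj) : M.dd.IsObj := by
  have hV : (cone M.Df).IsObj := h₀.cone h₁ hM.f
  refine IsObj.of_factorization (Y := M.core.dd) (C := M.coneBox.dd) (j := M.toCore.dd)
    (j' := M.ofCore.dd) (p := M.coreToBox.dd) (r := M.boxToCore.dd) (θ := M.boxHomotopy.dd)
    hM.isTypeD_dd (isObj_dd_of_CR_eq_zero h₀ h₁ hM.f hM.h rfl)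
    (isObj_dd_of_CR_eq_zero hV hV diff_zero diff_id rfl) ?_ ?_ (Tuple.isMor_coreToBox hM).isMor_dd
    (Tuple.isMor_boxToCore hM).isMor_dd ?_ ?_ ?_ ?_
  · rw [← Tuple.dd_comp, Tuple.comp_toCore_ofCore, Tuple.dd_id]
  · rw [← Tuple.dd_comp, Tuple.comp_ofCore_toCore, Tuple.dd_id]
  · rw [Tuple.diff_dd, Tuple.d_toCore, Tuple.dd_comp, Tuple.dd_comp]
  · rw [Tuple.diff_dd, Tuple.d_boxHomotopy hM, Tuple.dd_comp]
  · rw [← Tuple.dd_comp, Tuple.comp_eq_zero_of_CR rfl rfl rfl rfl rfl rfl rfl, Tuple.dd_zero]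
  · rw [← Tuple.dd_comp, Tuple.comp_eq_zero_of_CR rfl rfl rfl rfl rfl rfl rfl, Tuple.dd_zero]

end Typewriter

/-! ### The invariant of orthogonal pairs -/

namespace AuxGraph

/-- The connected component of a vertex. -/
def component (Γ : AuxGraph.{v, w}) (a₀ : Γ.V) : Γ.Sub where
  verts := {a | Relation.EqvGen (fun a b => Nonempty (Γ.E a b)) a₀ a}
  edges a _ := {_e | Relation.EqvGen (fun a b => Nonempty (Γ.E a b)) a₀ a}
  source_mem h := h
  target_mem {_ _ e} h := h.trans _ _ _ (.rel _ _ ⟨e⟩)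

theorem connected_component (Γ : AuxGraph.{v, w}) (a₀ : Γ.V) :
    (Γ.component a₀).toGraph.Connected := by
  have key : ∀ a b, Relation.EqvGen (fun a b => Nonempty (Γ.E a b)) a b →
      ∀ (ha : a ∈ (Γ.component a₀).verts) (hb : b ∈ (Γ.component a₀).verts),
        Relation.EqvGen (fun a b => Nonempty ((Γ.component a₀).toGraph.E a b)) ⟨a, ha⟩ ⟨b, hb⟩ := by
    intro a b h
    induction h with
    | rel a b h => exact fun ha _ => h.elim fun e => .rel _ _ ⟨⟨e, ha⟩⟩
    | refl a => exact fun _ _ => .refl _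
    | symm a b _ ih => exact fun ha hb => (ih hb ha).symm
    | trans a b c h _ ih ih' =>
      intro ha hc
      -- The intermediate vertex is joined to `a`, so the zigzag never leaves the component.
      have hb : b ∈ (Γ.component a₀).verts := Relation.EqvGen.trans _ _ _ ha h
      exact (ih ha hb).trans _ _ _ (ih' hb hc)
  refine ⟨⟨⟨a₀, .refl _⟩⟩, fun a b => key _ _ ?_ a.2 b.2⟩
  exact (Relation.EqvGen.symm _ _ a.2).trans _ _ _ b.2

end AuxGraph

/-! ### Typewriters with identified modules, and zero tuples -/

namespace Typewriter

open PreD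

variable {A : DGAlgebra.{u}} {M₀ M₁ N₀ N₁ M₀' M₁' N₀' N₁' : PreD A}

section mk'

variable (h₀ : M₀ = N₀) (h₁ : M₁ = N₁) {Df : Hom M₀ M₁} {Dh : Hom N₀ N₁}
  {CR : Hom (cone Df) (cone Dh)}

theorem isValid_mk' (o₀ : M₀.IsTypeD) (o₁ : M₁.IsTypeD) (hf : IsMor Df) (hh : IsMor Dh)
    (hc : IsMor CR) : (mk' h₀ h₁ Df Dh CR).IsValid := by
  cases h₀; cases h₁; exact ⟨o₀, o₁, hf, hh, hc⟩

theorem isObj_mk'_M₀ (o₀ : M₀.IsObj) : (mk' h₀ h₁ Df Dh CR).M₀.IsObj := by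
  cases h₀; cases h₁; exact o₀

theorem isObj_mk'_M₁ (o₁ : M₁.IsObj) : (mk' h₀ h₁ Df Dh CR).M₁.IsObj := by
  cases h₀; cases h₁; exact o₁

variable (h₀' : M₀' = N₀') (h₁' : M₁' = N₁') {Df' : Hom M₀' M₁'} {Dh' : Hom N₀' N₁'}
  {CR' : Hom (cone Df') (cone Dh')} {T₀ : Hom M₀ M₀'} {T₁ : Hom M₁ M₁'} {Tf : Hom M₀ M₁'}
  {Th : Hom N₀ N₁'} {TCR : Hom (cone Df) (cone Dh')}

/-- The squares for `h` are given with the maps `F(eᵢ')`, those for `f` with `F(eᵢ)`. Once the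
equalities of objects are eliminated, the heterogeneous equalities identify the two sets of maps. -/
theorem Tuple.isMor_mk' {S₀ : Hom N₀ N₀'} {S₁ : Hom N₁ N₁'} (e₀ : HEq T₀ S₀) (e₁ : HEq T₁ S₁)
    (m₀ : PreD.IsMor T₀) (m₁ : PreD.IsMor T₁)
    (hf : PreD.IsHomotopy Tf (PreD.comp T₁ Df) (PreD.comp Df' T₀))
    (hh : PreD.IsHomotopy Th (PreD.comp S₁ Dh) (PreD.comp Dh' S₀))
    (hc : PreD.IsHomotopy TCR (PreD.comp (coneMap Dh Dh' S₀ S₁ Th) CR)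
      (PreD.comp CR' (coneMap Df Df' T₀ T₁ Tf))) :
    (Tuple.mk' h₀ h₁ h₀' h₁' Df Dh CR Df' Dh' CR' T₀ T₁ Tf Th TCR).IsMor := by
  cases h₀; cases h₁; cases h₀'; cases h₁'; cases e₀; cases e₁
  exact ⟨m₀, m₁, hf, hh, hc⟩

theorem Tuple.isHEquiv_mk'_T₀ (h : IsHEquiv T₀) :
    IsHEquiv (Tuple.mk' h₀ h₁ h₀' h₁' Df Dh CR Df' Dh' CR' T₀ T₁ Tf Th TCR).T₀ := by
  cases h₀; cases h₁; cases h₀'; cases h₁'; exact h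

theorem Tuple.isHEquiv_mk'_T₁ (h : IsHEquiv T₁) :
    IsHEquiv (Tuple.mk' h₀ h₁ h₀' h₁' Df Dh CR Df' Dh' CR' T₀ T₁ Tf Th TCR).T₁ := by
  cases h₀; cases h₁; cases h₀'; cases h₁'; exact h

end mk'

theorem Tuple.isMor_zero {M M' : Typewriter A} : (0 : Tuple M M').IsMor := by
  refine ⟨diff_zero, diff_zero, ?_, ?_, ?_⟩
  · change PreD.comp 0 _ + PreD.comp _ 0 = diff 0
    rw [PreD.comp_zero, PreD.zero_comp, add_zero, diff_zero]
  · change PreD.comp 0 _ + PreD.comp _ 0 = diff 0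
    rw [PreD.comp_zero, PreD.zero_comp, add_zero, diff_zero]
  · rw [Tuple.coneF_eq_zero rfl rfl rfl, Tuple.coneH_eq_zero rfl rfl rfl]
    change PreD.comp 0 _ + PreD.comp _ 0 = diff 0
    rw [PreD.comp_zero, PreD.zero_comp, add_zero, diff_zero]

theorem Tuple.coneF_zero {M M' : Typewriter A} : (0 : Tuple M M').coneF = 0 :=
  Tuple.coneF_eq_zero rfl rfl rfl

theorem Tuple.coneH_zero {M M' : Typewriter A} : (0 : Tuple M M').coneH = 0 :=
  Tuple.coneH_eq_zero rfl rfl rfl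

theorem Tuple.comp_zero {M M' M'' : Typewriter A} (T : Tuple M' M'') :
    Tuple.comp T (0 : Tuple M M') = 0 := by
  refine Tuple.ext' (PreD.comp_zero _) (PreD.comp_zero _) ?_ ?_ ?_
  · change PreD.comp _ 0 + PreD.comp _ 0 = 0
    rw [PreD.comp_zero, PreD.comp_zero, add_zero]
  · change PreD.comp _ 0 + PreD.comp _ 0 = 0
    rw [PreD.comp_zero, PreD.comp_zero, add_zero]
  · change PreD.comp _ 0 + PreD.comp _ (Tuple.coneF 0) = 0
    rw [Tuple.coneF_zero, PreD.comp_zero, PreD.comp_zero, add_zero]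

theorem Tuple.zero_comp {M M' M'' : Typewriter A} (T : Tuple M M') :
    Tuple.comp (0 : Tuple M' M'') T = 0 := by
  refine Tuple.ext' (PreD.zero_comp _) (PreD.zero_comp _) ?_ ?_ ?_
  · change PreD.comp 0 _ + PreD.comp 0 _ = 0
    rw [PreD.zero_comp, PreD.zero_comp, add_zero]
  · change PreD.comp 0 _ + PreD.comp 0 _ = 0
    rw [PreD.zero_comp, PreD.zero_comp, add_zero]
  · change PreD.comp (Tuple.coneH 0) _ + PreD.comp 0 _ = 0
    rw [Tuple.coneH_zero, PreD.zero_comp, PreD.zero_comp, add_zero]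

theorem Tuple.homotopic_zero {M M' : Typewriter A} :
    Tuple.Homotopic (0 : Tuple M M') 0 := by
  have h : ∀ {P Q : PreD A}, PreD.IsHomotopy (0 : Hom P Q) 0 0 := fun {P Q} => by
    rw [PreD.IsHomotopy, diff_zero, add_zero]
  refine ⟨0, h, h, ?_, ?_, ?_⟩
  · rw [Tuple.coneF_zero]; exact h
  · rw [Tuple.coneH_zero]; exact h
  · have hc : (0 : Tuple M M').coneCR = 0 := by
      rw [Tuple.coneCR, Tuple.coneF_zero, Tuple.coneH_zero]
      exact coneMap_zero _ _
    rw [hc]; exact h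

end Typewriter

/-! ### The weak and strong invariance of `BFD` -/

namespace CarriageReturns

open PreD BorderedSutured

variable {A : DGAlgebra.{u}} {G : AuxData.{v, w} BorSut} {F : Invariant G A} {W : F.Witnesses}

/-- On a component of the product of the graphs of two pairs, zero morphisms of typewriters are
compatible with the morphisms of typewriters of the edges. -/
theorem nonempty_pairMaps (C : CarriageReturns W) : Nonempty C.PairMaps :=
  ⟨{
    mor := fun {p q} _ => AuxGraph.component _ ((C.connected p).1.some, (C.connected q).1.some)
    mor_connected := fun _ => AuxGraph.connected_component _ _
    tup := fun _ _ => 0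
    isMor := fun _ _ => Typewriter.Tuple.isMor_zero
    square := fun _ _ _ _ => by
      rw [Typewriter.Tuple.comp_zero, Typewriter.Tuple.zero_comp]
      exact Typewriter.Tuple.homotopic_zero }⟩

variable (C : CarriageReturns W)

theorem isValid_typewriter (hF : F.IsWeak) (p : OrthPair) (d : (C.graph p).toGraph.V) :
    (C.typewriter p d).IsValid :=
  Typewriter.isValid_mk' _ _ ((hF.onObj _).obj _).1 ((hF.onObj _).obj _).1 (hF.mor _ _)
    (hF.mor _ _) (C.cr_mor _ _)

theorem isObj_dd_typewriter (hF : F.IsWeak) (p : OrthPair) (d : (C.graph p).toGraph.V) :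
    (C.typewriter p d).dd.IsObj :=
  (C.isValid_typewriter hF p d).isObj_dd
    (Typewriter.isObj_mk'_M₀ _ _ ((hF.onObj _).obj _))
    (Typewriter.isObj_mk'_M₁ _ _ ((hF.onObj _).obj _))

theorem isMor_tuple (hF : F.IsWeak) (p : OrthPair) {d d' : (C.graph p).toGraph.V}
    (e : (C.graph p).toGraph.E d d') : (C.tuple p e).IsMor :=
  Typewriter.Tuple.isMor_mk' _ _ _ _ (C.map_eq₀ p e) (C.map_eq₁ p e) ((hF.onObj _).map _).1
    ((hF.onObj _).map _).1 (W.isHomotopy _ _) (W.isHomotopy _ _) (C.isHomotopy p e)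

theorem exists_isHInverse_tuple (hF : F.IsWeak) (p : OrthPair) {d d' : (C.graph p).toGraph.V}
    (e : (C.graph p).toGraph.E d d') : ∃ S, (C.tuple p e).IsHInverse S :=
  (C.isMor_tuple hF p e).exists_isHInverse (C.isValid_typewriter hF p d)
    (C.isValid_typewriter hF p d')
    (Typewriter.Tuple.isHEquiv_mk'_T₀ _ _ _ _ ((hF.onObj _).map _))
    (Typewriter.Tuple.isHEquiv_mk'_T₁ _ _ _ _ ((hF.onObj _).map _))

variable {C} (X : C.PairMaps)

theorem isWeak_BFD (hF : F.IsWeak) : (BFD X).IsWeak where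
  onObj p :=
    { obj := fun d => C.isObj_dd_typewriter hF p d
      map := fun e => by
        obtain ⟨S, hS⟩ := C.exists_isHInverse_tuple hF p e
        exact ⟨(C.isMor_tuple hF p e).isMor_dd, S.dd, hS.dd⟩ }
  mor φ d := (X.isMor φ d).isMor_dd
  square {p q} φ d d' e := by
    have h := (X.square φ e).dd
    rw [Typewriter.Tuple.dd_comp, Typewriter.Tuple.dd_comp] at h
    exact h

/-- Up to homotopy, the maps that `BFD` assigns to paths come from tuples assigned to paths. -/
theorem exists_pathTuple (hF : F.IsWeak) (p : OrthPair) (a b : (X.aux.graph p).V)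
    (T : Hom (((BFD X).onObj p).obj a) (((BFD X).onObj p).obj b))
    (hT : ((BFD X).onObj p).PathMap a b T) :
    ∃ T', C.PathTuple p a b T' ∧ Homotopic T T'.dd ∧ IsMor T'.dd := by
  induction hT with
  | nil =>
    refine ⟨_, PathTuple.nil, ?_, ?_⟩
    · rw [Typewriter.Tuple.dd_id]; exact Homotopic.refl _
    · rw [Typewriter.Tuple.dd_id]; exact isMor_id
  | forward _ e ih =>
    obtain ⟨T', hT', h, hm⟩ := ih
    have he := (C.isMor_tuple hF p e).isMor_dd
    refine ⟨_, hT'.forward e, ?_, ?_⟩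
    · rw [Typewriter.Tuple.dd_comp]; exact h.comp_left he
    · rw [Typewriter.Tuple.dd_comp]; exact he.comp hm
  | backward _ e hS ih =>
    obtain ⟨T', hT', h, hm⟩ := ih
    -- The given inverse of the map of bimodules need not come from a tuple; it is replaced by the
    -- image of an inverse tuple, to which it is homotopic by uniqueness.
    obtain ⟨S', hS'⟩ := C.exists_isHInverse_tuple hF p e
    refine ⟨_, hT'.backward e hS', ?_, ?_⟩
    · rw [Typewriter.Tuple.dd_comp]
      exact (h.comp_left hS.1).trans ((IsHInverse.homotopic hS hS'.dd).comp_right hm)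
    · rw [Typewriter.Tuple.dd_comp]; exact hS'.dd.1.comp hm

theorem isStrong_BFD (hF : F.IsWeak) (hC : C.IsStrong) : (BFD X).IsStrong where
  weak := isWeak_BFD X hF
  independent p a b T T' hT hT' := by
    obtain ⟨S, hS, h, _⟩ := exists_pathTuple X hF p a b T hT
    obtain ⟨S', hS', h', _⟩ := exists_pathTuple X hF p a b T' hT'
    exact (h.trans (hC p a b S S' hS hS').dd).trans h'.symm

end CarriageReturns

theorem mainTheorem5 (A : DGAlgebra.{u}) (G : AuxData.{v, w} BorderedSutured.BorSut)
    (F : Invariant G A) (hF : F.IsWeak) (W : F.Witnesses) (C : CarriageReturns W) :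
    Nonempty C.PairMaps ∧
      ∀ X : C.PairMaps, (CarriageReturns.BFD X).IsWeak ∧
        (F.IsStrong → W.IsStrong → C.IsStrong → (CarriageReturns.BFD X).IsStrong) :=
  ⟨C.nonempty_pairMaps, fun X => ⟨CarriageReturns.isWeak_BFD X hF,
    fun _ _ hC => CarriageReturns.isStrong_BFD X hF hC⟩⟩

end
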